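/- **Setting.** Consider $x_{t+1}=A(v_t)x_t+B(v_t)u_t$ with $x_t\in\mathbb R^{n_x}$, $u_t\in\mathbb R^{n_u}$, $v_t\in\mathbb R^{n_v}$ i.i.d. with law $\nu$, $A(v)=\sum_i [v]_iA_i$, $B(v)=\sum_i [v]_iB_i$; put $z_t=(x_t,u_t)\in\mathbb R^{n_z}$, $n_z=n_x+n_u$. Let $\mathcal V\in\mathbb R^{n_x\times n_z\times n_v}$ have slices $[\mathcal V]_{::i}=[A_i,B_i]$ and let $\mathcal M\in\mathbb R^{n_x\times n_z\times n_w}$ be a mode tensor with $\operatorname{rk}(\mathcal M_{(3)})=\operatorname{rk}([\mathcal M_{(3)};\mathcal V_{(3)}])=n_w$, where $\mathcal T_{(n)}$ is the mode-$n$ matricization. Put $w=(\mathcal M_{(3)}^\top)^\dagger\mathcal V_{(3)}^\top v$ for $v\sim\nu$, assume $\|w\|_2\le r_w$ a.s., and let $W_\star=\mathbb E[ww^\top]$. For symmetric $W$, $Z$ let $$\mathcal E(W;Z)=\mathcal M_{(1)}(W\otimes Z)\mathcal M_{(1)}^\top,\qquad \mathcal E_\star=\mathcal E(W_\star;\cdot),\qquad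 \Pi_K(X)=[I;K]\,X\,[I,K^\top],$$ and let $\rho$ denote the spectral radius of a linear map on symmetric matrices. Let $Q\succ0$, $R\succ0$, $H=\operatorname{diag}(Q,R)$. **Data.** We observe $(x_{i+1},z_i)_{i=1}^N$, $z_i=(x_i,u_i)$, $x_{i+1}=A(v_i)x_i+B(v_i)u_i$, where the pairs $(z_i,v_i)$ are independent, $v_i\sim\nu$ is independent of $z_i$, and the $z_i$ are identically distributed with a law dominated by the Lebesgue measure; $N\ge n_z(n_z+1)/2$. Let $\operatorname{svec}$ be the isometric vectorization of symmetric matrices, let $\circledast$ denote the symmetrized Kronecker product (so $z\circledast z=\operatorname{svec}(zz^\top)$), and let $\mathcal W=\mathcal M\circledast\mathcal M$ and $\bar\times_2$ be the mode-2 vector product. The least squares estimate $\hat W$ is given by $\operatorname{svec}(\hat W)=\mathbf Z_N^\dagger Y_N$, where $\mathbf Z_N$ stacks the matrices $\mathcal W\,\bar\times_2\,(z_i\circledast z_i)$ and $Y_N$ stacks $x_{i+1}\circledast x_{i+1}$. Let $\mathbf W(Z)=\mathcal W_{(3)}\big((Z\circledast Z)\otimes I\big)\mathcal W_{(3)}^\top$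 and let $\mathcal H_i$ be the linear map on symmetric $n_w\times n_w$ matrices whose matrix in $\operatorname{svec}$ coordinates is $\big[\sum_j\mathbf W(z_jz_j^\top)\big]^\dagger\mathbf W(z_iz_i^\top)$; $\|\mathcal H_i\|_2=\max\{\|\mathcal H_i(X)\|_2: X=X^\top,\ \|X\|_2\le1\}$. For $\delta\in(0,1)$ put $$\beta_W=r_w^2\Big(\sum_{i=1}^N\|\mathcal H_i\|_2^2\Big)^{1/2}\sqrt{2\log(2n_w/\delta)},\qquad \underline W=\hat W-\beta_WI,\qquad \overline W=\hat W+\beta_WI .$$ **Control problems.** Let $x_0$ be a square integrable initial state, independent of $(v_t)_{t\ge0}$, and $X_0=\mathbb E[x_0x_0^\top]$. * $\mathrm{Val}(\mathrm{LQR}_\star)$ is the infimum of $\mathbb E\big[\sum_{t\ge0}x_t^\top Qx_t+u_t^\top Ru_t\big]$ over the nonanticipative input sequences. * $\mathrm{Val}(\mathrm{LQR}_{cp})$ is the infimum of $\sum_{t\ge0}\operatorname{tr}[Z_tH]$ over the sequences $Z_t\succeq0$ whose upper left $n_x\times n_x$ blocks $X_t$ satisfy $X_{t+1}=\mathcal E_\star(Z_t)$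 and start at the given $X_0$. * $\mathrm{Val}(\overline{\mathrm{LQR}}_{cp})$ is the infimum, over the causal policies choosing $Z_t\succeq0$ with upper left block $X_t$ from $X_0,\dots,X_t$, of the supremum over $\underline W\preceq W\preceq\overline W$ of $\sum_{t\ge0}\operatorname{tr}[Z_tH]$ along $X_{t+1}=\mathcal E(W;Z_t)$ (only those $W$ count for which all $Z_t\succeq0$). The distributionally robust solution $(\bar P,\bar K)$ is the LQR solution of $\mathcal E(\overline W;\cdot)$: writing the adjoint of $\mathcal E(\overline W;\cdot)$ at $P$ in blocks $\begin{bmatrix}\mathcal F^*(P)&\mathcal H^*(P)^\top\\ \mathcal H^*(P)&\mathcal G^*(P)\end{bmatrix}$, $\bar P\succ0$ solves $P=Q+\mathcal F^*(P)-\mathcal H^*(P)^\top(R+\mathcal G^*(P))^{-1}\mathcal H^*(P)$ and $\bar K=-(R+\mathcal G^*(\bar P))^{-1}\mathcal H^*(\bar P)$. **Statement.** There is an event of probability at least $1-\delta$ on which the following holds whenever the robust synthesis problem is feasible, i.e. whenever there is a $K$ with $\rho(\mathcal E(W;\Pi_K(\cdot)))<1$ for all $\underline W\preceq W\preceq\overline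 W$: the pair $(\bar P,\bar K)$ exists and is unique, and 1. $\rho\big(\mathcal E_\star(\Pi_{\bar K}(\cdot))\big)<1$, that is, $\bar K$ mean-square stabilizes the true moment dynamics; 2. $\mathrm{Val}(\overline{\mathrm{LQR}}_{cp})\ \ge\ \mathrm{Val}(\mathrm{LQR}_{cp})=\mathrm{Val}(\mathrm{LQR}_\star)$. -/

import Mathlib

open MeasureTheory ProbabilityTheory Matrix
open scoped Kronecker ENNReal

namespace MultNoise

noncomputable section

/-! ### Symmetrized vectorization, pseudo-inverse, operators on symmetric matrices -/

/-- The matrix `Q_d` with `svec X = Q_d vec X`. The `d (d + 1) / 2` coordinates of `svec` are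
indexed by the unordered pairs of indices; their order is immaterial. -/
def symQ (n : Type) [DecidableEq n] : Matrix (Sym2 n) (n × n) ℝ :=
  fun s p => if Sym2.mk p.1 p.2 = s then (if p.1 = p.2 then 1 else 1 / √2) else 0

/-- `svec X`: on a symmetric `X` the coordinate at `{i, j}` is `X i i` if `i = j`, and
`√2 * X i j` otherwise. -/
def svec {n : Type} [Fintype n] [DecidableEq n] (X : Matrix n n ℝ) : Sym2 n → ℝ :=
  symQ n *ᵥ fun p => X p.1 p.2

/-- The inverse of `svec`, with values in the symmetric matrices. -/
def unsvec {n : Type} [DecidableEq n] (x : Sym2 n → ℝ) : Matrix n n ℝ :=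
  fun i j => if i = j then x (Sym2.mk i j) else x (Sym2.mk i j) / √2

/-- The symmetrized Kronecker product `V ⊛ U`. -/
def skron {m n : Type} [Fintype m] [DecidableEq m] [Fintype n] [DecidableEq n]
    (V U : Matrix m n ℝ) : Matrix (Sym2 m) (Sym2 n) ℝ :=
  (1 / 2 : ℝ) • (symQ m * (U ⊗ₖ V + V ⊗ₖ U) * (symQ n)ᵀ)

/-- The Moore-Penrose pseudo-inverse `A† = (AᵀA)† Aᵀ`, where `(AᵀA)†` inverts the nonzero
eigenvalues of `AᵀA`. -/
def pinv {m n : Type} [Fintype m] [Fintype n] [DecidableEq n] (A : Matrix m n ℝ) :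
    Matrix n m ℝ :=
  let h : (Aᴴ * A).IsHermitian := Matrix.isHermitian_conjTranspose_mul_self A
  (h.eigenvectorUnitary : Matrix n n ℝ) * Matrix.diagonal (fun i => (h.eigenvalues i)⁻¹) *
    star (h.eigenvectorUnitary : Matrix n n ℝ) * Aᵀ

/-- The matrix, in `svec` coordinates, of a linear map `S` between spaces of symmetric
matrices. -/
def opMatrix {m n : Type} [Fintype m] [DecidableEq m] [DecidableEq n]
    (S : Matrix n n ℝ → Matrix m m ℝ) : Matrix (Sym2 m) (Sym2 n) ℝ :=
  fun p q => svec (S (unsvec (Pi.single q 1))) p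

/-- The spectral radius of a linear map between symmetric matrices: that of its matrix (over
the complex numbers). -/
def rho {n : Type} [Fintype n] [DecidableEq n] (S : Matrix n n ℝ → Matrix n n ℝ) : ℝ≥0∞ :=
  spectralRadius ℂ ((opMatrix S).map Complex.ofReal)

/-- The spectral norm of a matrix. -/
def specNorm {n : Type} [Fintype n] [DecidableEq n] (X : Matrix n n ℝ) : ℝ :=
  ‖Matrix.toEuclideanCLM (n := n) (𝕜 := ℝ) X‖

/-- The norm `max {‖S X‖ : X symmetric, ‖X‖ ≤ 1}` (spectral norms) of the linear map `S` on the
symmetric matrices whose matrix in `svec` coordinates is `L`. -/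
def symOpNorm {n : Type} [Fintype n] [DecidableEq n] (L : Matrix (Sym2 n) (Sym2 n) ℝ) : ℝ :=
  sSup {r : ℝ | ∃ X : Matrix n n ℝ, X.IsSymm ∧ specNorm X ≤ 1 ∧
    r = specNorm (unsvec (L *ᵥ svec X))}

/-! ### Third-order tensors -/

/-- Third-order tensors. -/
abbrev Tensor (p q r : Type) : Type := p → q → r → ℝ

/-- The mode-1 matricization. -/
def mat1 {p q r : Type} (T : Tensor p q r) : Matrix p (r × q) ℝ := fun i jk => T i jk.2 jk.1

/-- The mode-2 matricization. -/
def mat2 {p q r : Type} (T : Tensor p q r) : Matrix q (r × p) ℝ := fun j ik => T ik.2 j ik.1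

/-- The mode-3 matricization. -/
def mat3 {p q r : Type} (T : Tensor p q r) : Matrix r (q × p) ℝ := fun k ij => T ij.2 ij.1 k

/-- The Tucker operator `⟦T; X₁, X₂, X₃⟧`. -/
def tucker {p q r p' q' r' : Type} [Fintype p] [Fintype q] [Fintype r] (T : Tensor p q r)
    (X₁ : Matrix p' p ℝ) (X₂ : Matrix q' q ℝ) (X₃ : Matrix r' r ℝ) : Tensor p' q' r' :=
  fun i j k => ∑ a, ∑ b, ∑ c, X₁ i a * X₂ j b * X₃ k c * T a b c

/-- The mode-2 vector product. -/
def vecProd2 {p q r : Type} [Fintype q] (T : Tensor p q r) (x : q → ℝ) : Matrix p r ℝ :=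
  fun i k => ∑ j, x j * T i j k

/-- The Kronecker product `T ⊗ T` of a tensor with itself. -/
def tkron {p q r : Type} (T : Tensor p q r) : Tensor (p × p) (q × q) (r × r) :=
  fun i j k => T i.1 j.1 k.1 * T i.2 j.2 k.2

/-- The symmetrized Kronecker product `T ⊛ T` of a tensor with itself. -/
def tskron {p q r : Type} [Fintype p] [DecidableEq p] [Fintype q] [DecidableEq q]
    [Fintype r] [DecidableEq r] (T : Tensor p q r) : Tensor (Sym2 p) (Sym2 q) (Sym2 r) :=
  tucker (tkron T) (symQ p) (symQ q) (symQ r)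

/-! ### The system, its model tensor and its second moment dynamics -/

/-- `A(v) = ∑ i, v i • A i` (and likewise `B(v)`). -/
def modeSum {nv : ℕ} {m n : Type} (A : Fin nv → Matrix m n ℝ) (v : Fin nv → ℝ) :
    Matrix m n ℝ :=
  ∑ i, v i • A i

/-- The true mode tensor, with slices `[A i, B i]`. -/
def trueTensor {nx nu nv : ℕ} (A : Fin nv → Matrix (Fin nx) (Fin nx) ℝ)
    (B : Fin nv → Matrix (Fin nx) (Fin nu) ℝ) : Tensor (Fin nx) (Fin nx ⊕ Fin nu) (Fin nv) :=
  fun i j k => Matrix.fromCols (A k) (B k) i j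

/-- Model equivalence: `rank M₍₃₎ = rank [M₍₃₎; V₍₃₎] = n_w`. -/
def ModelEquivalence {nx nu nv nw : ℕ} (A : Fin nv → Matrix (Fin nx) (Fin nx) ℝ)
    (B : Fin nv → Matrix (Fin nx) (Fin nu) ℝ)
    (M : Tensor (Fin nx) (Fin nx ⊕ Fin nu) (Fin nw)) : Prop :=
  (mat3 M).rank = nw ∧ (Matrix.fromRows (mat3 M) (mat3 (trueTensor A B))).rank = nw

/-- The disturbance `w = (M₍₃₎ᵀ)† V₍₃₎ᵀ v` of the model with mode tensor `M`. -/
def modelNoise {nx nu nv nw : ℕ} (A : Fin nv → Matrix (Fin nx) (Fin nx) ℝ)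
    (B : Fin nv → Matrix (Fin nx) (Fin nu) ℝ)
    (M : Tensor (Fin nx) (Fin nx ⊕ Fin nu) (Fin nw)) (v : Fin nv → ℝ) : Fin nw → ℝ :=
  (pinv (mat3 M)ᵀ * (mat3 (trueTensor A B))ᵀ) *ᵥ v

/-- The true second moment `W⋆ = E[w wᵀ]`, when `v` has law `ν`. -/
def trueMoment {nx nu nv nw : ℕ} (A : Fin nv → Matrix (Fin nx) (Fin nx) ℝ)
    (B : Fin nv → Matrix (Fin nx) (Fin nu) ℝ)
    (M : Tensor (Fin nx) (Fin nx ⊕ Fin nu) (Fin nw)) (ν : Measure (Fin nv → ℝ)) :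
    Matrix (Fin nw) (Fin nw) ℝ :=
  fun k l => ∫ v, modelNoise A B M v k * modelNoise A B M v l ∂ν

/-- The moment dynamics `E(W; Z) = M₍₁₎ (W ⊗ Z) M₍₁₎ᵀ`. -/
def momentOp {nx nu nw : ℕ} (M : Tensor (Fin nx) (Fin nx ⊕ Fin nu) (Fin nw))
    (W : Matrix (Fin nw) (Fin nw) ℝ) (Z : Matrix (Fin nx ⊕ Fin nu) (Fin nx ⊕ Fin nu) ℝ) :
    Matrix (Fin nx) (Fin nx) ℝ :=
  mat1 M * (W ⊗ₖ Z) * (mat1 M)ᵀ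

/-- The closed-loop policy `Π_K(X) = [I; K] X [I, Kᵀ]`. -/
def policyOp {nx nu : ℕ} (K : Matrix (Fin nu) (Fin nx) ℝ) (X : Matrix (Fin nx) (Fin nx) ℝ) :
    Matrix (Fin nx ⊕ Fin nu) (Fin nx ⊕ Fin nu) ℝ :=
  Matrix.fromRows 1 K * X * Matrix.fromCols 1 Kᵀ

/-- The closed-loop moment dynamics `E_K(W; X) = E(W; Π_K(X))`. -/
def closedLoop {nx nu nw : ℕ} (M : Tensor (Fin nx) (Fin nx ⊕ Fin nu) (Fin nw))
    (W : Matrix (Fin nw) (Fin nw) ℝ) (K : Matrix (Fin nu) (Fin nx) ℝ)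
    (X : Matrix (Fin nx) (Fin nx) ℝ) : Matrix (Fin nx) (Fin nx) ℝ :=
  momentOp M W (policyOp K X)

/-! ### The Riccati equation -/

/-- The part of the mode tensor that multiplies the state. -/
def tensorA {nx nu nw : ℕ} (M : Tensor (Fin nx) (Fin nx ⊕ Fin nu) (Fin nw)) :
    Tensor (Fin nx) (Fin nx) (Fin nw) := fun i j k => M i (Sum.inl j) k

/-- The part of the mode tensor that multiplies the input. -/
def tensorB {nx nu nw : ℕ} (M : Tensor (Fin nx) (Fin nx ⊕ Fin nu) (Fin nw)) :
    Tensor (Fin nx) (Fin nu) (Fin nw) := fun i j k => M i (Sum.inr j) k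

/-- `F*(P) = 𝒜₍₂₎ (W ⊗ P) 𝒜₍₂₎ᵀ`. -/
def adjF {nx nu nw : ℕ} (M : Tensor (Fin nx) (Fin nx ⊕ Fin nu) (Fin nw))
    (W : Matrix (Fin nw) (Fin nw) ℝ) (P : Matrix (Fin nx) (Fin nx) ℝ) :
    Matrix (Fin nx) (Fin nx) ℝ :=
  mat2 (tensorA M) * (W ⊗ₖ P) * (mat2 (tensorA M))ᵀ

/-- `G*(P) = ℬ₍₂₎ (W ⊗ P) ℬ₍₂₎ᵀ`. -/
def adjG {nx nu nw : ℕ} (M : Tensor (Fin nx) (Fin nx ⊕ Fin nu) (Fin nw))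
    (W : Matrix (Fin nw) (Fin nw) ℝ) (P : Matrix (Fin nx) (Fin nx) ℝ) :
    Matrix (Fin nu) (Fin nu) ℝ :=
  mat2 (tensorB M) * (W ⊗ₖ P) * (mat2 (tensorB M))ᵀ

/-- `H*(P) = ℬ₍₂₎ (W ⊗ P) 𝒜₍₂₎ᵀ`. -/
def adjH {nx nu nw : ℕ} (M : Tensor (Fin nx) (Fin nx ⊕ Fin nu) (Fin nw))
    (W : Matrix (Fin nw) (Fin nw) ℝ) (P : Matrix (Fin nx) (Fin nx) ℝ) :
    Matrix (Fin nu) (Fin nx) ℝ :=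
  mat2 (tensorB M) * (W ⊗ₖ P) * (mat2 (tensorA M))ᵀ

/-- `(P, K)` is the LQR solution of the dynamics `E(W; ·)`: `P ≻ 0` solves the Riccati equation
`P = Q + F*(P) - H*(P)ᵀ (R + G*(P))⁻¹ H*(P)`, and `K = -(R + G*(P))⁻¹ H*(P)`. -/
def IsRiccatiPair {nx nu nw : ℕ} (M : Tensor (Fin nx) (Fin nx ⊕ Fin nu) (Fin nw))
    (Q : Matrix (Fin nx) (Fin nx) ℝ) (R : Matrix (Fin nu) (Fin nu) ℝ)
    (W : Matrix (Fin nw) (Fin nw) ℝ) (P : Matrix (Fin nx) (Fin nx) ℝ)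
    (K : Matrix (Fin nu) (Fin nx) ℝ) : Prop :=
  P.PosDef ∧
  P = Q + adjF M W P - (adjH M W P)ᵀ * (R + adjG M W P)⁻¹ * adjH M W P ∧
  K = -((R + adjG M W P)⁻¹ * adjH M W P)

/-! ### Least squares estimate and data-driven bounds -/

/-- The regressor `𝒵_N`: the stacked matrices `𝒲 ×₂ (z_i ⊛ z_i)`, with `𝒲 = M ⊛ M` and
`z ⊛ z = svec (z zᵀ)`. -/
def regressor {nx nu nw N : ℕ} (M : Tensor (Fin nx) (Fin nx ⊕ Fin nu) (Fin nw))
    (z : Fin N → Fin nx ⊕ Fin nu → ℝ) : Matrix (Fin N × Sym2 (Fin nx)) (Sym2 (Fin nw)) ℝ :=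
  fun ip r => vecProd2 (tskron M) (svec (Matrix.vecMulVec (z ip.1) (z ip.1))) ip.2 r

/-- The stacked outputs `Y_N = (x_{i+1} ⊛ x_{i+1})_i`. -/
def outputs {nx N : ℕ} (y : Fin N → Fin nx → ℝ) : Fin N × Sym2 (Fin nx) → ℝ :=
  fun ip => svec (Matrix.vecMulVec (y ip.1) (y ip.1)) ip.2

/-- The least squares estimate `Ŵ`, with `svec Ŵ = 𝒵_N† Y_N`. -/
def lsEstimate {nx nu nw N : ℕ} (M : Tensor (Fin nx) (Fin nx ⊕ Fin nu) (Fin nw))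
    (z : Fin N → Fin nx ⊕ Fin nu → ℝ) (y : Fin N → Fin nx → ℝ) :
    Matrix (Fin nw) (Fin nw) ℝ :=
  unsvec (pinv (regressor M z) *ᵥ outputs y)

/-- `𝒲(Z) = 𝒲₍₃₎ ((Z ⊛ Z) ⊗ I) 𝒲₍₃₎ᵀ`, with `𝒲 = M ⊛ M`. -/
def gramOp {nx nu nw : ℕ} (M : Tensor (Fin nx) (Fin nx ⊕ Fin nu) (Fin nw))
    (Z : Matrix (Fin nx ⊕ Fin nu) (Fin nx ⊕ Fin nu) ℝ) :
    Matrix (Sym2 (Fin nw)) (Sym2 (Fin nw)) ℝ :=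
  mat3 (tskron M) * (skron Z Z ⊗ₖ (1 : Matrix (Sym2 (Fin nx)) (Sym2 (Fin nx)) ℝ)) *
    (mat3 (tskron M))ᵀ

/-- The matrix `H_i = [∑ j, 𝒲(z_j z_jᵀ)]† 𝒲(z_i z_iᵀ)`. -/
def hMatrix {nx nu nw N : ℕ} (M : Tensor (Fin nx) (Fin nx ⊕ Fin nu) (Fin nw))
    (z : Fin N → Fin nx ⊕ Fin nu → ℝ) (i : Fin N) :
    Matrix (Sym2 (Fin nw)) (Sym2 (Fin nw)) ℝ :=
  pinv (∑ j, gramOp M (Matrix.vecMulVec (z j) (z j))) * gramOp M (Matrix.vecMulVec (z i) (z i))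

/-- `ζ_W = (∑ i, ‖H_i‖²) ^ (1/2)`, with the operator norm on symmetric matrices. -/
def zetaW {nx nu nw N : ℕ} (M : Tensor (Fin nx) (Fin nx ⊕ Fin nu) (Fin nw))
    (z : Fin N → Fin nx ⊕ Fin nu → ℝ) : ℝ :=
  √(∑ i, symOpNorm (hMatrix M z i) ^ 2)

/-- The radius `β_W = r_w² ζ_W √(2 log (2 n_w / δ))`. -/
def betaW {nx nu nw N : ℕ} (M : Tensor (Fin nx) (Fin nx ⊕ Fin nu) (Fin nw))
    (rad δ : ℝ) (z : Fin N → Fin nx ⊕ Fin nu → ℝ) : ℝ :=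
  rad ^ 2 * zetaW M z * √(2 * Real.log (2 * (nw : ℝ) / δ))

/-- The lower bound `Ŵ - β_W I`. -/
def lowerW {nx nu nw N : ℕ} (M : Tensor (Fin nx) (Fin nx ⊕ Fin nu) (Fin nw))
    (rad δ : ℝ) (z : Fin N → Fin nx ⊕ Fin nu → ℝ) (y : Fin N → Fin nx → ℝ) :
    Matrix (Fin nw) (Fin nw) ℝ :=
  lsEstimate M z y - betaW M rad δ z • (1 : Matrix (Fin nw) (Fin nw) ℝ)

/-- The upper bound `Ŵ + β_W I`. -/
def upperW {nx nu nw N : ℕ} (M : Tensor (Fin nx) (Fin nx ⊕ Fin nu) (Fin nw))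
    (rad δ : ℝ) (z : Fin N → Fin nx ⊕ Fin nu → ℝ) (y : Fin N → Fin nx → ℝ) :
    Matrix (Fin nw) (Fin nw) ℝ :=
  lsEstimate M z y + betaW M rad δ z • (1 : Matrix (Fin nw) (Fin nw) ℝ)

/-- `W₁ ⪯ W ⪯ W₂`. -/
def Between {n : Type} [Fintype n] (W₁ W₂ W : Matrix n n ℝ) : Prop :=
  (W - W₁).PosSemidef ∧ (W₂ - W).PosSemidef

/-- The data: `N` samples `(y_i, z_i)` with `z_i = (x_i, u_i)` and
`y_i = x_{i+1} = A(v_i) x_i + B(v_i) u_i`. The pairs `(z_i, v_i)` are independent, `v_i` is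
independent of `z_i` and has law `ν`, and the `z_i` are identically distributed with a law
dominated by the Lebesgue measure. -/
structure IsSample {nx nu nv N : ℕ} {Ω : Type*} [MeasurableSpace Ω] (Pr : Measure Ω)
    (A : Fin nv → Matrix (Fin nx) (Fin nx) ℝ) (B : Fin nv → Matrix (Fin nx) (Fin nu) ℝ)
    (ν : Measure (Fin nv → ℝ)) (z : Fin N → Ω → Fin nx ⊕ Fin nu → ℝ)
    (v : Fin N → Ω → Fin nv → ℝ) (y : Fin N → Ω → Fin nx → ℝ) : Prop where
  measurable_z : ∀ i, Measurable (z i)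
  measurable_v : ∀ i, Measurable (v i)
  indep : iIndepFun (fun i ω => (z i ω, v i ω)) Pr
  indep_z_v : ∀ i, IndepFun (z i) (v i) Pr
  identDistrib_z : ∀ i j, IdentDistrib (z i) (z j) Pr Pr
  dominated_z : ∀ i, Pr.map (z i) ≪ volume
  law_v : ∀ i, Pr.map (v i) = ν
  output : ∀ i, ∀ᵐ ω ∂Pr, y i ω = modeSum A (v i ω) *ᵥ (fun j => z i ω (Sum.inl j)) +
    modeSum B (v i ω) *ᵥ (fun j => z i ω (Sum.inr j))

/-! ### The optimal control problems and their optimal values -/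

/-- The state trajectory `x_{t+1} = A(v_t) x_t + B(v_t) u_t`. -/
def stateTraj {nx nu nv : ℕ} {Ω : Type*} (A : Fin nv → Matrix (Fin nx) (Fin nx) ℝ)
    (B : Fin nv → Matrix (Fin nx) (Fin nu) ℝ) (x₀ : Ω → Fin nx → ℝ) (v : ℕ → Ω → Fin nv → ℝ)
    (u : ℕ → Ω → Fin nu → ℝ) : ℕ → Ω → Fin nx → ℝ
  | 0 => x₀
  | t + 1 => fun ω =>
      modeSum A (v t ω) *ᵥ stateTraj A B x₀ v u t ω + modeSum B (v t ω) *ᵥ u t ω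

/-- The stochastic setting of the control problem: the square integrable initial state is known
at time `0`, and `v_t` has law `ν`, is independent of the information available at time `t`, and
is known at time `t + 1`. In particular the `v_t` are i.i.d. -/
structure IsControlSetting {nx nv : ℕ} {Ω : Type*} {mΩ : MeasurableSpace Ω} (μ : Measure Ω)
    (𝓕 : Filtration ℕ mΩ) (ν : Measure (Fin nv → ℝ)) (x₀ : Ω → Fin nx → ℝ)
    (v : ℕ → Ω → Fin nv → ℝ) : Prop where
  measurable_init : Measurable[𝓕 0] x₀
  memLp_init : ∀ i, MemLp (fun ω => x₀ ω i) 2 μ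
  measurable_v : ∀ t, Measurable[𝓕 (t + 1)] (v t)
  law_v : ∀ t, μ.map (v t) = ν
  indep : ∀ t, Indep (𝓕 t) (MeasurableSpace.comap (v t) inferInstance) μ

/-- The second moment `X₀ = E[x₀ x₀ᵀ]` of the initial state. -/
def initMoment {nx : ℕ} {Ω : Type*} [MeasurableSpace Ω] (μ : Measure Ω)
    (x₀ : Ω → Fin nx → ℝ) : Matrix (Fin nx) (Fin nx) ℝ :=
  fun i j => ∫ ω, x₀ ω i * x₀ ω j ∂μ

/-- The optimal value of the stochastic LQR problem: the infimum of
`E[∑ t, x_tᵀ Q x_t + u_tᵀ R u_t]` over the adapted input sequences. -/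
def valSLQR {nx nu nv : ℕ} {Ω : Type*} {mΩ : MeasurableSpace Ω} (μ : Measure Ω)
    (𝓕 : Filtration ℕ mΩ) (A : Fin nv → Matrix (Fin nx) (Fin nx) ℝ)
    (B : Fin nv → Matrix (Fin nx) (Fin nu) ℝ) (Q : Matrix (Fin nx) (Fin nx) ℝ)
    (R : Matrix (Fin nu) (Fin nu) ℝ) (x₀ : Ω → Fin nx → ℝ) (v : ℕ → Ω → Fin nv → ℝ) : ℝ≥0∞ :=
  ⨅ (u : ℕ → Ω → Fin nu → ℝ) (_ : ∀ t, Measurable[𝓕 t] (u t)),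
    ∫⁻ ω, ∑' t, ENNReal.ofReal
      (stateTraj A B x₀ v u t ω ⬝ᵥ Q *ᵥ stateTraj A B x₀ v u t ω + u t ω ⬝ᵥ R *ᵥ u t ω) ∂μ

/-- `Z_t ⪰ 0`, with upper left block `X_t`, where `X_{t+1} = E(W; Z_t)` starts at `X₀`. -/
def IsFeasible {nx nu nw : ℕ} (M : Tensor (Fin nx) (Fin nx ⊕ Fin nu) (Fin nw))
    (W : Matrix (Fin nw) (Fin nw) ℝ) (X₀ : Matrix (Fin nx) (Fin nx) ℝ)
    (Z : ℕ → Matrix (Fin nx ⊕ Fin nu) (Fin nx ⊕ Fin nu) ℝ) : Prop :=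
  (∀ t, (Z t).PosSemidef) ∧ (Z 0).toBlocks₁₁ = X₀ ∧
    ∀ t, (Z (t + 1)).toBlocks₁₁ = momentOp M W (Z t)

/-- The cost `∑ t, tr[Z_t H]` with `H = diag(Q, R)`. -/
def momentCost {nx nu : ℕ} (Q : Matrix (Fin nx) (Fin nx) ℝ) (R : Matrix (Fin nu) (Fin nu) ℝ)
    (Z : ℕ → Matrix (Fin nx ⊕ Fin nu) (Fin nx ⊕ Fin nu) ℝ) : ℝ≥0∞ :=
  ∑' t, ENNReal.ofReal (Matrix.trace (Z t * Matrix.fromBlocks Q 0 0 R))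

/-- The optimal value of the LQR problem of the moment dynamics `E(W; ·)`. -/
def valCP {nx nu nw : ℕ} (M : Tensor (Fin nx) (Fin nx ⊕ Fin nu) (Fin nw))
    (Q : Matrix (Fin nx) (Fin nx) ℝ) (R : Matrix (Fin nu) (Fin nu) ℝ)
    (W : Matrix (Fin nw) (Fin nw) ℝ) (X₀ : Matrix (Fin nx) (Fin nx) ℝ) : ℝ≥0∞ :=
  ⨅ (Z : ℕ → Matrix (Fin nx ⊕ Fin nu) (Fin nx ⊕ Fin nu) ℝ) (_ : IsFeasible M W X₀ Z),
    momentCost Q R Z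

/-- Moment policies: `Z_t` is chosen from the history `X_0, …, X_t`, subject to `Z_t ⪰ 0` and to
its upper left block being `X_t`. -/
abbrev MomentPolicy (nx nu : ℕ) : Type :=
  (t : ℕ) → (Fin (t + 1) → Matrix (Fin nx) (Fin nx) ℝ) →
    Matrix (Fin nx ⊕ Fin nu) (Fin nx ⊕ Fin nu) ℝ

/-- The constraint on a moment policy. -/
def IsAdmissible {nx nu : ℕ} (π : MomentPolicy nx nu) : Prop :=
  ∀ (t : ℕ) (h : Fin (t + 1) → Matrix (Fin nx) (Fin nx) ℝ), (∀ s, (h s).PosSemidef) →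
    (π t h).PosSemidef ∧ (π t h).toBlocks₁₁ = h (Fin.last t)

/-- The moments `Z_t` are generated by the policy `π`. -/
def Follows {nx nu : ℕ} (π : MomentPolicy nx nu)
    (Z : ℕ → Matrix (Fin nx ⊕ Fin nu) (Fin nx ⊕ Fin nu) ℝ) : Prop :=
  ∀ t, Z t = π t (fun s => (Z s).toBlocks₁₁)

/-- The optimal value of the distributionally robust LQR problem of the moment dynamics: minimize
over the policies the worst case cost over the parameters `W` with `W₁ ⪯ W ⪯ W₂`. The adversary
has to respect the constraints `Z_t ⪰ 0` as well: a `W` for which the closed loop leaves the cone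
of second moments is not counted. -/
def valDR {nx nu nw : ℕ} (M : Tensor (Fin nx) (Fin nx ⊕ Fin nu) (Fin nw))
    (Q : Matrix (Fin nx) (Fin nx) ℝ) (R : Matrix (Fin nu) (Fin nu) ℝ)
    (W₁ W₂ : Matrix (Fin nw) (Fin nw) ℝ) (X₀ : Matrix (Fin nx) (Fin nx) ℝ) : ℝ≥0∞ :=
  ⨅ (π : MomentPolicy nx nu) (_ : IsAdmissible π),
    ⨆ (W : Matrix (Fin nw) (Fin nw) ℝ) (_ : Between W₁ W₂ W)
      (Z : ℕ → Matrix (Fin nx ⊕ Fin nu) (Fin nx ⊕ Fin nu) ℝ)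
      (_ : IsFeasible M W X₀ Z ∧ Follows π Z), momentCost Q R Z

end

end MultNoise

open MultNoise

/-! The proof joins a matrix Hoeffding inequality with the monotonicity of the Riccati theory in the
second moment of the noise. The link between them is that `W⋆` itself need not lie in the confidence
interval: it is enough that the interval contains a matrix with the same moment dynamics on
symmetric matrices.

Estimation. Model equivalence makes every output exactly bilinear in `w_i` and `z_i`, so `x xᵀ` is
linear in `w wᵀ` and the normal equations give `Ŵ = ∑ H_i(w_i w_iᵀ)` (`lsEstimate_eq`). Put `W' = ∑
H_i(W⋆)`. The Gram matrix may be singular, and then `W'` need not equal `W⋆`. But `W' - W⋆` lies in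
the kernel of the Gram matrix, so it produces zero dynamics on every `z_i z_iᵀ`. Since a nonzero
quadratic form vanishes only on a Lebesgue null set, the matrices `z_i z_iᵀ` almost surely span all
symmetric matrices (`ae_linearIndependent_svec`), and `W'` and `W⋆` define the same dynamics
(`momentOp_identifiedMoment`).

Concentration. For fixed `z`, the error `Ŵ - W'` is a sum of independent centred matrices with norms
at most `c_i = ‖H_i‖ r_w²`. If `X² ⪯ c² I`, then `f(s) = tr exp(S + sX)` satisfies `f'' ≤ c² f`,
because the logarithmic mean of `eᵃ` and `eᵇ` is at most the arithmetic mean. Hence `f(1) ≤ cosh c ·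
f(0) + (sinh c / c) · f'(0)` (`trace_exp_add_le`). The linear term has mean zero, so summands are
integrated out one at a time and each costs a factor `cosh c_i ≤ exp(c_i²/2)`. No exponential of a
sum is ever split, and the variance proxy is `∑ c_i²`, as in the scalar case.

Control. The upper bound `W₂` need not be positive semidefinite, but `W₃ = W⋆ + (W₂ - W')` is. It
has the same dynamics as `W₂` on symmetric matrices, and `W₃ ⪰ W⋆`. Completing the square in the
Bellman operator (`bellman_eq`) gives existence of the Riccati solution by value iteration, its
uniqueness, and its role as a Lyapunov function. The Lyapunov decrease for `W₃` passes to the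
smaller `W⋆`, which is the stability claim.

Values. The adversary may choose `W'`, whose trajectories are trajectories of the true dynamics;
this bounds the robust value from below. The moments of a finite-cost stochastic trajectory are
feasible for the moment problem at equal cost. Conversely, linear feedback with the Riccati gain
attains `tr(P X₀)`, which is a lower bound for the moment problem. -/

namespace MultNoise

/-! ### Trace inequalities for the matrix exponential -/

section TraceExp

variable {n : Type} [Fintype n] [DecidableEq n]

open scoped MatrixOrder in
/-- The trace of a product of two positive semidefinite matrices is nonnegative. -/
theorem trace_mul_nonneg {A B : Matrix n n ℝ} (hA : A.PosSemidef) (hB : B.PosSemidef) :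
    0 ≤ (A * B).trace := by
  obtain ⟨C, rfl⟩ := CStarAlgebra.nonneg_iff_eq_star_mul_self.mp hA.nonneg
  rw [star_eq_conjTranspose, Matrix.mul_assoc, Matrix.trace_mul_comm]
  exact (hB.mul_mul_conjTranspose_same C).trace_nonneg

/-- Orthogonal diagonalization of a real symmetric matrix. -/
theorem exists_orthogonal_diagonal {A : Matrix n n ℝ} (hA : A.IsHermitian) :
    ∃ (U : Matrix n n ℝ) (a : n → ℝ), Uᵀ * U = 1 ∧ U * Uᵀ = 1 ∧ A = U * diagonal a * Uᵀ := by
  refine ⟨hA.eigenvectorUnitary, hA.eigenvalues, ?_, ?_, ?_⟩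
  · simpa [star_eq_conjTranspose] using Unitary.coe_star_mul_self hA.eigenvectorUnitary
  · simpa [star_eq_conjTranspose] using Unitary.coe_mul_star_self hA.eigenvectorUnitary
  · have := hA.spectral_theorem
    simpa [Unitary.conjStarAlgAut_apply, star_eq_conjTranspose, Function.comp_def] using this

theorem exp_orthogonal_diagonal {U : Matrix n n ℝ} (h : Uᵀ * U = 1) (a : n → ℝ) :
    NormedSpace.exp (U * diagonal a * Uᵀ) = U * diagonal (fun i => Real.exp (a i)) * Uᵀ := by
  have hU : IsUnit U := IsUnit.of_mul_eq_one_right _ h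
  have hinv : Uᵀ = U⁻¹ := (Matrix.inv_eq_left_inv h).symm
  rw [hinv, Matrix.exp_conj U _ hU, Matrix.exp_diagonal]
  congr 3
  ext i
  simp [Real.exp_eq_exp_ℝ]

/-- Two matrices that do not commute have different eigenbases, but traces of their products only
see the nonnegative weights `(UᵀV)ᵢⱼ²`. Trace inequalities thereby reduce to scalar inequalities
between pairs of eigenvalues. -/
theorem trace_orthogonal_mul {U V : Matrix n n ℝ} (f g : n → ℝ) :
    ((U * diagonal f * Uᵀ) * (V * diagonal g * Vᵀ)).trace =
      ∑ i, ∑ j, (Uᵀ * V) i j ^ 2 * (f i * g j) := by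
  have h : ((U * diagonal f * Uᵀ) * (V * diagonal g * Vᵀ)).trace =
      (diagonal f * ((Uᵀ * V) * (diagonal g * (Uᵀ * V)ᵀ))).trace := by
    rw [Matrix.transpose_mul, Matrix.transpose_transpose, Matrix.mul_assoc U, Matrix.mul_assoc U,
      Matrix.trace_mul_comm U]
    simp only [Matrix.mul_assoc]
  rw [h, Matrix.trace]
  refine Finset.sum_congr rfl fun i _ => ?_
  rw [Matrix.diag_apply, Matrix.diagonal_mul, Matrix.mul_apply, Finset.mul_sum]
  refine Finset.sum_congr rfl fun j _ => ?_
  rw [Matrix.diagonal_mul, Matrix.transpose_apply]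
  ring

theorem orthogonal_diagonal_mul {U : Matrix n n ℝ} (h : Uᵀ * U = 1) (f g : n → ℝ) :
    (U * diagonal f * Uᵀ) * (U * diagonal g * Uᵀ) = U * diagonal (fun i => f i * g i) * Uᵀ := by
  calc _ = U * diagonal f * (Uᵀ * U) * diagonal g * Uᵀ := by simp only [Matrix.mul_assoc]
    _ = _ := by rw [h, Matrix.mul_one, Matrix.mul_assoc U, Matrix.diagonal_mul_diagonal]

theorem orthogonal_diagonal_one {U : Matrix n n ℝ} (h : U * Uᵀ = 1) :
    (1 : Matrix n n ℝ) = U * diagonal (fun _ => 1) * Uᵀ := by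
  simp [h]

theorem posSemidef_exp {A : Matrix n n ℝ} (hA : A.IsHermitian) :
    (NormedSpace.exp A).PosSemidef := by
  obtain ⟨U, a, h1, -, rfl⟩ := exists_orthogonal_diagonal hA
  rw [exp_orthogonal_diagonal h1]
  exact (PosSemidef.diagonal fun i => (Real.exp_pos _).le).mul_mul_conjTranspose_same U

/-- Klein's inequality for the exponential. -/
theorem trace_exp_klein {A B : Matrix n n ℝ} (hA : A.IsHermitian) (hB : B.IsHermitian) :
    ((A - B) * NormedSpace.exp B).trace ≤
      (NormedSpace.exp A).trace - (NormedSpace.exp B).trace := by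
  obtain ⟨U, a, hU1, hU2, rfl⟩ := exists_orthogonal_diagonal hA
  obtain ⟨V, b, hV1, hV2, rfl⟩ := exists_orthogonal_diagonal hB
  -- Traces of a single matrix are padded with an identity written in the other eigenbasis. All
  -- terms then carry the same weights, and the claim becomes `(a - b) eᵇ ≤ eᵃ - eᵇ`.
  rw [exp_orthogonal_diagonal hU1, exp_orthogonal_diagonal hV1, Matrix.sub_mul, Matrix.trace_sub,
    orthogonal_diagonal_mul hV1, ← Matrix.mul_one (U * diagonal (fun i => Real.exp (a i)) * Uᵀ),
    ← Matrix.one_mul (V * diagonal (fun i => Real.exp (b i)) * Vᵀ),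
    ← Matrix.one_mul (V * diagonal (fun i => b i * Real.exp (b i)) * Vᵀ)]
  rw [show (U * diagonal a * Uᵀ * (1 * (V * diagonal (fun i => Real.exp (b i)) * Vᵀ))) =
    (U * diagonal a * Uᵀ * (V * diagonal (fun i => Real.exp (b i)) * Vᵀ)) by rw [Matrix.one_mul]]
  nth_rewrite 2 [orthogonal_diagonal_one hV2]
  rw [orthogonal_diagonal_one hU2]
  simp only [trace_orthogonal_mul, ← Finset.sum_sub_distrib]
  refine Finset.sum_le_sum fun i _ => Finset.sum_le_sum fun j _ => ?_
  have h : a i - b j + 1 ≤ Real.exp (a i - b j) := Real.add_one_le_exp _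
  have h2 : Real.exp (a i) = Real.exp (a i - b j) * Real.exp (b j) := by
    rw [← Real.exp_add]; congr 1; ring
  have h3 : (a i - b j) * Real.exp (b j) ≤ Real.exp (a i) - Real.exp (b j) := by
    rw [h2]; nlinarith [Real.exp_pos (b j)]
  nlinarith [mul_le_mul_of_nonneg_left h3 (sq_nonneg ((Uᵀ * V) i j))]

/-- The difference of the two sides vanishes at zero and has derivative `(1 - (1 - x) eˣ) / 2`,
which is nonnegative by `1 - x ≤ e⁻ˣ`. -/
theorem exp_sub_one_le (x : ℝ) (hx : 0 ≤ x) : Real.exp x - 1 ≤ x * (Real.exp x + 1) / 2 := by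
  let f : ℝ → ℝ := fun x => x * (Real.exp x + 1) / 2 - (Real.exp x - 1)
  have hf : ∀ x, HasDerivAt f ((1 * (Real.exp x + 1) + x * Real.exp x) / 2 - Real.exp x) x :=
    fun x => (((hasDerivAt_id x).mul ((Real.hasDerivAt_exp x).add_const 1)).div_const 2).sub
      ((Real.hasDerivAt_exp x).sub_const 1)
  have hmono : MonotoneOn f (Set.Ici 0) := by
    refine monotoneOn_of_deriv_nonneg (convex_Ici 0)
      (fun x _ => (hf x).continuousAt.continuousWithinAt)
      (fun x _ => (hf x).differentiableAt.differentiableWithinAt) fun x _ => ?_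
    rw [(hf x).deriv]
    have h1 := Real.add_one_le_exp (-x)
    have h2 : Real.exp (-x) * Real.exp x = 1 := by rw [← Real.exp_add]; simp
    nlinarith [Real.exp_pos x]
  have := hmono (Set.mem_Ici.2 le_rfl) (Set.mem_Ici.2 hx) hx
  simp only [f, Real.exp_zero] at this
  linarith

/-- This is the inequality between the logarithmic and the arithmetic mean of `eᵃ` and `eᵇ`, cleared
of denominators so that `a = b` is allowed. -/
theorem sub_mul_exp_sub_le (a b : ℝ) :
    (a - b) * (Real.exp a - Real.exp b) ≤ (a - b) ^ 2 * (Real.exp a + Real.exp b) / 2 := by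
  have key : ∀ a b : ℝ, b ≤ a →
      (a - b) * (Real.exp a - Real.exp b) ≤ (a - b) ^ 2 * (Real.exp a + Real.exp b) / 2 := by
    intro a b hab
    have h := exp_sub_one_le (a - b) (by linarith)
    have h2 : Real.exp a = Real.exp (a - b) * Real.exp b := by
      rw [← Real.exp_add]; congr 1; ring
    have h3 : Real.exp a - Real.exp b ≤ (a - b) * (Real.exp a + Real.exp b) / 2 := by
      rw [h2]; nlinarith [Real.exp_pos b]
    nlinarith
  rcases le_total b a with h | h
  · exact key a b h
  · have := key b a h; nlinarith

theorem trace_exp_mul_sq_le {A D : Matrix n n ℝ} {c : ℝ} (hA : A.IsHermitian)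
    (hD : (c ^ 2 • (1 : Matrix n n ℝ) - D * D).PosSemidef) :
    (NormedSpace.exp A * (D * D)).trace ≤ c ^ 2 * (NormedSpace.exp A).trace := by
  have := trace_mul_nonneg (posSemidef_exp hA) hD
  rw [Matrix.mul_sub, Matrix.trace_sub, Matrix.mul_smul, Matrix.trace_smul, Matrix.mul_one] at this
  simpa using this

/-- Weighting by a function of the first matrix is essential: it commutes with that matrix, so both
cross terms of the square have the same trace. -/
theorem trace_orthogonal_mul_sq {U V : Matrix n n ℝ} (hU : Uᵀ * U = 1)
    (hV : Vᵀ * V = 1) (hV2 : V * Vᵀ = 1) (a b f : n → ℝ) :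
    ((U * diagonal f * Uᵀ) * ((U * diagonal a * Uᵀ - V * diagonal b * Vᵀ) *
      (U * diagonal a * Uᵀ - V * diagonal b * Vᵀ))).trace =
      ∑ i, ∑ j, (Uᵀ * V) i j ^ 2 * (f i * (a i - b j) ^ 2) := by
  set F := U * diagonal f * Uᵀ with hF
  set A := U * diagonal a * Uᵀ with hA
  set B := V * diagonal b * Vᵀ with hB
  have e : (F * ((A - B) * (A - B))).trace =
      (F * A * A * 1).trace - 2 * (F * A * B).trace + (F * (B * B)).trace := by
    have h1 : F * A = A * F := by
      rw [hF, hA, orthogonal_diagonal_mul hU, orthogonal_diagonal_mul hU]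
      simp only [mul_comm]
    have h2 : (F * (B * A)).trace = (F * A * B).trace := by
      rw [← Matrix.mul_assoc, Matrix.trace_mul_comm, ← Matrix.mul_assoc, h1]
    have h3 : F * ((A - B) * (A - B)) = F * A * A - F * A * B - F * (B * A) + F * (B * B) := by
      noncomm_ring
    rw [h3, Matrix.trace_add, Matrix.trace_sub, Matrix.trace_sub, h2, Matrix.mul_one]
    ring
  rw [e, hF, hA, hB, orthogonal_diagonal_mul hU, orthogonal_diagonal_mul hU,
    orthogonal_diagonal_mul hV, orthogonal_diagonal_one hV2]
  simp only [trace_orthogonal_mul, ← Finset.sum_sub_distrib, ← Finset.sum_add_distrib,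
    Finset.mul_sum]
  refine Finset.sum_congr rfl fun i _ => Finset.sum_congr rfl fun j _ => ?_
  ring

/-- This is the source of the Hoeffding constant: it controls the increments of the derivative of
`tr exp` along a segment, in place of a formula for the second derivative. In eigenvalue pairs it is
`sub_mul_exp_sub_le`. -/
theorem trace_sub_mul_exp_sub_le {A B : Matrix n n ℝ} {c : ℝ} (hA : A.IsHermitian)
    (hB : B.IsHermitian) (hD : (c ^ 2 • (1 : Matrix n n ℝ) - (A - B) * (A - B)).PosSemidef) :
    ((A - B) * NormedSpace.exp A).trace - ((A - B) * NormedSpace.exp B).trace ≤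
      c ^ 2 * ((NormedSpace.exp A).trace + (NormedSpace.exp B).trace) / 2 := by
  have h1 := trace_exp_mul_sq_le hA hD
  have h2 := trace_exp_mul_sq_le hB hD
  suffices h : ((A - B) * NormedSpace.exp A).trace - ((A - B) * NormedSpace.exp B).trace ≤
      ((NormedSpace.exp A * ((A - B) * (A - B))).trace +
        (NormedSpace.exp B * ((A - B) * (A - B))).trace) / 2 by linarith
  clear h1 h2 hD
  obtain ⟨U, a, hU1, hU2, rfl⟩ := exists_orthogonal_diagonal hA
  obtain ⟨V, b, hV1, hV2, rfl⟩ := exists_orthogonal_diagonal hB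
  -- The square is unchanged when the difference is reversed; this lets the same formula be used
  -- with the two eigenbases exchanged.
  have hsq : (U * diagonal a * Uᵀ - V * diagonal b * Vᵀ) *
      (U * diagonal a * Uᵀ - V * diagonal b * Vᵀ) = (V * diagonal b * Vᵀ - U * diagonal a * Uᵀ) *
      (V * diagonal b * Vᵀ - U * diagonal a * Uᵀ) := by noncomm_ring
  rw [exp_orthogonal_diagonal hU1, exp_orthogonal_diagonal hV1,
    trace_orthogonal_mul_sq hU1 hV1 hV2, hsq, trace_orthogonal_mul_sq hV1 hU1 hU2]
  have hcomm : ∑ i, ∑ j, (Vᵀ * U) i j ^ 2 * (Real.exp (b i) * (b i - a j) ^ 2) =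
      ∑ i, ∑ j, (Uᵀ * V) i j ^ 2 * (Real.exp (b j) * (b j - a i) ^ 2) := by
    rw [Finset.sum_comm]
    refine Finset.sum_congr rfl fun i _ => Finset.sum_congr rfl fun j _ => ?_
    rw [show Vᵀ * U = (Uᵀ * V)ᵀ by simp [Matrix.transpose_mul], Matrix.transpose_apply]
  have e : ((U * diagonal a * Uᵀ - V * diagonal b * Vᵀ) *
        (U * diagonal (fun i => Real.exp (a i)) * Uᵀ)).trace -
      ((U * diagonal a * Uᵀ - V * diagonal b * Vᵀ) *
        (V * diagonal (fun i => Real.exp (b i)) * Vᵀ)).trace =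
      ∑ i, ∑ j, (Uᵀ * V) i j ^ 2 * ((a i - b j) * (Real.exp (a i) - Real.exp (b j))) := by
    rw [Matrix.sub_mul, Matrix.sub_mul, Matrix.trace_sub, Matrix.trace_sub,
      orthogonal_diagonal_mul hU1, orthogonal_diagonal_mul hV1,
      Matrix.trace_mul_comm (V * diagonal b * Vᵀ),
      ← Matrix.mul_one (U * diagonal (fun i => a i * Real.exp (a i)) * Uᵀ),
      ← Matrix.one_mul (V * diagonal (fun i => b i * Real.exp (b i)) * Vᵀ)]
    nth_rewrite 1 [orthogonal_diagonal_one hV2]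
    rw [orthogonal_diagonal_one hU2]
    simp only [trace_orthogonal_mul, ← Finset.sum_sub_distrib]
    refine Finset.sum_congr rfl fun i _ => Finset.sum_congr rfl fun j _ => ?_
    ring
  rw [e, hcomm, ← Finset.sum_add_distrib, Finset.sum_div]
  refine Finset.sum_le_sum fun i _ => ?_
  rw [← Finset.sum_add_distrib, Finset.sum_div]
  refine Finset.sum_le_sum fun j _ => ?_
  have := mul_le_mul_of_nonneg_left (sub_mul_exp_sub_le (a i) (b j)) (sq_nonneg ((Uᵀ * V) i j))
  calc _ ≤ _ := this
    _ = _ := by ring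

end TraceExp

/-! ### Comparison lemmas for real functions -/

section Comparison

/-- The inequality at `(s, t)` and at `(t, s)` traps `f t - f s` between `(t - s) g s` and `(t - s)
g t`. With Klein's inequality this differentiates `tr exp` along a line. -/
theorem hasDerivAt_of_subgradient {f g : ℝ → ℝ} (hg : Continuous g)
    (h : ∀ s t, (t - s) * g s ≤ f t - f s) (s : ℝ) : HasDerivAt f (g s) s := by
  rw [hasDerivAt_iff_isLittleO]
  refine Asymptotics.isLittleO_iff.2 fun ε hε => ?_
  have : ∀ᶠ t in nhds s, |g t - g s| < ε := by
    have := (Metric.continuous_iff.1 hg) s ε hε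
    obtain ⟨d, hd, hh⟩ := this
    filter_upwards [Metric.ball_mem_nhds s hd] with t ht
    exact hh t ht
  filter_upwards [this] with t ht
  have h1 := h s t
  have h2 := h t s
  rw [smul_eq_mul, Real.norm_eq_abs, Real.norm_eq_abs]
  have h3 : |f t - f s - (t - s) * g s| ≤ |(t - s) * (g t - g s)| := by
    rw [abs_of_nonneg (by linarith)]
    refine le_trans ?_ (le_abs_self _)
    nlinarith
  rw [abs_mul] at h3
  nlinarith [abs_nonneg (t - s)]

/-- The function `g(s) sinh(c(1-s)) + c f(s) cosh(c(1-s))` is constant when `f'' = c² f` and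
decreases when `f'' ≤ c² f`. The claim compares its values at the two ends of the unit interval. -/
theorem le_cosh_of_second_deriv_le {f g g' : ℝ → ℝ} {c : ℝ} (hc : 0 < c)
    (hf : ∀ s, HasDerivAt f (g s) s) (hg : ∀ s, HasDerivAt g (g' s) s)
    (h : ∀ s, g' s ≤ c ^ 2 * f s) :
    f 1 ≤ Real.cosh c * f 0 + Real.sinh c / c * g 0 := by
  let F : ℝ → ℝ := fun s => g s * Real.sinh (c * (1 - s)) + c * f s * Real.cosh (c * (1 - s))
  have hlin : ∀ s : ℝ, HasDerivAt (fun s => c * (1 - s)) (-c) s := fun s => by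
    simpa using ((hasDerivAt_id s).const_sub 1).const_mul c
  have hF : ∀ s, HasDerivAt F ((g' s - c ^ 2 * f s) * Real.sinh (c * (1 - s))) s := fun s => by
    convert! ((hg s).mul (hlin s).sinh).add (((hf s).const_mul c).mul (hlin s).cosh) using 1
    ring
  have hanti : AntitoneOn F (Set.Icc 0 1) := by
    refine antitoneOn_of_deriv_nonpos (convex_Icc 0 1)
      (fun x _ => (hF x).continuousAt.continuousWithinAt)
      (fun x _ => (hF x).differentiableAt.differentiableWithinAt) fun x hx => ?_
    rw [(hF x).deriv]
    rw [interior_Icc] at hx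
    refine mul_nonpos_of_nonpos_of_nonneg (by linarith [h x]) ?_
    rw [Real.sinh_nonneg_iff]
    exact mul_nonneg hc.le (by linarith [hx.2])
  have := hanti (Set.left_mem_Icc.2 zero_le_one) (Set.right_mem_Icc.2 zero_le_one) zero_le_one
  simp only [F, sub_self, mul_zero, Real.sinh_zero, Real.cosh_zero, sub_zero, mul_one] at this
  have h2 : f 1 ≤ (g 0 * Real.sinh c + c * f 0 * Real.cosh c) / c := by
    rw [le_div_iff₀ hc]; linarith
  refine h2.trans_eq ?_
  field_simp
  ring

end Comparison

/-! ### The pointwise bound behind matrix Hoeffding -/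

section MatrixHoeffding

variable {n : Type} [Fintype n] [DecidableEq n]

theorem differentiable_trace_mul_exp (S X : Matrix n n ℝ) :
    Differentiable ℝ fun s : ℝ => (X * NormedSpace.exp (S + s • X)).trace := by
  open scoped Matrix.Norms.Operator in
  have h1 : Differentiable ℝ (NormedSpace.exp : Matrix n n ℝ → Matrix n n ℝ) := fun A =>
    (NormedSpace.exp_analytic (𝕂 := ℝ) A).differentiableAt
  have h2 : Differentiable ℝ fun s : ℝ => S + s • X := by fun_prop
  have h3 : Differentiable ℝ fun s : ℝ => X * NormedSpace.exp (S + s • X) :=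
    (h1.comp h2).const_mul X
  exact (Matrix.traceLinearMap n ℝ ℝ).toContinuousLinearMap.differentiable.comp h3

/-- The matrix version of Hoeffding's pointwise bound. -/
theorem trace_exp_add_le {S X : Matrix n n ℝ} {c : ℝ} (hc : 0 < c) (hS : S.IsHermitian)
    (hX : X.IsHermitian) (hXc : (c ^ 2 • (1 : Matrix n n ℝ) - X * X).PosSemidef) :
    (NormedSpace.exp (S + X)).trace ≤ Real.cosh c * (NormedSpace.exp S).trace +
      Real.sinh c / c * (X * NormedSpace.exp S).trace := by
  have hY : ∀ s : ℝ, (S + s • X).IsHermitian := fun s => by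
    rw [Matrix.IsHermitian, Matrix.conjTranspose_add, Matrix.conjTranspose_smul, hS.eq, hX.eq]
    simp
  let f : ℝ → ℝ := fun s => (NormedSpace.exp (S + s • X)).trace
  let g : ℝ → ℝ := fun s => (X * NormedSpace.exp (S + s • X)).trace
  have hdg : Differentiable ℝ g := differentiable_trace_mul_exp S X
  have hsub : ∀ s t : ℝ, (S + t • X) - (S + s • X) = (t - s) • X := fun s t => by
    rw [sub_smul]; abel
  have hfg : ∀ s t, (t - s) * g s ≤ f t - f s := fun s t => by
    have := trace_exp_klein (hY t) (hY s)
    rw [hsub, Matrix.smul_mul, Matrix.trace_smul, smul_eq_mul] at this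
    exact this
  have hf : ∀ s, HasDerivAt f (g s) s := hasDerivAt_of_subgradient hdg.continuous hfg
  -- The two-matrix inequality is applied with constant `(t - s) c`. Dividing by `(t - s)²` and
  -- letting `t → s` then yields `g' ≤ c² f`.
  have hgt : ∀ s t, (t - s) * (g t - g s) ≤ (t - s) ^ 2 * (c ^ 2 * (f t + f s) / 2) := by
    intro s t
    have hD : (((t - s) * c) ^ 2 • (1 : Matrix n n ℝ) -
        ((S + t • X) - (S + s • X)) * ((S + t • X) - (S + s • X))).PosSemidef := by
      rw [hsub, Matrix.smul_mul, Matrix.mul_smul, smul_smul, mul_pow, ← pow_two, mul_smul,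
        ← smul_sub]
      exact hXc.smul (sq_nonneg _)
    have := trace_sub_mul_exp_sub_le (hY t) (hY s) hD
    rw [hsub, Matrix.smul_mul, Matrix.trace_smul, Matrix.smul_mul, Matrix.trace_smul,
      smul_eq_mul, smul_eq_mul] at this
    simp only [f, g]
    calc _ = _ := mul_sub _ _ _
      _ ≤ _ := this
      _ = _ := by ring
  have hg' : ∀ s, deriv g s ≤ c ^ 2 * f s := by
    intro s
    have h1 : Filter.Tendsto (slope g s) (nhdsWithin s {s}ᶜ) (nhds (deriv g s)) :=
      hasDerivAt_iff_tendsto_slope.1 (hdg s).hasDerivAt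
    have h2 : Filter.Tendsto (fun t => c ^ 2 * (f t + f s) / 2) (nhdsWithin s {s}ᶜ)
        (nhds (c ^ 2 * (f s + f s) / 2)) :=
      ((((hf s).continuousAt.tendsto.mono_left nhdsWithin_le_nhds).add_const _).const_mul
        _).div_const _
    have h3 := le_of_tendsto_of_tendsto h1 h2 <| by
      filter_upwards [self_mem_nhdsWithin] with t ht
      have hts : t - s ≠ 0 := sub_ne_zero.2 ht
      have hpos : 0 < (t - s) ^ 2 := by positivity
      have := hgt s t
      rw [slope_def_field]
      rw [← mul_le_mul_iff_of_pos_left hpos]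
      calc _ = (t - s) * (g t - g s) := by field_simp
        _ ≤ _ := this
    linarith
  have := le_cosh_of_second_deriv_le hc hf (fun s => (hdg s).hasDerivAt) hg'
  simpa [f, g] using this

/-- The factor of the linear term may be taken to depend on `c` only; this includes `c = 0`. -/
theorem exists_trace_exp_add_le (c : ℝ) (hc : 0 ≤ c) : ∃ k : ℝ, ∀ S X : Matrix n n ℝ,
    S.IsHermitian → X.IsHermitian → (c ^ 2 • (1 : Matrix n n ℝ) - X * X).PosSemidef →
    (NormedSpace.exp (S + X)).trace ≤ Real.cosh c * (NormedSpace.exp S).trace +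
      k * (X * NormedSpace.exp S).trace := by
  rcases hc.eq_or_lt with rfl | hc
  -- For `c = 0` the hypothesis says `-X² ⪰ 0`, which forces `X = 0`, so any factor works.
  · refine ⟨0, fun S X hS hX h => ?_⟩
    have h0 : X = 0 := by
      have h1 := h.trace_nonneg
      have h2 := (posSemidef_conjTranspose_mul_self X).trace_nonneg
      rw [hX.eq] at h2
      rw [Matrix.trace_sub] at h1
      have h3 : (Xᴴ * X).trace = 0 := by
        rw [hX.eq]; simp at h1; linarith
      exact (trace_conjTranspose_mul_self_eq_zero_iff).1 h3
    simp [h0]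
  · exact ⟨_, fun S X hS hX h => trace_exp_add_le hc hS hX h⟩

end MatrixHoeffding


/-! ### Measurability and topology of matrix spaces -/

section MeasurableMatrix

instance instMeasurableSpaceMatrix {m n : Type} : MeasurableSpace (Matrix m n ℝ) :=
  inferInstanceAs (MeasurableSpace (m → n → ℝ))

instance instBorelSpaceMatrix {m n : Type} [Countable m] [Countable n] :
    BorelSpace (Matrix m n ℝ) :=
  inferInstanceAs (BorelSpace (m → n → ℝ))

instance instSecondCountableTopologyMatrix {m n : Type} [Countable m] [Countable n] :
    SecondCountableTopology (Matrix m n ℝ) :=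
  inferInstanceAs (SecondCountableTopology (m → n → ℝ))

theorem measurable_matrix_iff {E : Type*} {m n : Type} [MeasurableSpace E]
    {X : E → Matrix m n ℝ} : Measurable X ↔ ∀ i j, Measurable fun e => X e i j :=
  ⟨fun h i j => measurable_pi_iff.1 (measurable_pi_iff.1 h i) j,
    fun h => measurable_pi_iff.2 fun i => measurable_pi_iff.2 fun j => h i j⟩

theorem continuous_matrix_exp {n : Type} [Fintype n] [DecidableEq n] :
    Continuous (NormedSpace.exp : Matrix n n ℝ → Matrix n n ℝ) := by
  open scoped Matrix.Norms.Operator in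
  exact NormedSpace.exp_continuous

theorem isClosed_posSemidef {n : Type} [Fintype n] :
    IsClosed {A : Matrix n n ℝ | A.PosSemidef} := by
  have h : {A : Matrix n n ℝ | A.PosSemidef} = {A | Aᴴ = A} ∩ ⋂ x : n → ℝ,
      {A | 0 ≤ star x ⬝ᵥ (A *ᵥ x)} := by
    ext A
    simp only [Set.mem_ofPred_eq, Set.mem_inter_iff, Set.mem_iInter]
    exact posSemidef_iff_dotProduct_mulVec
  rw [h]
  refine (isClosed_eq (by fun_prop) (by fun_prop)).inter (isClosed_iInter fun x => ?_)
  exact isClosed_le (by fun_prop) (by fun_prop)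

end MeasurableMatrix

/-! ### The spectral norm and the semidefinite order -/

section SpecNorm

variable {n : Type} [Fintype n] [DecidableEq n]

theorem isHermitian_iff_isSymm {n : Type} {X : Matrix n n ℝ} : X.IsHermitian ↔ X.IsSymm := by
  rw [Matrix.IsHermitian, Matrix.IsSymm, conjTranspose_eq_transpose_of_trivial]

/-- On eigenvalues, `c² - a²` is the product of `c - a` and `c + a`. -/
theorem posSemidef_sq_sub {X : Matrix n n ℝ} {c : ℝ} (hX : X.IsHermitian)
    (h1 : (c • (1 : Matrix n n ℝ) - X).PosSemidef) (h2 : (c • (1 : Matrix n n ℝ) + X).PosSemidef) :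
    (c ^ 2 • (1 : Matrix n n ℝ) - X * X).PosSemidef := by
  obtain ⟨U, a, hU1, hU2, rfl⟩ := exists_orthogonal_diagonal hX
  have hone : ∀ r : ℝ, r • (1 : Matrix n n ℝ) = U * diagonal (fun _ => r) * Uᵀ := fun r => by
    rw [← smul_one_eq_diagonal, Matrix.mul_smul, Matrix.smul_mul, Matrix.mul_one, hU2]
  have hUinv : IsUnit U := IsUnit.of_mul_eq_one_right _ hU1
  have key : ∀ f : n → ℝ, (U * diagonal f * Uᵀ).PosSemidef ↔ ∀ i, 0 ≤ f i := fun f => by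
    rw [← posSemidef_diagonal_iff]
    exact hUinv.posSemidef_star_right_conjugate_iff
  rw [hone, ← Matrix.sub_mul, ← Matrix.mul_sub, diagonal_sub, key] at h1
  rw [hone, ← Matrix.add_mul, ← Matrix.mul_add, diagonal_add, key] at h2
  rw [hone, orthogonal_diagonal_mul hU1, ← Matrix.sub_mul, ← Matrix.mul_sub, diagonal_sub, key]
  intro i
  have := h1 i
  have := h2 i
  nlinarith

theorem specNorm_nonneg (X : Matrix n n ℝ) : 0 ≤ specNorm X := norm_nonneg _

theorem norm_toLp_sq {n : Type} [Fintype n] (x : n → ℝ) : ‖WithLp.toLp 2 x‖ ^ 2 = x ⬝ᵥ x := by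
  rw [EuclideanSpace.norm_sq_eq]
  simp [dotProduct, pow_two]

omit [DecidableEq n] in
theorem dotProduct_mulVec_sq (X : Matrix n n ℝ) (hX : X.IsHermitian) (x : n → ℝ) :
    x ⬝ᵥ (X * X) *ᵥ x = (X *ᵥ x) ⬝ᵥ (X *ᵥ x) := by
  rw [← Matrix.mulVec_mulVec, dotProduct_mulVec, ← mulVec_transpose]
  rw [isHermitian_iff_isSymm.1 hX]

theorem specNorm_le {X : Matrix n n ℝ} {c : ℝ} (hc : 0 ≤ c) (hX : X.IsHermitian)
    (h : (c ^ 2 • (1 : Matrix n n ℝ) - X * X).PosSemidef) : specNorm X ≤ c := by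
  refine ContinuousLinearMap.opNorm_le_bound _ hc fun x => ?_
  have h1 := h.dotProduct_mulVec_nonneg x.ofLp
  rw [star_trivial, Matrix.sub_mulVec, dotProduct_sub, dotProduct_mulVec_sq X hX,
    smul_mulVec, one_mulVec, dotProduct_smul, ← norm_toLp_sq, ← norm_toLp_sq] at h1
  have h2 : ‖Matrix.toEuclideanCLM (n := n) (𝕜 := ℝ) X x‖ ^ 2 ≤ (c * ‖x‖) ^ 2 := by
    have e : Matrix.toEuclideanCLM (n := n) (𝕜 := ℝ) X x = WithLp.toLp 2 (X *ᵥ x.ofLp) := rfl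
    rw [e, mul_pow]
    simpa using h1
  exact le_of_sq_le_sq h2 (by positivity)

theorem posSemidef_sq_sub_of_specNorm_le {X : Matrix n n ℝ} {c : ℝ} (hX : X.IsHermitian)
    (h : specNorm X ≤ c) : (c ^ 2 • (1 : Matrix n n ℝ) - X * X).PosSemidef := by
  refine PosSemidef.of_dotProduct_mulVec_nonneg ?_ fun x => ?_
  · rw [Matrix.IsHermitian, conjTranspose_sub, conjTranspose_mul, hX.eq, conjTranspose_smul]
    simp
  · rw [star_trivial, Matrix.sub_mulVec, dotProduct_sub, dotProduct_mulVec_sq X hX,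
      smul_mulVec, one_mulVec, dotProduct_smul, ← norm_toLp_sq, ← norm_toLp_sq, smul_eq_mul,
      ← mul_pow, sub_nonneg]
    have := (Matrix.toEuclideanCLM (n := n) (𝕜 := ℝ) X).le_opNorm (WithLp.toLp 2 x)
    refine pow_le_pow_left₀ (norm_nonneg _) (le_trans this ?_) 2
    exact mul_le_mul_of_nonneg_right h (norm_nonneg _)

end SpecNorm

/-! ### Matrix Hoeffding inequality for independent summands -/

section MatrixHoeffdingProb

variable {n : Type} [Fintype n] [DecidableEq n] {E : Type*} [MeasurableSpace E] {τ : Measure E}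
  [IsProbabilityMeasure τ]

theorem trace_exp_nonneg {S : Matrix n n ℝ} (hS : S.IsHermitian) :
    0 ≤ (NormedSpace.exp S).trace := (posSemidef_exp hS).trace_nonneg

/-- The term of the pointwise bound that is linear in `X` integrates to zero, and only the factor
`cosh c` remains. The factor of the linear term must not depend on the sample, which is why it is
chosen before `S` and `X`. -/
theorem lintegral_trace_exp_add_le {X : E → Matrix n n ℝ} {c : ℝ} (hc : 0 ≤ c)
    (hsymm : ∀ e, (X e).IsHermitian)
    (hb : ∀ᵐ e ∂τ, (c ^ 2 • (1 : Matrix n n ℝ) - X e * X e).PosSemidef)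
    (hint : ∀ a b, Integrable (fun e => X e a b) τ) (h0 : ∀ a b, ∫ e, X e a b ∂τ = 0)
    {S : Matrix n n ℝ} (hS : S.IsHermitian) :
    ∫⁻ e, ENNReal.ofReal (NormedSpace.exp (S + X e)).trace ∂τ ≤
      ENNReal.ofReal (Real.cosh c) * ENNReal.ofReal (NormedSpace.exp S).trace := by
  obtain ⟨k, hk⟩ := exists_trace_exp_add_le (n := n) c hc
  set T := NormedSpace.exp S
  have htr : ∀ e, (X e * T).trace = ∑ a, ∑ b, X e a b * T b a := fun e => rfl
  have hint2 : Integrable (fun e => (X e * T).trace) τ := by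
    simp only [htr]
    exact integrable_finsetSum _ fun a _ => integrable_finsetSum _ fun b _ =>
      (hint a b).mul_const _
  have hzero : ∫ e, (X e * T).trace ∂τ = 0 := by
    simp only [htr]
    rw [integral_finsetSum _ fun a _ => integrable_finsetSum _ fun b _ =>
      (hint a b).mul_const _]
    refine Finset.sum_eq_zero fun a _ => ?_
    rw [integral_finsetSum _ fun b _ => (hint a b).mul_const _]
    refine Finset.sum_eq_zero fun b _ => ?_
    rw [integral_mul_const, h0, zero_mul]
  have hle : ∀ᵐ e ∂τ, (NormedSpace.exp (S + X e)).trace ≤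
      Real.cosh c * T.trace + k * (X e * T).trace := by
    filter_upwards [hb] with e he
    exact hk S (X e) hS (hsymm e) he
  have hint3 : Integrable (fun e => Real.cosh c * T.trace + k * (X e * T).trace) τ :=
    (integrable_const _).add (hint2.const_mul k)
  calc ∫⁻ e, ENNReal.ofReal (NormedSpace.exp (S + X e)).trace ∂τ
      ≤ ∫⁻ e, ENNReal.ofReal (Real.cosh c * T.trace + k * (X e * T).trace) ∂τ := by
        refine lintegral_mono_ae ?_
        filter_upwards [hle] with e he
        exact ENNReal.ofReal_le_ofReal he
    _ = ENNReal.ofReal (∫ e, (Real.cosh c * T.trace + k * (X e * T).trace) ∂τ) := by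
        rw [ofReal_integral_eq_lintegral_ofReal hint3]
        filter_upwards [hle] with e he
        exact (trace_exp_nonneg (hS.add (hsymm e))).trans he
    _ = _ := by
        rw [integral_add (integrable_const _) (hint2.const_mul k), integral_const, integral_const_mul,
          hzero, ← ENNReal.ofReal_mul (Real.cosh_pos c).le]
        simp

/-- Induction on the number of summands, with an arbitrary symmetric offset `S`: the first summand
is frozen into the offset while the others are integrated out, and is integrated last. -/
theorem lintegral_trace_exp_sum_le : ∀ {N : ℕ} {X : Fin N → E → Matrix n n ℝ} {c : Fin N → ℝ},
    (∀ i, 0 ≤ c i) → (∀ i, Measurable (X i)) → (∀ i e, (X i e).IsHermitian) →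
    (∀ i, ∀ᵐ e ∂τ, (c i ^ 2 • (1 : Matrix n n ℝ) - X i e * X i e).PosSemidef) →
    (∀ i a b, Integrable (fun e => X i e a b) τ) → (∀ i a b, ∫ e, X i e a b ∂τ = 0) →
    ∀ {S : Matrix n n ℝ}, S.IsHermitian →
    ∫⁻ w, ENNReal.ofReal (NormedSpace.exp (S + ∑ i, X i (w i))).trace
        ∂(Measure.pi fun _ : Fin N => τ) ≤
      (∏ i, ENNReal.ofReal (Real.cosh (c i))) * ENNReal.ofReal (NormedSpace.exp S).trace := by
  intro N
  induction N with
  | zero =>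
    intro X c hc hm hs hb hi h0 S hS
    simp
  | succ N ih =>
    intro X c hc hm hs hb hi h0 S hS
    have hmeas : Measurable fun p : E × (Fin N → E) =>
        ENNReal.ofReal (NormedSpace.exp (S + (X 0 p.1 + ∑ i, X (Fin.succ i) (p.2 i)))).trace := by
      refine ENNReal.measurable_ofReal.comp ?_
      have hc1 : Continuous fun A : Matrix n n ℝ => (NormedSpace.exp (S + A)).trace :=
        (continuous_matrix_exp.comp (continuous_const.add continuous_id)).matrix_trace
      refine hc1.measurable.comp (Measurable.add ((hm 0).comp measurable_fst) ?_)
      refine Finset.measurable_sum _ fun i _ => (hm i.succ).comp ?_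
      exact (measurable_pi_apply i).comp measurable_snd
    have e := (measurePreserving_piFinSuccAbove (fun _ : Fin (N + 1) => τ) 0).lintegral_comp hmeas
    have e2 : ∀ w : Fin (N + 1) → E,
        (fun p : E × (Fin N → E) => ENNReal.ofReal
          (NormedSpace.exp (S + (X 0 p.1 + ∑ i, X (Fin.succ i) (p.2 i)))).trace)
          (MeasurableEquiv.piFinSuccAbove (fun _ => E) 0 w) =
        ENNReal.ofReal (NormedSpace.exp (S + ∑ i, X i (w i))).trace := fun w => by
      simp [Fin.sum_univ_succ, MeasurableEquiv.piFinSuccAbove, Fin.insertNthEquiv, Fin.tail]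
    simp only [e2] at e
    rw [e, lintegral_prod _ hmeas.aemeasurable]
    calc _ ≤ ∫⁻ a, (∏ i : Fin N, ENNReal.ofReal (Real.cosh (c i.succ))) *
          ENNReal.ofReal (NormedSpace.exp (S + X 0 a)).trace ∂τ := by
          refine lintegral_mono fun a => ?_
          simp only [← add_assoc]
          exact ih (fun i => hc i.succ) (fun i => hm i.succ) (fun i => hs i.succ)
            (fun i => hb i.succ) (fun i => hi i.succ) (fun i => h0 i.succ) (hS.add (hs 0 a))
      _ = (∏ i : Fin N, ENNReal.ofReal (Real.cosh (c i.succ))) *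
          ∫⁻ a, ENNReal.ofReal (NormedSpace.exp (S + X 0 a)).trace ∂τ := by
          rw [lintegral_const_mul']
          exact (ENNReal.prod_lt_top fun i _ => ENNReal.ofReal_lt_top).ne
      _ ≤ (∏ i : Fin N, ENNReal.ofReal (Real.cosh (c i.succ))) *
          (ENNReal.ofReal (Real.cosh (c 0)) * ENNReal.ofReal (NormedSpace.exp S).trace) := by
          gcongr
          exact lintegral_trace_exp_add_le (hc 0) (hs 0) (hb 0) (hi 0) (h0 0) hS
      _ = _ := by rw [Fin.prod_univ_succ]; ring

/-- If `S ⪯ t I` fails, some eigenvalue exceeds `t`, and the trace of the exponential is at least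
its contribution. -/
theorem exp_mul_le_trace_exp {S : Matrix n n ℝ} (hS : S.IsHermitian) {t θ : ℝ} (hθ : 0 ≤ θ)
    (h : ¬ (t • (1 : Matrix n n ℝ) - S).PosSemidef) :
    Real.exp (θ * t) ≤ (NormedSpace.exp (θ • S)).trace := by
  obtain ⟨U, a, hU1, hU2, rfl⟩ := exists_orthogonal_diagonal hS
  have hone : t • (1 : Matrix n n ℝ) = U * diagonal (fun _ => t) * Uᵀ := by
    rw [← smul_one_eq_diagonal, Matrix.mul_smul, Matrix.smul_mul, Matrix.mul_one, hU2]
  obtain ⟨i, hi⟩ : ∃ i, t < a i := by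
    by_contra! hcon
    apply h
    rw [hone, ← Matrix.sub_mul, ← Matrix.mul_sub, diagonal_sub]
    exact (PosSemidef.diagonal fun i => sub_nonneg.2 (hcon i)).mul_mul_conjTranspose_same U
  have hsm : θ • (U * diagonal a * Uᵀ) = U * diagonal (θ • a) * Uᵀ := by
    rw [diagonal_smul, Matrix.mul_smul, Matrix.smul_mul]
  rw [hsm, exp_orthogonal_diagonal hU1, Matrix.trace_mul_cycle, hU1, Matrix.one_mul,
    Matrix.trace_diagonal]
  calc Real.exp (θ * t) ≤ Real.exp ((θ • a) i) :=
        Real.exp_le_exp.2 (mul_le_mul_of_nonneg_left hi.le hθ)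
    _ ≤ _ := Finset.single_le_sum (f := fun i => Real.exp ((θ • a) i))
        (fun j _ => (Real.exp_pos _).le) (Finset.mem_univ i)

/-- One-sided matrix Hoeffding inequality. -/
theorem measure_not_posSemidef_sub_sum_le {N : ℕ} {X : Fin N → E → Matrix n n ℝ} {c : Fin N → ℝ}
    (hc : ∀ i, 0 ≤ c i) (hm : ∀ i, Measurable (X i)) (hs : ∀ i e, (X i e).IsHermitian)
    (hb : ∀ i, ∀ᵐ e ∂τ, (c i ^ 2 • (1 : Matrix n n ℝ) - X i e * X i e).PosSemidef)
    (hi : ∀ i a b, Integrable (fun e => X i e a b) τ) (h0 : ∀ i a b, ∫ e, X i e a b ∂τ = 0)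
    (hσ : 0 < ∑ i, c i ^ 2) {t : ℝ} (ht : 0 ≤ t) :
    (Measure.pi fun _ : Fin N => τ) {w | ¬ (t • (1 : Matrix n n ℝ) - ∑ i, X i (w i)).PosSemidef} ≤
      ENNReal.ofReal (Fintype.card n * Real.exp (-t ^ 2 / (2 * ∑ i, c i ^ 2))) := by
  set σ := ∑ i, c i ^ 2 with hσdef
  -- This `θ` minimizes the Chernoff exponent `θ²σ/2 - θt`, with minimum `-t²/(2σ)`.
  set θ := t / σ with hθdef
  have hθ : 0 ≤ θ := div_nonneg ht hσ.le
  have hH : ∀ w : Fin N → E, (∑ i, X i (w i)).IsHermitian := fun w => by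
    rw [Matrix.IsHermitian, conjTranspose_sum]
    exact Finset.sum_congr rfl fun i _ => hs i (w i)
  have h1 := lintegral_trace_exp_sum_le (τ := τ) (X := fun i e => θ • X i e)
    (c := fun i => θ * c i) (fun i => mul_nonneg hθ (hc i)) (fun i => (hm i).const_smul θ)
    (fun i e => by
      rw [Matrix.IsHermitian, conjTranspose_smul, (hs i e).eq, star_trivial])
    (fun i => by
      filter_upwards [hb i] with e he
      rw [Matrix.smul_mul, Matrix.mul_smul, smul_smul, mul_pow, ← pow_two, mul_smul, ← smul_sub]
      exact he.smul (sq_nonneg _))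
    (fun i a b => (hi i a b).const_mul θ)
    (fun i a b => by
      simp only [Matrix.smul_apply, smul_eq_mul]
      rw [integral_const_mul, h0, mul_zero])
    (S := 0) isHermitian_zero
  simp only [zero_add, ← Finset.smul_sum, NormedSpace.exp_zero, Matrix.trace_one] at h1
  -- The bound `cosh x ≤ exp(x²/2)` turns the product into a single Gaussian factor with variance
  -- proxy `σ`.
  have h2 : (∏ i, ENNReal.ofReal (Real.cosh (θ * c i))) ≤
      ENNReal.ofReal (Real.exp (θ ^ 2 * σ / 2)) := by
    rw [← ENNReal.ofReal_prod_of_nonneg fun i _ => (Real.cosh_pos _).le]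
    refine ENNReal.ofReal_le_ofReal ?_
    calc ∏ i, Real.cosh (θ * c i) ≤ ∏ i, Real.exp ((θ * c i) ^ 2 / 2) :=
          Finset.prod_le_prod (fun i _ => (Real.cosh_pos _).le) fun i _ =>
            Real.cosh_le_exp_half_sq _
      _ = Real.exp (θ ^ 2 * σ / 2) := by
          rw [← Real.exp_sum, hσdef, Finset.mul_sum, Finset.sum_div]
          simp only [mul_pow]
  set f : (Fin N → E) → ℝ≥0∞ := fun w =>
    ENNReal.ofReal (NormedSpace.exp (θ • ∑ i, X i (w i))).trace with hf
  have hmono : {w : Fin N → E | ¬ (t • (1 : Matrix n n ℝ) - ∑ i, X i (w i)).PosSemidef} ⊆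
      {w | ENNReal.ofReal (Real.exp (θ * t)) ≤ f w} := fun w hw =>
    ENNReal.ofReal_le_ofReal (exp_mul_le_trace_exp (hH w) hθ hw)
  have hfm : Measurable f := by
    refine ENNReal.measurable_ofReal.comp ?_
    have hc1 : Continuous fun A : Matrix n n ℝ => (NormedSpace.exp (θ • A)).trace :=
      (continuous_matrix_exp.comp (continuous_const_smul θ)).matrix_trace
    exact hc1.measurable.comp (Finset.measurable_sum _ fun i _ =>
      (hm i).comp (measurable_pi_apply i))
  have hpos : 0 < Real.exp (θ * t) := Real.exp_pos _
  calc _ ≤ (Measure.pi fun _ : Fin N => τ) {w | ENNReal.ofReal (Real.exp (θ * t)) ≤ f w} :=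
        measure_mono hmono
    _ ≤ (∫⁻ w, f w ∂(Measure.pi fun _ : Fin N => τ)) / ENNReal.ofReal (Real.exp (θ * t)) :=
        meas_ge_le_lintegral_div hfm.aemeasurable (by simpa using hpos) ENNReal.ofReal_ne_top
    _ ≤ (ENNReal.ofReal (Real.exp (θ ^ 2 * σ / 2)) * ENNReal.ofReal (Fintype.card n)) /
          ENNReal.ofReal (Real.exp (θ * t)) := by
        gcongr
        exact h1.trans (mul_le_mul_left h2 _)
    _ = _ := by
        rw [← ENNReal.ofReal_mul (Real.exp_pos _).le, ← ENNReal.ofReal_div_of_pos hpos]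
        congr 1
        rw [mul_comm, mul_div_assoc, ← Real.exp_sub]
        congr 2
        rw [hθdef]
        field_simp
        ring

/-- Two-sided matrix Hoeffding inequality. -/
theorem measure_not_posSemidef_sum_le {N : ℕ} {X : Fin N → E → Matrix n n ℝ} {c : Fin N → ℝ}
    (hc : ∀ i, 0 ≤ c i) (hm : ∀ i, Measurable (X i)) (hs : ∀ i e, (X i e).IsHermitian)
    (hb : ∀ i, ∀ᵐ e ∂τ, (c i ^ 2 • (1 : Matrix n n ℝ) - X i e * X i e).PosSemidef)
    (hi : ∀ i a b, Integrable (fun e => X i e a b) τ) (h0 : ∀ i a b, ∫ e, X i e a b ∂τ = 0)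
    (hσ : 0 < ∑ i, c i ^ 2) {t : ℝ} (ht : 0 ≤ t) :
    (Measure.pi fun _ : Fin N => τ) {w | ¬ ((t • (1 : Matrix n n ℝ) - ∑ i, X i (w i)).PosSemidef ∧
      (t • (1 : Matrix n n ℝ) + ∑ i, X i (w i)).PosSemidef)} ≤
      ENNReal.ofReal (2 * Fintype.card n * Real.exp (-t ^ 2 / (2 * ∑ i, c i ^ 2))) := by
  have h1 := measure_not_posSemidef_sub_sum_le (τ := τ) hc hm hs hb hi h0 hσ ht
  have h2 := measure_not_posSemidef_sub_sum_le (τ := τ) (X := fun i e => - X i e) hc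
    (fun i => (hm i).neg) (fun i e => (hs i e).neg)
    (fun i => by simpa only [neg_mul_neg] using hb i) (fun i a b => (hi i a b).neg)
    (fun i a b => by simp only [Matrix.neg_apply]; rw [integral_neg, h0, neg_zero]) hσ ht
  simp only [Finset.sum_neg_distrib, sub_neg_eq_add] at h2
  have hsub : {w : Fin N → E | ¬ ((t • (1 : Matrix n n ℝ) - ∑ i, X i (w i)).PosSemidef ∧
      (t • (1 : Matrix n n ℝ) + ∑ i, X i (w i)).PosSemidef)} ⊆
      {w | ¬ (t • (1 : Matrix n n ℝ) - ∑ i, X i (w i)).PosSemidef} ∪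
      {w | ¬ (t • (1 : Matrix n n ℝ) + ∑ i, X i (w i)).PosSemidef} := fun w hw => by
    simp only [Set.mem_ofPred_eq, not_and_or] at hw
    exact hw
  refine (measure_mono hsub).trans ((measure_union_le _ _).trans ((add_le_add h1 h2).trans ?_))
  rw [← ENNReal.ofReal_add (by positivity) (by positivity)]
  exact ENNReal.ofReal_le_ofReal (by linarith)

end MatrixHoeffdingProb


/-! ### Coordinates on symmetric matrices -/

section Svec

variable {n : Type} [Fintype n] [DecidableEq n]

theorem svec_apply (X : Matrix n n ℝ) (s : Sym2 n) :
    svec X s = ∑ p : n × n, symQ n s p * X p.1 p.2 := rfl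

theorem svec_mk {X : Matrix n n ℝ} (hX : X.IsSymm) (i j : n) :
    svec X (Sym2.mk i j) = if i = j then X i j else √2 * X i j := by
  rw [svec_apply]
  split_ifs with h
  · subst h
    rw [Finset.sum_eq_single (i, i)]
    · simp [symQ]
    · rintro ⟨a, b⟩ - hp
      have : ¬ (Sym2.mk a b = Sym2.mk i i) := fun h => hp (by simpa using h)
      simp [symQ, this]
    · simp
  · have hne : (i, j) ≠ (j, i) := fun h' => h (Prod.ext_iff.1 h').1
    rw [← Finset.sum_subset (Finset.subset_univ {(i, j), (j, i)})]
    · rw [Finset.sum_pair hne]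
      have h2 : X j i = X i j := hX.apply i j
      have h3 : (√2)⁻¹ + (√2)⁻¹ = √2 := by
        have : √2 * √2 = 2 := Real.mul_self_sqrt (by norm_num)
        field_simp
        nlinarith
      simp only [symQ, h, Ne.symm h, Sym2.eq_swap, if_true, if_false, h2, one_div]
      rw [← add_mul, h3]
    · rintro ⟨a, b⟩ - hp
      have : ¬ (Sym2.mk a b = Sym2.mk i j) := fun h' => hp (by
        rcases Sym2.eq_iff.1 h' with ⟨rfl, rfl⟩ | ⟨rfl, rfl⟩ <;> simp)
      simp [symQ, this]

theorem isSymm_unsvec {n : Type} [DecidableEq n] (x : Sym2 n → ℝ) : (unsvec x).IsSymm := by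
  refine Matrix.IsSymm.ext fun i j => ?_
  simp only [unsvec, Sym2.eq_swap (a := i) (b := j), eq_comm (a := i)]

theorem unsvec_svec {X : Matrix n n ℝ} (hX : X.IsSymm) : unsvec (svec X) = X := by
  ext i j
  simp only [unsvec, svec_mk hX]
  split_ifs
  · rfl
  · field_simp

theorem svec_unsvec (x : Sym2 n → ℝ) : svec (unsvec x) = x := by
  ext s
  induction s using Sym2.ind with
  | _ i j =>
    rw [svec_mk (isSymm_unsvec x)]
    simp only [unsvec]
    split_ifs
    · rfl
    · field_simp

/-- `Qᵀ svec X = vec X` on symmetric matrices. -/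
theorem sum_symQ_mul_svec {X : Matrix n n ℝ} (hX : X.IsSymm) (p : n × n) :
    ∑ s, symQ n s p * svec X s = X p.1 p.2 := by
  obtain ⟨i, j⟩ := p
  rw [Finset.sum_eq_single (Sym2.mk i j)]
  · rw [svec_mk hX]
    simp only [symQ, if_true]
    split_ifs
    · simp
    · field_simp
  · intro s _ hs
    simp [symQ, hs.symm]
  · simp

/-- `svec` as a linear map. -/
noncomputable def svecLin (n : Type) [Fintype n] [DecidableEq n] : Matrix n n ℝ →ₗ[ℝ] (Sym2 n → ℝ) where
  toFun := svec
  map_add' X Y := by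
    ext s; simp only [svec_apply, Pi.add_apply, Matrix.add_apply, mul_add, Finset.sum_add_distrib]
  map_smul' c X := by
    ext s
    simp only [svec_apply, Pi.smul_apply, Matrix.smul_apply, smul_eq_mul, Finset.mul_sum,
      RingHom.id_apply]
    exact Finset.sum_congr rfl fun p _ => by ring

/-- `unsvec` as a linear map. -/
noncomputable def unsvecLin (n : Type) [DecidableEq n] : (Sym2 n → ℝ) →ₗ[ℝ] Matrix n n ℝ where
  toFun := unsvec
  map_add' x y := by
    ext i j; simp only [unsvec, Pi.add_apply, Matrix.add_apply]; split_ifs <;> ring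
  map_smul' c x := by
    ext i j
    simp only [unsvec, Pi.smul_apply, Matrix.smul_apply, smul_eq_mul, RingHom.id_apply]
    split_ifs <;> ring

theorem svecLin_apply (X : Matrix n n ℝ) : svecLin n X = svec X := rfl

theorem unsvecLin_apply {n : Type} [DecidableEq n] (x : Sym2 n → ℝ) : unsvecLin n x = unsvec x := rfl

theorem svec_injective {X Y : Matrix n n ℝ} (hX : X.IsSymm) (hY : Y.IsSymm)
    (h : svec X = svec Y) : X = Y := by
  rw [← unsvec_svec hX, ← unsvec_svec hY, h]

theorem isSymm_vecMulVec {n : Type} (z : n → ℝ) : (vecMulVec z z).IsSymm := by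
  refine Matrix.IsSymm.ext fun i j => ?_
  simp [vecMulVec_apply, mul_comm]

/-- The Kronecker square of `z zᵀ` is again of rank one, the outer square of `vec(z zᵀ)`; the two
equal summands cancel the factor one half. -/
theorem skron_vecMulVec (z : n → ℝ) :
    skron (vecMulVec z z) (vecMulVec z z) =
      vecMulVec (svec (vecMulVec z z)) (svec (vecMulVec z z)) := by
  have h : vecMulVec z z ⊗ₖ vecMulVec z z = vecMulVec (fun p : n × n => vecMulVec z z p.1 p.2)
      (fun p : n × n => vecMulVec z z p.1 p.2) := by
    ext p q
    simp only [kroneckerMap_apply, vecMulVec_apply]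
    ring
  rw [skron, ← two_smul ℝ, Matrix.mul_smul, Matrix.smul_mul, smul_smul, h, mul_vecMulVec,
    vecMulVec_mul, vecMul_transpose]
  norm_num
  rfl

end Svec

/-! ### The regressor and the Gram matrix in terms of the moment dynamics -/

section MomentOp

variable {nx nu nw : ℕ} (M : Tensor (Fin nx) (Fin nx ⊕ Fin nu) (Fin nw))

theorem momentOp_apply (W : Matrix (Fin nw) (Fin nw) ℝ)
    (Z : Matrix (Fin nx ⊕ Fin nu) (Fin nx ⊕ Fin nu) ℝ) (i j : Fin nx) :
    momentOp M W Z i j = ∑ b : (Fin nx ⊕ Fin nu) × (Fin nx ⊕ Fin nu), ∑ c : Fin nw × Fin nw,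
      Z b.1 b.2 * W c.1 c.2 * (M i b.1 c.1 * M j b.2 c.2) := by
  simp only [momentOp, Matrix.mul_apply, mat1, kroneckerMap_apply, Matrix.transpose_apply,
    Finset.sum_mul]
  simp only [← Fintype.sum_prod_type']
  let e : ((Fin nw × (Fin nx ⊕ Fin nu)) × (Fin nw × (Fin nx ⊕ Fin nu))) ≃
      (((Fin nx ⊕ Fin nu) × (Fin nx ⊕ Fin nu)) × (Fin nw × Fin nw)) :=
    { toFun := fun p => ((p.2.2, p.1.2), (p.2.1, p.1.1))
      invFun := fun p => ((p.2.2, p.1.2), (p.2.1, p.1.1))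
      left_inv := fun _ => rfl
      right_inv := fun _ => rfl }
  refine Fintype.sum_equiv e _ _ fun p => ?_
  simp only [e, Equiv.coe_fn_mk]
  ring

theorem isSymm_momentOp {W : Matrix (Fin nw) (Fin nw) ℝ} (hW : W.IsSymm)
    {Z : Matrix (Fin nx ⊕ Fin nu) (Fin nx ⊕ Fin nu) ℝ} (hZ : Z.IsSymm) :
    (momentOp M W Z).IsSymm := by
  rw [Matrix.IsSymm, momentOp, transpose_mul, transpose_mul, transpose_transpose,
    ← Matrix.mul_assoc, ← kroneckerMap_transpose, hW, hZ]

/-- This gives the tensor regressor its meaning: in `svec` coordinates it is the map `X ↦ E(X; Z)`.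
The factors `Q` of the symmetrized tensor are absorbed by `Qᵀ svec = vec`, which holds on symmetric
matrices only. -/
theorem vecProd2_tskron_mulVec {X : Matrix (Fin nw) (Fin nw) ℝ} (hX : X.IsSymm)
    {Z : Matrix (Fin nx ⊕ Fin nu) (Fin nx ⊕ Fin nu) ℝ} (hZ : Z.IsSymm) :
    vecProd2 (tskron M) (svec Z) *ᵥ svec X = svec (momentOp M X Z) := by
  ext i
  have h1 : (vecProd2 (tskron M) (svec Z) *ᵥ svec X) i = ∑ k, ∑ j, ∑ a, ∑ b, ∑ c,
      symQ (Fin nx) i a * ((symQ _ j b * svec Z j) * (symQ _ k c * svec X k) *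
        (M a.1 b.1 c.1 * M a.2 b.2 c.2)) := by
    simp only [mulVec, dotProduct, vecProd2, tskron, tucker, tkron, Finset.sum_mul,
      Finset.mul_sum]
    refine Finset.sum_congr rfl fun k _ => Finset.sum_congr rfl fun j _ =>
      Finset.sum_congr rfl fun a _ => Finset.sum_congr rfl fun b _ =>
      Finset.sum_congr rfl fun c _ => by ring
  have h2 : svec (momentOp M X Z) i = ∑ a, ∑ b, ∑ c, ∑ j, ∑ k,
      symQ (Fin nx) i a * ((symQ _ j b * svec Z j) * (symQ _ k c * svec X k) *
        (M a.1 b.1 c.1 * M a.2 b.2 c.2)) := by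
    rw [svec_apply]
    refine Finset.sum_congr rfl fun a _ => ?_
    rw [momentOp_apply, Finset.mul_sum]
    refine Finset.sum_congr rfl fun b _ => ?_
    rw [Finset.mul_sum]
    refine Finset.sum_congr rfl fun c _ => ?_
    rw [← sum_symQ_mul_svec hZ b, ← sum_symQ_mul_svec hX c]
    simp only [Finset.sum_mul, Finset.mul_sum]
    rw [Finset.sum_comm]
  rw [h1, h2, Finset.sum_comm]
  calc _ = ∑ j, ∑ a, ∑ k, ∑ b, ∑ c, symQ (Fin nx) i a * ((symQ _ j b * svec Z j) *
        (symQ _ k c * svec X k) * (M a.1 b.1 c.1 * M a.2 b.2 c.2)) :=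
        Finset.sum_congr rfl fun j _ => Finset.sum_comm
    _ = ∑ a, ∑ j, ∑ k, ∑ b, ∑ c, symQ (Fin nx) i a * ((symQ _ j b * svec Z j) *
        (symQ _ k c * svec X k) * (M a.1 b.1 c.1 * M a.2 b.2 c.2)) := Finset.sum_comm
    _ = ∑ a, ∑ j, ∑ b, ∑ k, ∑ c, symQ (Fin nx) i a * ((symQ _ j b * svec Z j) *
        (symQ _ k c * svec X k) * (M a.1 b.1 c.1 * M a.2 b.2 c.2)) :=
        Finset.sum_congr rfl fun a _ => Finset.sum_congr rfl fun j _ => Finset.sum_comm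
    _ = ∑ a, ∑ b, ∑ j, ∑ k, ∑ c, symQ (Fin nx) i a * ((symQ _ j b * svec Z j) *
        (symQ _ k c * svec X k) * (M a.1 b.1 c.1 * M a.2 b.2 c.2)) :=
        Finset.sum_congr rfl fun a _ => Finset.sum_comm
    _ = ∑ a, ∑ b, ∑ j, ∑ c, ∑ k, symQ (Fin nx) i a * ((symQ _ j b * svec Z j) *
        (symQ _ k c * svec X k) * (M a.1 b.1 c.1 * M a.2 b.2 c.2)) :=
        Finset.sum_congr rfl fun a _ => Finset.sum_congr rfl fun b _ =>
          Finset.sum_congr rfl fun j _ => Finset.sum_comm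
    _ = _ := Finset.sum_congr rfl fun a _ => Finset.sum_congr rfl fun b _ => Finset.sum_comm

/-- The block of the regressor that belongs to one sample. -/
noncomputable def sampleRegressor (z : Fin nx ⊕ Fin nu → ℝ) : Matrix (Sym2 (Fin nx)) (Sym2 (Fin nw)) ℝ :=
  vecProd2 (tskron M) (svec (vecMulVec z z))

/-- At a rank one argument `𝒲(Z)` is the contribution of one sample to the normal equations. -/
theorem gramOp_vecMulVec (z : Fin nx ⊕ Fin nu → ℝ) :
    gramOp M (vecMulVec z z) = (sampleRegressor M z)ᵀ * sampleRegressor M z := by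
  ext k l
  rw [gramOp, skron_vecMulVec]
  simp only [Matrix.mul_apply, mat3, kroneckerMap_apply, Matrix.transpose_apply,
    Fintype.sum_prod_type, vecMulVec_apply, sampleRegressor, vecProd2, Matrix.one_apply, mul_ite,
    mul_one, mul_zero, Finset.sum_ite_eq', Finset.mem_univ, if_true, Finset.sum_mul,
    Finset.mul_sum]
  rw [Finset.sum_comm]
  refine Finset.sum_congr rfl fun i _ => Finset.sum_congr rfl fun j _ =>
    Finset.sum_congr rfl fun j' _ => ?_
  ring

variable {N : ℕ}

theorem regressor_transpose_mul (z : Fin N → Fin nx ⊕ Fin nu → ℝ) :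
    (regressor M z)ᵀ * regressor M z = ∑ i, gramOp M (vecMulVec (z i) (z i)) := by
  ext k l
  simp only [gramOp_vecMulVec, Matrix.sum_apply, Matrix.mul_apply, Fintype.sum_prod_type,
    Matrix.transpose_apply]
  rfl

theorem regressor_transpose_mulVec (z : Fin N → Fin nx ⊕ Fin nu → ℝ)
    (Y : Fin N → Sym2 (Fin nx) → ℝ) :
    (regressor M z)ᵀ *ᵥ (fun ip => Y ip.1 ip.2) = ∑ i, (sampleRegressor M (z i))ᵀ *ᵥ Y i := by
  ext k
  simp only [Finset.sum_apply, mulVec, dotProduct, Fintype.sum_prod_type, Matrix.transpose_apply]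
  rfl

/-- A sum of Gram matrices annihilates `d` only if each one does, because `dᵀ(∑ G_i)d` is the sum of
the squared lengths of the sample residuals. -/
theorem sampleRegressor_mulVec_eq_zero (z : Fin N → Fin nx ⊕ Fin nu → ℝ)
    {d : Sym2 (Fin nw) → ℝ} (h : (∑ i, gramOp M (vecMulVec (z i) (z i))) *ᵥ d = 0) (i : Fin N) :
    sampleRegressor M (z i) *ᵥ d = 0 := by
  have h1 : ∑ i, (sampleRegressor M (z i) *ᵥ d) ⬝ᵥ (sampleRegressor M (z i) *ᵥ d) = 0 := by
    have : d ⬝ᵥ ((∑ i, gramOp M (vecMulVec (z i) (z i))) *ᵥ d) = 0 := by rw [h, dotProduct_zero]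
    rw [sum_mulVec, dotProduct_sum] at this
    rw [← this]
    refine Finset.sum_congr rfl fun i _ => ?_
    rw [gramOp_vecMulVec, ← mulVec_mulVec, dotProduct_mulVec d, vecMul_transpose]
  rw [Finset.sum_eq_zero_iff_of_nonneg fun i _ => by
    rw [← norm_toLp_sq]; exact sq_nonneg _] at h1
  exact dotProduct_self_eq_zero.1 (h1 i (Finset.mem_univ i))

end MomentOp


/-! ### The Moore-Penrose inverse -/

section Pinv

variable {m n : Type} [Fintype m] [Fintype n] [DecidableEq n]

theorem exists_pinv_eq (A : Matrix m n ℝ) : ∃ (U : Matrix n n ℝ) (a : n → ℝ), Uᵀ * U = 1 ∧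
    U * Uᵀ = 1 ∧ Aᵀ * A = U * diagonal a * Uᵀ ∧ (∀ i, 0 ≤ a i) ∧
    pinv A = U * diagonal (fun i => (a i)⁻¹) * Uᵀ * Aᵀ := by
  have h : (Aᴴ * A).IsHermitian := isHermitian_conjTranspose_mul_self A
  refine ⟨h.eigenvectorUnitary, h.eigenvalues, ?_, ?_, ?_, ?_, ?_⟩
  · simpa [star_eq_conjTranspose] using Unitary.coe_star_mul_self h.eigenvectorUnitary
  · simpa [star_eq_conjTranspose] using Unitary.coe_mul_star_self h.eigenvectorUnitary
  · have := h.spectral_theorem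
    simpa [Unitary.conjStarAlgAut_apply, star_eq_conjTranspose, Function.comp_def] using this
  · exact fun i => (posSemidef_conjTranspose_mul_self A).eigenvalues_nonneg i
  · simp only [pinv, star_eq_conjTranspose, conjTranspose_eq_transpose_of_trivial]

/-- The four Moore-Penrose conditions. -/
structure IsMoorePenrose (A : Matrix m n ℝ) (B : Matrix n m ℝ) : Prop where
  mul_mul_left : A * B * A = A
  mul_mul_right : B * A * B = B
  symm_left : (A * B)ᵀ = A * B
  symm_right : (B * A)ᵀ = B * A

omit [DecidableEq n] in
-- The products `AB` and `AC` are symmetric projections that absorb each other, hence coincide;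
-- likewise `BA` and `CA`. Uniqueness makes the choice of eigenbasis in `pinv` irrelevant.
theorem IsMoorePenrose.eq {A : Matrix m n ℝ} {B C : Matrix n m ℝ} (hB : IsMoorePenrose A B)
    (hC : IsMoorePenrose A C) : B = C := by
  have h1 : A * B = A * C := by
    calc A * B = (A * C * A) * B := by rw [hC.mul_mul_left]
      _ = (A * C)ᵀ * (A * B)ᵀ := by rw [hC.symm_left, hB.symm_left]; simp only [Matrix.mul_assoc]
      _ = ((A * B * A) * C)ᵀ := by rw [← transpose_mul]; simp only [Matrix.mul_assoc]
      _ = A * C := by rw [hB.mul_mul_left, hC.symm_left]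
  have h2 : B * A = C * A := by
    calc B * A = B * (A * C * A) := by rw [hC.mul_mul_left]
      _ = (B * A)ᵀ * (C * A)ᵀ := by rw [hC.symm_right, hB.symm_right]; simp only [Matrix.mul_assoc]
      _ = (C * (A * B * A))ᵀ := by rw [← transpose_mul]; simp only [Matrix.mul_assoc]
      _ = C * A := by rw [hB.mul_mul_left, hC.symm_right]
  calc B = B * A * B := hB.mul_mul_right.symm
    _ = C * (A * B) := by rw [h2, Matrix.mul_assoc]
    _ = C * A * C := by rw [h1, Matrix.mul_assoc]
    _ = C := hC.mul_mul_right

theorem isMoorePenrose_pinv (A : Matrix m n ℝ) : IsMoorePenrose A (pinv A) := by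
  obtain ⟨U, a, hU1, hU2, hS, -, hp⟩ := exists_pinv_eq A
  set D := U * diagonal (fun i => (a i)⁻¹) * Uᵀ with hD
  have hDt : Dᵀ = D := by
    rw [hD, transpose_mul, transpose_mul, transpose_transpose, diagonal_transpose,
      Matrix.mul_assoc]
  have hpS : pinv A * A = U * diagonal (fun i => (a i)⁻¹ * a i) * Uᵀ := by
    rw [hp, Matrix.mul_assoc, hS, hD, orthogonal_diagonal_mul hU1]
  have hsr : (pinv A * A)ᵀ = pinv A * A := by
    rw [hpS, transpose_mul, transpose_mul, transpose_transpose, diagonal_transpose,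
      Matrix.mul_assoc]
  have hSDS : Aᵀ * A * (pinv A * A) = Aᵀ * A := by
    rw [hpS, hS, orthogonal_diagonal_mul hU1]
    congr 3
    ext i
    rcases eq_or_ne (a i) 0 with h | h
    · simp [h]
    · field_simp
  refine ⟨?_, ?_, ?_, hsr⟩
  · have h0 : (A * (pinv A * A - 1))ᴴ * (A * (pinv A * A - 1)) = 0 := by
      rw [conjTranspose_eq_transpose_of_trivial, transpose_mul, Matrix.mul_assoc,
        ← Matrix.mul_assoc Aᵀ, Matrix.mul_sub, hSDS, Matrix.mul_one, sub_self, Matrix.mul_zero]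
    have h1 := conjTranspose_mul_self_eq_zero.1 h0
    rw [Matrix.mul_sub, Matrix.mul_one, sub_eq_zero] at h1
    rw [Matrix.mul_assoc, h1]
  · have h : pinv A * A * D = D := by
      rw [hpS, hD, orthogonal_diagonal_mul hU1]
      congr 3
      ext i
      rcases eq_or_ne (a i) 0 with h | h
      · simp [h]
      · field_simp
    calc pinv A * A * pinv A = pinv A * A * D * Aᵀ := by nth_rewrite 2 [hp]; simp only [Matrix.mul_assoc]
      _ = pinv A := by rw [h, hp]
  · rw [hp, ← Matrix.mul_assoc, transpose_mul, transpose_mul, transpose_transpose, hDt,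
      ← Matrix.mul_assoc]

/-- The inner factor of `pinv A` comes from an eigenbasis of `AᵀA`, whereas `pinv (Aᵀ * A)` uses one
of its square. The former satisfies the Moore-Penrose conditions for `AᵀA`, so uniqueness identifies
the two. -/
theorem pinv_eq_pinv_gram_mul (A : Matrix m n ℝ) : pinv A = pinv (Aᵀ * A) * Aᵀ := by
  obtain ⟨U, a, hU1, hU2, hS, -, hp⟩ := exists_pinv_eq A
  have hmp : IsMoorePenrose (Aᵀ * A) (U * diagonal (fun i => (a i)⁻¹) * Uᵀ) := by
    rw [hS]
    have hT : ∀ f : n → ℝ, (U * diagonal f * Uᵀ)ᵀ = U * diagonal f * Uᵀ := fun f => by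
      rw [transpose_mul, transpose_mul, transpose_transpose, diagonal_transpose, Matrix.mul_assoc]
    refine ⟨?_, ?_, ?_, ?_⟩
    · rw [orthogonal_diagonal_mul hU1, orthogonal_diagonal_mul hU1]
      congr 3
      ext i
      rcases eq_or_ne (a i) 0 with h | h
      · simp [h]
      · field_simp
    · rw [orthogonal_diagonal_mul hU1, orthogonal_diagonal_mul hU1]
      congr 3
      ext i
      rcases eq_or_ne (a i) 0 with h | h
      · simp [h]
      · field_simp
    · rw [orthogonal_diagonal_mul hU1, hT]
    · rw [orthogonal_diagonal_mul hU1, hT]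
  rw [hp, hmp.eq (isMoorePenrose_pinv (Aᵀ * A))]

/-- The pseudo-inverse is the limit of Tikhonov regularizations. -/
theorem tendsto_tikhonov (A : Matrix m n ℝ) (i : n) (j : m) :
    Filter.Tendsto (fun k : ℕ => ((Aᵀ * A + ((k : ℝ) + 1)⁻¹ • (1 : Matrix n n ℝ))⁻¹ * Aᵀ) i j) Filter.atTop
      (nhds (pinv A i j)) := by
  obtain ⟨U, a, hU1, hU2, hS, ha, hp⟩ := exists_pinv_eq A
  -- Along a null eigenvector of `AᵀA` the matrix `A` itself vanishes. The diverging inverse of the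
  -- regularization there meets a zero factor, in agreement with the convention `0⁻¹ = 0`.
  have hzero : ∀ l, a l = 0 → ∀ j, (Uᵀ * Aᵀ) l j = 0 := by
    intro l hl j
    have h1 : (A * U)ᵀ * (A * U) = diagonal a := by
      calc (A * U)ᵀ * (A * U) = Uᵀ * (Aᵀ * A) * U := by
            rw [transpose_mul]; simp only [Matrix.mul_assoc]
        _ = (Uᵀ * U) * diagonal a * (Uᵀ * U) := by rw [hS]; simp only [Matrix.mul_assoc]
        _ = diagonal a := by rw [hU1, Matrix.one_mul, Matrix.mul_one]
    have h2 : ∑ j, (A * U) j l * (A * U) j l = 0 := by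
      have := congrFun (congrFun h1 l) l
      rw [diagonal_apply_eq, hl] at this
      exact this
    rw [Finset.sum_eq_zero_iff_of_nonneg fun j _ => mul_self_nonneg _] at h2
    rw [← transpose_mul, transpose_apply]
    exact mul_self_eq_zero.1 (h2 j (Finset.mem_univ j))
  have hinv : ∀ k : ℕ, (Aᵀ * A + ((k : ℝ) + 1)⁻¹ • (1 : Matrix n n ℝ))⁻¹ =
      U * diagonal (fun l => (a l + ((k : ℝ) + 1)⁻¹)⁻¹) * Uᵀ := by
    intro k
    apply Matrix.inv_eq_left_inv
    have hone : ((k : ℝ) + 1)⁻¹ • (1 : Matrix n n ℝ) =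
        U * diagonal (fun _ => ((k : ℝ) + 1)⁻¹) * Uᵀ := by
      rw [← smul_one_eq_diagonal, Matrix.mul_smul, Matrix.smul_mul, Matrix.mul_one, hU2]
    rw [hS, hone, ← Matrix.add_mul, ← Matrix.mul_add, diagonal_add, orthogonal_diagonal_mul hU1,
      orthogonal_diagonal_one hU2]
    congr 3
    ext l
    have h1 := ha l
    exact inv_mul_cancel₀ (by positivity)
  have hentry : ∀ d : n → ℝ, (U * diagonal d * Uᵀ * Aᵀ) i j =
      ∑ l, U i l * (d l * (Uᵀ * Aᵀ) l j) := fun d => by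
    rw [Matrix.mul_assoc, Matrix.mul_assoc, Matrix.mul_apply]
    exact Finset.sum_congr rfl fun l _ => by rw [diagonal_mul]
  simp only [hinv, hp, hentry]
  refine tendsto_finsetSum _ fun l _ => Filter.Tendsto.const_mul _ ?_
  rcases (ha l).eq_or_lt with h | h
  · simp [hzero l h.symm]
  · refine Filter.Tendsto.mul_const _ (Filter.Tendsto.inv₀ ?_ h.ne')
    have h1 : Filter.Tendsto (fun k : ℕ => ((k : ℝ) + 1)⁻¹) Filter.atTop (nhds 0) := by
      simpa using tendsto_one_div_add_atTop_nhds_zero_nat (𝕜 := ℝ)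
    simpa using h1.const_add (a l)

theorem measurable_matrix_inv : Measurable fun A : Matrix n n ℝ => A⁻¹ := by
  rw [measurable_matrix_iff]
  intro i j
  have h : ∀ A : Matrix n n ℝ, A⁻¹ i j = A.det⁻¹ * A.adjugate i j := fun A => by
    rw [Matrix.inv_def, Ring.inverse_eq_inv', Matrix.smul_apply, smul_eq_mul]
  simp only [h]
  have h1 : Continuous fun A : Matrix n n ℝ => A.det := continuous_id.matrix_det
  have h2 : Continuous fun A : Matrix n n ℝ => A.adjugate i j :=
    continuous_id.matrix_adjugate.matrix_elem i j
  exact h1.measurable.inv.mul h2.measurable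

/-- The pseudo-inverse jumps where the rank changes, so continuity is not available; it is a
pointwise limit of measurable regularized inverses. -/
theorem measurable_pinv : Measurable (pinv : Matrix m n ℝ → Matrix n m ℝ) := by
  rw [measurable_matrix_iff]
  intro i j
  refine measurable_of_tendsto_metrizable (f := fun (k : ℕ) (A : Matrix m n ℝ) =>
    ((Aᵀ * A + ((k : ℝ) + 1)⁻¹ • (1 : Matrix n n ℝ))⁻¹ * Aᵀ) i j) (fun k => ?_)
    (tendsto_pi_nhds.2 fun A => tendsto_tikhonov A i j)
  have h1 : Continuous fun A : Matrix m n ℝ => Aᵀ * A + ((k : ℝ) + 1)⁻¹ • (1 : Matrix n n ℝ) := by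
    fun_prop
  have h2 := measurable_matrix_iff.1 (measurable_matrix_inv.comp h1.measurable)
  simp only [Matrix.mul_apply]
  refine Finset.measurable_sum _ fun l _ => (h2 i l).mul ?_
  exact (continuous_id.matrix_transpose.matrix_elem l j).measurable

end Pinv

/-! ### The operator norm on symmetric matrices -/

section SymOpNorm

variable {n : Type} [Fintype n] [DecidableEq n]

theorem specNorm_smul (c : ℝ) (X : Matrix n n ℝ) : specNorm (c • X) = |c| * specNorm X := by
  simp only [specNorm, map_smul, norm_smul, Real.norm_eq_abs]

theorem specNorm_add_le (X Y : Matrix n n ℝ) : specNorm (X + Y) ≤ specNorm X + specNorm Y := by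
  simp only [specNorm, map_add]
  exact norm_add_le _ _

theorem specNorm_zero : specNorm (0 : Matrix n n ℝ) = 0 := by
  simp [specNorm]

/-- The linear map on matrices with matrix `L` in `svec` coordinates, jointly in `L` and `X`. -/
noncomputable def svecAction (n : Type) [Fintype n] [DecidableEq n] :
    Matrix (Sym2 n) (Sym2 n) ℝ →ₗ[ℝ] Matrix n n ℝ →ₗ[ℝ] Matrix n n ℝ :=
  LinearMap.mk₂ ℝ (fun L X => unsvec (L *ᵥ svec X))
    (fun L L' X => by simp only [← unsvecLin_apply, add_mulVec, map_add])
    (fun c L X => by simp only [← unsvecLin_apply, smul_mulVec, map_smul])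
    (fun L X Y => by simp only [← unsvecLin_apply, ← svecLin_apply, map_add, mulVec_add])
    (fun c L X => by simp only [← unsvecLin_apply, ← svecLin_apply, map_smul, mulVec_smul])

theorem svecAction_apply (L : Matrix (Sym2 n) (Sym2 n) ℝ) (X : Matrix n n ℝ) :
    svecAction n L X = unsvec (L *ᵥ svec X) := rfl

theorem exists_specNorm_le_bound (L : Matrix (Sym2 n) (Sym2 n) ℝ) :
    ∃ C, ∀ X : Matrix n n ℝ, specNorm (unsvec (L *ᵥ svec X)) ≤ C * specNorm X := by
  open scoped Matrix.Norms.L2Operator in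
  exact ⟨_, fun X => (LinearMap.toContinuousLinearMap (svecAction n L)).le_opNorm X⟩

theorem bddAbove_symOpNorm (L : Matrix (Sym2 n) (Sym2 n) ℝ) :
    BddAbove {r : ℝ | ∃ X : Matrix n n ℝ, X.IsSymm ∧ specNorm X ≤ 1 ∧
      r = specNorm (unsvec (L *ᵥ svec X))} := by
  obtain ⟨C, hC⟩ := exists_specNorm_le_bound L
  refine ⟨|C|, ?_⟩
  rintro r ⟨X, -, hX, rfl⟩
  refine (hC X).trans ((le_abs_self _).trans ?_)
  rw [abs_mul, abs_of_nonneg (specNorm_nonneg X)]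
  exact mul_le_of_le_one_right (abs_nonneg _) hX

theorem symOpNorm_nonneg (L : Matrix (Sym2 n) (Sym2 n) ℝ) : 0 ≤ symOpNorm L := by
  refine Real.sSup_nonneg ?_
  rintro r ⟨X, -, -, rfl⟩
  exact specNorm_nonneg _

/-- Homogeneity extends the supremum over the unit ball to any radius. Radius zero is treated apart,
since rescaling by `c⁻¹` is impossible there. -/
theorem specNorm_unsvec_le (L : Matrix (Sym2 n) (Sym2 n) ℝ) {X : Matrix n n ℝ} (hX : X.IsSymm)
    {c : ℝ} (hc : 0 ≤ c) (h : specNorm X ≤ c) :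
    specNorm (unsvec (L *ᵥ svec X)) ≤ symOpNorm L * c := by
  rcases hc.eq_or_lt with rfl | hc
  · obtain ⟨C, hC⟩ := exists_specNorm_le_bound L
    have : specNorm X = 0 := le_antisymm h (specNorm_nonneg X)
    simpa [this] using hC X
  · have h1 : specNorm (unsvec (L *ᵥ svec (c⁻¹ • X))) ≤ symOpNorm L := by
      refine le_csSup (bddAbove_symOpNorm L) ⟨c⁻¹ • X, hX.smul _, ?_, rfl⟩
      rw [specNorm_smul, abs_of_pos (inv_pos.2 hc)]
      rw [inv_mul_le_iff₀ hc]; simpa using h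
    rw [← svecAction_apply, map_smul, specNorm_smul, abs_of_pos (inv_pos.2 hc),
      inv_mul_le_iff₀ hc, mul_comm, svecAction_apply] at h1
    exact h1

/-- As a supremum of convex functions the norm is convex, and a finite convex function on a
finite-dimensional space is continuous. This is used for the measurability of `betaW`. -/
theorem continuous_symOpNorm : Continuous (symOpNorm (n := n)) := by
  have hne : ∀ L : Matrix (Sym2 n) (Sym2 n) ℝ, {r : ℝ | ∃ X : Matrix n n ℝ, X.IsSymm ∧
      specNorm X ≤ 1 ∧ r = specNorm (unsvec (L *ᵥ svec X))}.Nonempty := fun L =>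
    ⟨_, 0, isSymm_zero, by simp [specNorm_zero], rfl⟩
  have hconv : ConvexOn ℝ Set.univ (symOpNorm (n := n)) := by
    refine ⟨convex_univ, fun L _ L' _ a b ha hb _ => ?_⟩
    refine csSup_le (hne _) ?_
    rintro r ⟨X, hX, hX1, rfl⟩
    have h1 := specNorm_unsvec_le L hX zero_le_one hX1
    have h2 := specNorm_unsvec_le L' hX zero_le_one hX1
    rw [mul_one] at h1 h2
    rw [← svecAction_apply, map_add, map_smul, map_smul, LinearMap.add_apply,
      LinearMap.smul_apply, LinearMap.smul_apply, svecAction_apply, svecAction_apply]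
    refine (specNorm_add_le _ _).trans ?_
    rw [specNorm_smul, specNorm_smul, abs_of_nonneg ha, abs_of_nonneg hb]
    exact add_le_add (mul_le_mul_of_nonneg_left h1 ha) (mul_le_mul_of_nonneg_left h2 hb)
  open scoped Matrix.Norms.Elementwise in
  exact continuousOn_univ.1 (hconv.continuousOn isOpen_univ)

end SymOpNorm


/-! ### Bilinearity of the moment dynamics -/

section MomentOpLin

variable {nx nu nw : ℕ} (M : Tensor (Fin nx) (Fin nx ⊕ Fin nu) (Fin nw))

/-- The moment dynamics as a bilinear map. -/
noncomputable def momentLin : Matrix (Fin nw) (Fin nw) ℝ →ₗ[ℝ]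
    Matrix (Fin nx ⊕ Fin nu) (Fin nx ⊕ Fin nu) ℝ →ₗ[ℝ] Matrix (Fin nx) (Fin nx) ℝ :=
  LinearMap.mk₂ ℝ (momentOp M)
    (fun W W' Z => by simp only [momentOp, add_kronecker, Matrix.mul_add, Matrix.add_mul])
    (fun c W Z => by simp only [momentOp, smul_kronecker, Matrix.mul_smul, Matrix.smul_mul])
    (fun W Z Z' => by simp only [momentOp, kronecker_add, Matrix.mul_add, Matrix.add_mul])
    (fun c W Z => by simp only [momentOp, kronecker_smul, Matrix.mul_smul, Matrix.smul_mul])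

theorem momentLin_apply (W : Matrix (Fin nw) (Fin nw) ℝ)
    (Z : Matrix (Fin nx ⊕ Fin nu) (Fin nx ⊕ Fin nu) ℝ) : momentLin M W Z = momentOp M W Z := rfl

theorem momentOp_vecMulVec (w : Fin nw → ℝ) (z : Fin nx ⊕ Fin nu → ℝ) :
    momentOp M (vecMulVec w w) (vecMulVec z z) =
      vecMulVec (fun i => ∑ k, ∑ j, w k * M i j k * z j)
        (fun i => ∑ k, ∑ j, w k * M i j k * z j) := by
  ext i i'
  rw [momentOp_apply, vecMulVec_apply, Finset.sum_comm (s := Finset.univ (α := Fin nw)),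
    Finset.sum_comm (s := Finset.univ (α := Fin nw)), Fintype.sum_mul_sum, Fintype.sum_prod_type]
  refine Finset.sum_congr rfl fun b _ => Finset.sum_congr rfl fun b' _ => ?_
  rw [Fintype.sum_mul_sum, Fintype.sum_prod_type]
  refine Finset.sum_congr rfl fun c _ => Finset.sum_congr rfl fun c' _ => ?_
  simp only [vecMulVec_apply]
  ring

end MomentOpLin

/-! ### Equivalent models and the algebra of the least squares estimate -/

section Model

variable {nx nu nv nw N : ℕ} {A : Fin nv → Matrix (Fin nx) (Fin nx) ℝ}
  {B : Fin nv → Matrix (Fin nx) (Fin nu) ℝ} {M : Tensor (Fin nx) (Fin nx ⊕ Fin nu) (Fin nw)}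

/-- Stacking the true tensor below the model does not raise the rank, so the row space is unchanged
and the true rows are combinations of the model rows. -/
theorem exists_mat3_eq_mul (hM : ModelEquivalence A B M) :
    ∃ C : Matrix (Fin nv) (Fin nw) ℝ, mat3 (trueTensor A B) = C * mat3 M := by
  obtain ⟨h1, h2⟩ := hM
  rw [Matrix.rank_eq_finrank_span_row] at h1 h2
  have hle : Submodule.span ℝ (Set.range (mat3 M)) ≤
      Submodule.span ℝ (Set.range (Matrix.fromRows (mat3 M) (mat3 (trueTensor A B)))) := by
    refine Submodule.span_mono ?_
    rintro _ ⟨i, rfl⟩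
    exact ⟨Sum.inl i, rfl⟩
  have heq := Submodule.eq_of_le_of_finrank_eq hle (h1.trans h2.symm)
  have hmem : ∀ k, mat3 (trueTensor A B) k ∈ Submodule.span ℝ (Set.range (mat3 M)) := fun k => by
    rw [heq]
    exact Submodule.subset_span ⟨Sum.inr k, rfl⟩
  choose c hc using fun k => (Submodule.mem_span_range_iff_exists_fun ℝ).1 (hmem k)
  refine ⟨Matrix.of c, ?_⟩
  ext k p
  rw [← hc k, Matrix.mul_apply, Finset.sum_apply]
  rfl

/-- The product of `M₍₃₎ᵀ` with its pseudo-inverse fixes the range of `M₍₃₎ᵀ`, which contains `V₍₃₎ᵀ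
v` by the inclusion of row spaces. Hence the model reproduces the true system exactly, path by path.
-/
theorem mat3_transpose_mulVec_modelNoise (hM : ModelEquivalence A B M) (v : Fin nv → ℝ) :
    (mat3 M)ᵀ *ᵥ modelNoise A B M v = (mat3 (trueTensor A B))ᵀ *ᵥ v := by
  obtain ⟨C, hC⟩ := exists_mat3_eq_mul hM
  rw [modelNoise, mulVec_mulVec, hC, transpose_mul, ← Matrix.mul_assoc, ← Matrix.mul_assoc,
    (isMoorePenrose_pinv (mat3 M)ᵀ).mul_mul_left]

theorem output_eq (hM : ModelEquivalence A B M) (v : Fin nv → ℝ) (z : Fin nx ⊕ Fin nu → ℝ) :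
    modeSum A v *ᵥ (fun j => z (Sum.inl j)) + modeSum B v *ᵥ (fun j => z (Sum.inr j)) =
      fun i => ∑ k, ∑ j, modelNoise A B M v k * M i j k * z j := by
  ext i
  have h : ∀ j, ∑ k, modelNoise A B M v k * M i j k = ∑ k, v k * trueTensor A B i j k := by
    intro j
    have := congrFun (mat3_transpose_mulVec_modelNoise hM v) (j, i)
    simp only [mulVec, dotProduct, Matrix.transpose_apply, mat3] at this
    simpa only [mul_comm] using this
  have h2 : ∑ k, ∑ j, modelNoise A B M v k * M i j k * z j =
      ∑ j, (∑ k, v k * trueTensor A B i j k) * z j := by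
    rw [Finset.sum_comm]
    exact Finset.sum_congr rfl fun j _ => by rw [← h, Finset.sum_mul]
  rw [h2, Fintype.sum_sum_type, Pi.add_apply]
  simp only [mulVec, dotProduct, modeSum, Matrix.sum_apply, Matrix.smul_apply, smul_eq_mul,
    trueTensor, fromCols_apply_inl, fromCols_apply_inr]

/-- By the normal equations the estimate is `G†` applied to the sum of the `Z_iᵀ svec(y_i y_iᵀ)`.
There is no residual, so `svec(y_i y_iᵀ)` equals `Z_i svec(w_i w_iᵀ)` and the factors `Z_iᵀ Z_i`
assemble into `H_i`. -/
theorem lsEstimate_eq {z : Fin N → Fin nx ⊕ Fin nu → ℝ} {y : Fin N → Fin nx → ℝ}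
    {w : Fin N → Fin nw → ℝ} (hy : ∀ i, y i = fun p => ∑ k, ∑ j, w i k * M p j k * z i j) :
    lsEstimate M z y = ∑ i, svecAction (Fin nw) (hMatrix M z i) (vecMulVec (w i) (w i)) := by
  simp only [svecAction_apply, ← unsvecLin_apply, ← map_sum]
  rw [lsEstimate, ← unsvecLin_apply, pinv_eq_pinv_gram_mul, regressor_transpose_mul,
    ← mulVec_mulVec]
  congr 1
  have h := regressor_transpose_mulVec M z (fun i => svec (vecMulVec (y i) (y i)))
  rw [show outputs y = fun ip : Fin N × Sym2 (Fin nx) =>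
    (fun i => svec (vecMulVec (y i) (y i))) ip.1 ip.2 from rfl, h, mulVec_sum]
  refine Finset.sum_congr rfl fun i _ => ?_
  rw [hMatrix, ← mulVec_mulVec, gramOp_vecMulVec M (z i), ← mulVec_mulVec,
    show sampleRegressor M (z i) *ᵥ svec (vecMulVec (w i) (w i)) =
      svec (momentOp M (vecMulVec (w i) (w i)) (vecMulVec (z i) (z i))) from
      vecProd2_tskron_mulVec M (isSymm_vecMulVec _) (isSymm_vecMulVec _),
    momentOp_vecMulVec, hy i]

/-- The component of a second moment matrix that the data identify. -/
noncomputable def identifiedMoment (M : Tensor (Fin nx) (Fin nx ⊕ Fin nu) (Fin nw))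
    (z : Fin N → Fin nx ⊕ Fin nu → ℝ) (W : Matrix (Fin nw) (Fin nw) ℝ) :
    Matrix (Fin nw) (Fin nw) ℝ :=
  ∑ i, svecAction (Fin nw) (hMatrix M z i) W

theorem isSymm_svecAction (L : Matrix (Sym2 (Fin nw)) (Sym2 (Fin nw)) ℝ)
    (W : Matrix (Fin nw) (Fin nw) ℝ) : (svecAction (Fin nw) L W).IsSymm := isSymm_unsvec _

theorem isSymm_identifiedMoment (z : Fin N → Fin nx ⊕ Fin nu → ℝ)
    (W : Matrix (Fin nw) (Fin nw) ℝ) : (identifiedMoment M z W).IsSymm := by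
  rw [Matrix.IsSymm, identifiedMoment, transpose_sum]
  exact Finset.sum_congr rfl fun i _ => isSymm_svecAction _ _

/-- The change from `W` to `G†G W` lies in the kernel of `G`, hence in the kernel of every sample
regressor: it gives zero dynamics on each `z_i z_iᵀ`. These matrices span, so it gives zero dynamics
on every symmetric `Z`, even when `G` is singular. -/
theorem momentOp_identifiedMoment {z : Fin N → Fin nx ⊕ Fin nu → ℝ}
    (hz : Submodule.span ℝ (Set.range fun i => svec (vecMulVec (z i) (z i))) = ⊤)
    {W : Matrix (Fin nw) (Fin nw) ℝ} (hW : W.IsSymm)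
    {Z : Matrix (Fin nx ⊕ Fin nu) (Fin nx ⊕ Fin nu) ℝ} (hZ : Z.IsSymm) :
    momentOp M (identifiedMoment M z W) Z = momentOp M W Z := by
  set G := ∑ i, gramOp M (vecMulVec (z i) (z i)) with hG
  set d := (pinv G * G) *ᵥ svec W - svec W with hd
  have h1 : identifiedMoment M z W = unsvec ((pinv G * G) *ᵥ svec W) := by
    simp only [identifiedMoment, svecAction_apply, ← unsvecLin_apply, ← map_sum, hMatrix]
    rw [← sum_mulVec, ← Finset.mul_sum]
  have h2 : identifiedMoment M z W - W = unsvec d := by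
    rw [h1, hd, ← unsvecLin_apply, ← unsvecLin_apply, map_sub, unsvecLin_apply (svec W),
      unsvec_svec hW]
  have h3 : G *ᵥ d = 0 := by
    rw [hd, mulVec_sub, mulVec_mulVec, ← Matrix.mul_assoc, (isMoorePenrose_pinv G).mul_mul_left,
      sub_self]
  have h4 : ∀ i, momentOp M (unsvec d) (vecMulVec (z i) (z i)) = 0 := by
    intro i
    have h5 := sampleRegressor_mulVec_eq_zero M z h3 i
    rw [← svec_unsvec d, sampleRegressor,
      vecProd2_tskron_mulVec M (isSymm_unsvec d) (isSymm_vecMulVec _)] at h5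
    refine svec_injective (isSymm_momentOp M (isSymm_unsvec d) (isSymm_vecMulVec _)) isSymm_zero ?_
    rw [h5, ← svecLin_apply, map_zero]
  have h5 : ∀ x : Sym2 (Fin nx ⊕ Fin nu) → ℝ, momentLin M (unsvec d) (unsvecLin _ x) = 0 := by
    intro x
    have hx : x ∈ Submodule.span ℝ (Set.range fun i => svec (vecMulVec (z i) (z i))) := by
      rw [hz]; trivial
    have hle : Submodule.span ℝ (Set.range fun i => svec (vecMulVec (z i) (z i))) ≤
        LinearMap.ker ((momentLin M (unsvec d)).comp (unsvecLin _)) := by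
      refine Submodule.span_le.2 ?_
      rintro _ ⟨i, rfl⟩
      change momentLin M (unsvec d) (unsvecLin _ (svec (vecMulVec (z i) (z i)))) = 0
      rw [unsvecLin_apply, unsvec_svec (isSymm_vecMulVec _)]
      exact h4 i
    exact hle hx
  have h6 := h5 (svec Z)
  rw [unsvecLin_apply, unsvec_svec hZ, ← h2, map_sub, LinearMap.sub_apply, sub_eq_zero] at h6
  exact h6

end Model

/-! ### Second moment matrices -/

section SecondMoment

variable {ι : Type} {E : Type*} [Fintype ι] [MeasurableSpace E] {τ : Measure E} {w : E → ι → ℝ}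

/-- The second moment matrix. -/
noncomputable def secondMoment (τ : Measure E) (w : E → ι → ℝ) :
    Matrix (ι) (ι) ℝ :=
  fun k l => ∫ e, w e k * w e l ∂τ

omit [Fintype ι] in
theorem isSymm_secondMoment : (secondMoment τ w).IsSymm := by
  refine Matrix.IsSymm.ext fun i j => ?_
  simp only [secondMoment, mul_comm]

theorem dotProduct_secondMoment (hi : ∀ k l, Integrable (fun e => w e k * w e l) τ)
    (x : ι → ℝ) :
    x ⬝ᵥ secondMoment τ w *ᵥ x = ∫ e, (x ⬝ᵥ w e) ^ 2 ∂τ := by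
  have h : ∀ e, (x ⬝ᵥ w e) ^ 2 = ∑ k, ∑ l, x k * x l * (w e k * w e l) := fun e => by
    rw [pow_two, dotProduct, Fintype.sum_mul_sum]
    exact Finset.sum_congr rfl fun k _ => Finset.sum_congr rfl fun l _ => by ring
  simp only [h]
  rw [integral_finsetSum _ fun k _ => integrable_finsetSum _ fun l _ => (hi k l).const_mul _]
  simp only [dotProduct, mulVec, Finset.mul_sum]
  refine Finset.sum_congr rfl fun k _ => ?_
  rw [integral_finsetSum _ fun l _ => (hi k l).const_mul _]
  refine Finset.sum_congr rfl fun l _ => ?_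
  rw [integral_const_mul, secondMoment]
  ring

theorem posSemidef_secondMoment (hi : ∀ k l, Integrable (fun e => w e k * w e l) τ) :
    (secondMoment τ w).PosSemidef := by
  refine PosSemidef.of_dotProduct_mulVec_nonneg (isHermitian_iff_isSymm.2 isSymm_secondMoment)
    fun x => ?_
  rw [star_trivial, dotProduct_secondMoment hi]
  exact integral_nonneg fun e => sq_nonneg _

end SecondMoment

/-! ### Bounded noise and its centred second moments -/

section BoundedNoise

variable {nw : ℕ} {E : Type*} [MeasurableSpace E] {τ : Measure E} [IsProbabilityMeasure τ]
  {w : E → Fin nw → ℝ} {rad : ℝ}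

theorem abs_apply_le_of_norm_le {x : Fin nw → ℝ} (h : ‖WithLp.toLp 2 x‖ ≤ rad) (k : Fin nw) :
    |x k| ≤ rad :=
  (PiLp.norm_apply_le (WithLp.toLp 2 x) k).trans h

theorem integrable_mul_noise (hw : Measurable w) (hb : ∀ᵐ e ∂τ, ‖WithLp.toLp 2 (w e)‖ ≤ rad)
    (k l : Fin nw) : Integrable (fun e => w e k * w e l) τ := by
  refine Integrable.of_bound (C := rad * rad) ?_ ?_
  · exact ((measurable_pi_iff.1 hw k).mul (measurable_pi_iff.1 hw l)).aestronglyMeasurable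
  · filter_upwards [hb] with e he
    rw [norm_mul]
    exact mul_le_mul (abs_apply_le_of_norm_le he k) (abs_apply_le_of_norm_le he l) (abs_nonneg _)
      ((norm_nonneg _).trans he)

theorem sq_dotProduct_le {x y : Fin nw → ℝ} (h : ‖WithLp.toLp 2 y‖ ≤ rad) :
    (x ⬝ᵥ y) ^ 2 ≤ rad ^ 2 * (x ⬝ᵥ x) := by
  have h1 : (x ⬝ᵥ y) ^ 2 ≤ (x ⬝ᵥ x) * (y ⬝ᵥ y) := by
    have := Finset.sum_mul_sq_le_sq_mul_sq Finset.univ x y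
    simpa [dotProduct, pow_two] using this
  have h2 : y ⬝ᵥ y ≤ rad ^ 2 := by
    rw [← norm_toLp_sq]; exact pow_le_pow_left₀ (norm_nonneg _) h 2
  have h3 : 0 ≤ x ⬝ᵥ x := by rw [← norm_toLp_sq]; positivity
  nlinarith

theorem posSemidef_sq_sub_secondMoment (hw : Measurable w)
    (hb : ∀ᵐ e ∂τ, ‖WithLp.toLp 2 (w e)‖ ≤ rad) :
    (rad ^ 2 • (1 : Matrix (Fin nw) (Fin nw) ℝ) - secondMoment τ w).PosSemidef := by
  have hi := integrable_mul_noise hw hb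
  refine PosSemidef.of_dotProduct_mulVec_nonneg ?_ fun x => ?_
  · rw [isHermitian_iff_isSymm]
    exact (isSymm_one.smul _).sub isSymm_secondMoment
  · rw [star_trivial, sub_mulVec, dotProduct_sub, smul_mulVec, one_mulVec, dotProduct_smul,
      smul_eq_mul, sub_nonneg, dotProduct_secondMoment hi]
    calc _ ≤ ∫ _, rad ^ 2 * (x ⬝ᵥ x) ∂τ := by
          refine integral_mono_of_nonneg (Filter.Eventually.of_forall fun e => sq_nonneg _)
            (integrable_const _) ?_
          filter_upwards [hb] with e he
          exact sq_dotProduct_le he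
      _ = _ := by simp

theorem posSemidef_vecMulVec {n : Type} [Fintype n] (x : n → ℝ) : (vecMulVec x x).PosSemidef := by
  simpa using posSemidef_vecMulVec_self_star x

theorem posSemidef_sq_sub_vecMulVec {y : Fin nw → ℝ} (h : ‖WithLp.toLp 2 y‖ ≤ rad) :
    (rad ^ 2 • (1 : Matrix (Fin nw) (Fin nw) ℝ) - vecMulVec y y).PosSemidef := by
  refine PosSemidef.of_dotProduct_mulVec_nonneg ?_ fun x => ?_
  · rw [isHermitian_iff_isSymm]
    exact (isSymm_one.smul _).sub (isSymm_vecMulVec y)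
  · rw [star_trivial, sub_mulVec, dotProduct_sub, smul_mulVec, one_mulVec, dotProduct_smul,
      smul_eq_mul, sub_nonneg, vecMulVec_mulVec]
    refine le_of_eq_of_le ?_ (sq_dotProduct_le h)
    simp [pow_two, dotProduct_comm y x]

/-- Both `w wᵀ` and its mean lie between `0` and `r² I`, so their difference lies between `-r² I`
and `r² I`. The triangle inequality would lose a factor two. -/
theorem specNorm_vecMulVec_sub_secondMoment_le (hw : Measurable w)
    (hb : ∀ᵐ e ∂τ, ‖WithLp.toLp 2 (w e)‖ ≤ rad) :
    ∀ᵐ e ∂τ, specNorm (vecMulVec (w e) (w e) - secondMoment τ w) ≤ rad ^ 2 := by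
  filter_upwards [hb] with e he
  have hS : (vecMulVec (w e) (w e) - secondMoment τ w).IsHermitian := by
    rw [isHermitian_iff_isSymm]
    exact (isSymm_vecMulVec _).sub isSymm_secondMoment
  refine specNorm_le (sq_nonneg _) hS (posSemidef_sq_sub hS ?_ ?_)
  · have := (posSemidef_sq_sub_vecMulVec he).add
      (posSemidef_secondMoment (integrable_mul_noise hw hb))
    convert this using 1
    abel
  · have := (posSemidef_sq_sub_secondMoment hw hb).add (posSemidef_vecMulVec (w e))
    convert this using 1
    abel

theorem linearMap_apply_eq_sum {n : Type} [Fintype n] [DecidableEq n]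
    (φ : Matrix n n ℝ →ₗ[ℝ] ℝ) (X : Matrix n n ℝ) :
    φ X = ∑ a, ∑ b, X a b * φ (Matrix.single a b 1) := by
  conv_lhs => rw [matrix_eq_sum_single X]
  simp only [map_sum]
  refine Finset.sum_congr rfl fun a _ => Finset.sum_congr rfl fun b _ => ?_
  rw [← smul_eq_mul, ← map_smul, smul_single, smul_eq_mul, mul_one]

omit [IsProbabilityMeasure τ] in
theorem measurable_vecMulVec_sub (hw : Measurable w) :
    Measurable fun e => vecMulVec (w e) (w e) - secondMoment τ w := by
  rw [measurable_matrix_iff]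
  intro k l
  exact ((measurable_pi_iff.1 hw k).mul (measurable_pi_iff.1 hw l)).sub_const _

/-- The entry functional of a linear map on matrices. -/
noncomputable def entryLin {n : Type} [Fintype n] (T : Matrix n n ℝ →ₗ[ℝ] Matrix n n ℝ)
    (a b : n) : Matrix n n ℝ →ₗ[ℝ] ℝ :=
  (Matrix.entryLinearMap ℝ ℝ a b).comp T

theorem integrable_centered (hw : Measurable w) (hb : ∀ᵐ e ∂τ, ‖WithLp.toLp 2 (w e)‖ ≤ rad)
    (φ : Matrix (Fin nw) (Fin nw) ℝ →ₗ[ℝ] ℝ) :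
    Integrable (fun e => φ (vecMulVec (w e) (w e) - secondMoment τ w)) τ := by
  have h := fun e => linearMap_apply_eq_sum φ (vecMulVec (w e) (w e) - secondMoment τ w)
  simp only [h]
  exact integrable_finsetSum _ fun a _ => integrable_finsetSum _ fun b _ =>
    ((integrable_mul_noise hw hb a b).sub (integrable_const _)).mul_const _

theorem integral_centered (hw : Measurable w) (hb : ∀ᵐ e ∂τ, ‖WithLp.toLp 2 (w e)‖ ≤ rad)
    (φ : Matrix (Fin nw) (Fin nw) ℝ →ₗ[ℝ] ℝ) :
    ∫ e, φ (vecMulVec (w e) (w e) - secondMoment τ w) ∂τ = 0 := by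
  have hi : ∀ a b, Integrable (fun e => (vecMulVec (w e) (w e) - secondMoment τ w) a b) τ :=
    fun a b => (integrable_mul_noise hw hb a b).sub (integrable_const _)
  have h := fun e => linearMap_apply_eq_sum φ (vecMulVec (w e) (w e) - secondMoment τ w)
  simp only [h]
  rw [integral_finsetSum _ fun a _ => integrable_finsetSum _ fun b _ => (hi a b).mul_const _]
  refine Finset.sum_eq_zero fun a _ => ?_
  rw [integral_finsetSum _ fun b _ => (hi a b).mul_const _]
  refine Finset.sum_eq_zero fun b _ => ?_
  rw [integral_mul_const]
  have : ∫ e, (vecMulVec (w e) (w e) - secondMoment τ w) a b ∂τ = 0 := by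
    simp only [Matrix.sub_apply, vecMulVec_apply]
    rw [integral_sub (integrable_mul_noise hw hb a b) (integrable_const _)]
    simp [secondMoment]
  rw [this, zero_mul]

end BoundedNoise


/-! ### Concentration of the estimation error -/

section Concentration

variable {nx nu nw N : ℕ} (M : Tensor (Fin nx) (Fin nx ⊕ Fin nu) (Fin nw))
  {E : Type*} [MeasurableSpace E] {τ : Measure E} [IsProbabilityMeasure τ]
  {w : E → Fin nw → ℝ} {rad : ℝ}

/-- The error of the least squares estimate. -/
noncomputable def estimationError (τ : Measure E) (w : E → Fin nw → ℝ)
    (z : Fin N → Fin nx ⊕ Fin nu → ℝ) (v : Fin N → E) : Matrix (Fin nw) (Fin nw) ℝ :=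
  ∑ i, svecAction (Fin nw) (hMatrix M z i) (vecMulVec (w (v i)) (w (v i)) - secondMoment τ w)

/-- The estimation error is between `-β` and `β`. -/
def ErrorBound (τ : Measure E) (w : E → Fin nw → ℝ) (rad δ : ℝ)
    (z : Fin N → Fin nx ⊕ Fin nu → ℝ) (v : Fin N → E) : Prop :=
  (betaW M rad δ z • (1 : Matrix (Fin nw) (Fin nw) ℝ) - estimationError M τ w z v).PosSemidef ∧
    (betaW M rad δ z • (1 : Matrix (Fin nw) (Fin nw) ℝ) + estimationError M τ w z v).PosSemidef

theorem betaW_nonneg (rad δ : ℝ) (z : Fin N → Fin nx ⊕ Fin nu → ℝ) : 0 ≤ betaW M rad δ z :=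
  mul_nonneg (mul_nonneg (sq_nonneg _) (Real.sqrt_nonneg _)) (Real.sqrt_nonneg _)

theorem betaW_eq (rad δ : ℝ) (z : Fin N → Fin nx ⊕ Fin nu → ℝ) :
    betaW M rad δ z = √(∑ i, (symOpNorm (hMatrix M z i) * rad ^ 2) ^ 2) *
      √(2 * Real.log (2 * (nw : ℝ) / δ)) := by
  rw [betaW, zetaW]
  congr 1
  simp only [mul_pow]
  rw [← Finset.sum_mul, Real.sqrt_mul' _ (by positivity), Real.sqrt_sq (by positivity), mul_comm]

theorem posSemidef_of_isEmpty {n : Type} [IsEmpty n] (X : Matrix n n ℝ) : X.PosSemidef := by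
  have : X = 0 := Subsingleton.elim _ _
  rw [this]
  exact PosSemidef.zero

/-- With `z` fixed, the maps `H_i` and the radius are deterministic and only the noises are random,
so the Hoeffding inequality applies with `c_i = ‖H_i‖ r²`. -/
theorem measure_pi_not_errorBound_le (hw : Measurable w)
    (hb : ∀ᵐ e ∂τ, ‖WithLp.toLp 2 (w e)‖ ≤ rad) {δ : ℝ} (hδ : 0 < δ) (hδ' : δ < 1)
    (z : Fin N → Fin nx ⊕ Fin nu → ℝ) :
    (Measure.pi fun _ : Fin N => τ) {v | ¬ ErrorBound M τ w rad δ z v} ≤ ENNReal.ofReal δ := by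
  -- Dimension zero is split off: there the condition is void, while the computation of the radius
  -- below needs `2 n_w / δ ≥ 1`.
  rcases Nat.eq_zero_or_pos nw with rfl | hnw
  · have : {v : Fin N → E | ¬ ErrorBound M τ w rad δ z v} = ∅ := by
      ext v
      simp [ErrorBound, posSemidef_of_isEmpty]
    simp [this]
  set X : Fin N → E → Matrix (Fin nw) (Fin nw) ℝ := fun i e =>
    svecAction (Fin nw) (hMatrix M z i) (vecMulVec (w e) (w e) - secondMoment τ w) with hX
  set c : Fin N → ℝ := fun i => symOpNorm (hMatrix M z i) * rad ^ 2 with hcdef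
  have hc : ∀ i, 0 ≤ c i := fun i => mul_nonneg (symOpNorm_nonneg _) (sq_nonneg _)
  have hs : ∀ i e, (X i e).IsHermitian := fun i e =>
    isHermitian_iff_isSymm.2 (isSymm_svecAction _ _)
  have hbd : ∀ i, ∀ᵐ e ∂τ, (c i ^ 2 • (1 : Matrix (Fin nw) (Fin nw) ℝ) -
      X i e * X i e).PosSemidef := fun i => by
    filter_upwards [specNorm_vecMulVec_sub_secondMoment_le hw hb] with e he
    exact posSemidef_sq_sub_of_specNorm_le (hs i e) (specNorm_unsvec_le _
      ((isSymm_vecMulVec _).sub isSymm_secondMoment) (sq_nonneg _) he)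
  have hm : ∀ i, Measurable (X i) := fun i =>
    (LinearMap.continuous_of_finiteDimensional
      (svecAction (Fin nw) (hMatrix M z i))).measurable.comp (measurable_vecMulVec_sub hw)
  have hi : ∀ i a b, Integrable (fun e => X i e a b) τ := fun i a b =>
    integrable_centered hw hb (entryLin (svecAction (Fin nw) (hMatrix M z i)) a b)
  have h0 : ∀ i a b, ∫ e, X i e a b ∂τ = 0 := fun i a b =>
    integral_centered hw hb (entryLin (svecAction (Fin nw) (hMatrix M z i)) a b)
  have hβ : betaW M rad δ z = √(∑ i, c i ^ 2) * √(2 * Real.log (2 * (nw : ℝ) / δ)) :=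
    betaW_eq M rad δ z
  rcases (Finset.sum_nonneg fun i _ => sq_nonneg (c i) : 0 ≤ ∑ i, c i ^ 2).eq_or_lt with hσ | hσ
  -- The Hoeffding bound divides by `∑ c_i²`. If that sum is zero, the summands vanish almost
  -- surely, and so do the error and the radius.
  · have hc0 : ∀ i, c i = 0 := fun i => by
      have := (Finset.sum_eq_zero_iff_of_nonneg fun i _ => sq_nonneg (c i)).1 hσ.symm i
        (Finset.mem_univ i)
      exact pow_eq_zero_iff two_ne_zero |>.1 this
    have hX0 : ∀ i, ∀ᵐ e ∂τ, X i e = 0 := fun i => by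
      filter_upwards [hbd i] with e he
      rw [hc0 i] at he
      have h1 := he.trace_nonneg
      have h2 := (posSemidef_conjTranspose_mul_self (X i e)).trace_nonneg
      rw [(hs i e).eq] at h2
      rw [Matrix.trace_sub] at h1
      refine trace_conjTranspose_mul_self_eq_zero_iff.1 ?_
      rw [(hs i e).eq]
      simp at h1
      linarith
    have hall : ∀ᵐ v ∂(Measure.pi fun _ : Fin N => τ), ∀ i, X i (v i) = 0 :=
      ae_all_iff.2 fun i =>
        (measurePreserving_eval (fun _ : Fin N => τ) i).quasiMeasurePreserving.ae (hX0 i)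
    have hβ0 : betaW M rad δ z = 0 := by rw [hβ, ← hσ]; simp
    refine le_of_eq_of_le (ae_iff.1 ?_) zero_le
    filter_upwards [hall] with v hv
    have : estimationError M τ w z v = 0 := Finset.sum_eq_zero fun i _ => hv i
    change ErrorBound M τ w rad δ z v
    rw [ErrorBound, this, hβ0]
    simp [PosSemidef.zero]
  · refine (measure_not_posSemidef_sum_le hc hm hs hbd hi h0 hσ (betaW_nonneg M rad δ z)).trans ?_
    -- The radius is chosen so that the exponent is `-log(2 n_w / δ)`; the tail bound is then
    -- exactly `δ`.
    refine ENNReal.ofReal_le_ofReal (le_of_eq ?_)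
    have hn : (0 : ℝ) < nw := by exact_mod_cast hnw
    have hn1 : (1 : ℝ) ≤ nw := by exact_mod_cast hnw
    have hlog : 0 ≤ Real.log (2 * (nw : ℝ) / δ) := by
      refine Real.log_nonneg ?_
      rw [le_div_iff₀ hδ]
      linarith
    rw [hβ, mul_pow, Real.sq_sqrt hσ.le, Real.sq_sqrt (by positivity)]
    have : -((∑ i, c i ^ 2) * (2 * Real.log (2 * (nw : ℝ) / δ))) / (2 * ∑ i, c i ^ 2) =
        -Real.log (2 * (nw : ℝ) / δ) := by
      field_simp
    rw [this, Real.exp_neg, Real.exp_log (by positivity), Fintype.card_fin]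
    field_simp

theorem measurable_matrix_mul {F : Type*} [MeasurableSpace F] {l m n : Type} [Fintype m]
    {X : F → Matrix l m ℝ} {Y : F → Matrix m n ℝ} (hX : Measurable X) (hY : Measurable Y) :
    Measurable fun f => X f * Y f := by
  rw [measurable_matrix_iff] at *
  intro i j
  simp only [Matrix.mul_apply]
  exact Finset.measurable_sum _ fun k _ => (hX i k).mul (hY k j)

theorem continuous_sampleRegressor : Continuous (sampleRegressor M) := by
  refine continuous_matrix fun i k => ?_
  simp only [sampleRegressor, vecProd2, svec_apply, vecMulVec_apply]
  fun_prop

theorem measurable_gramOp_vecMulVec :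
    Measurable fun z : Fin nx ⊕ Fin nu → ℝ => gramOp M (vecMulVec z z) := by
  simp only [gramOp_vecMulVec]
  exact ((continuous_sampleRegressor M).matrix_transpose.matrix_mul
    (continuous_sampleRegressor M)).measurable

theorem measurable_hMatrix (i : Fin N) :
    Measurable fun z : Fin N → Fin nx ⊕ Fin nu → ℝ => hMatrix M z i := by
  refine measurable_matrix_mul (measurable_pinv.comp (Finset.measurable_sum _ fun j _ => ?_)) ?_
  · exact (measurable_gramOp_vecMulVec M).comp (measurable_pi_apply j)
  · exact (measurable_gramOp_vecMulVec M).comp (measurable_pi_apply i)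

theorem measurable_svecAction {F : Type*} [MeasurableSpace F] {n : Type} [Fintype n]
    [DecidableEq n] {L : F → Matrix (Sym2 n) (Sym2 n) ℝ} {X : F → Matrix n n ℝ}
    (hL : Measurable L) (hX : Measurable X) :
    Measurable fun f => svecAction n (L f) (X f) := by
  rw [measurable_matrix_iff] at *
  intro i j
  simp only [svecAction_apply, unsvec]
  have h : ∀ s, Measurable fun f => (L f *ᵥ svec (X f)) s := fun s => by
    simp only [mulVec, dotProduct, svec_apply]
    exact Finset.measurable_sum _ fun t _ => (hL s t).mul
      (Finset.measurable_sum _ fun p _ => (hX p.1 p.2).const_mul _)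
  split_ifs
  · exact h _
  · exact (h _).div_const _

theorem measurable_betaW (rad δ : ℝ) :
    Measurable fun z : Fin N → Fin nx ⊕ Fin nu → ℝ => betaW M rad δ z := by
  simp only [betaW_eq]
  refine Measurable.mul_const (Measurable.sqrt (Finset.measurable_sum _ fun i _ => ?_)) _
  exact ((continuous_symOpNorm.measurable.comp (measurable_hMatrix M i)).mul_const _).pow_const 2

omit [IsProbabilityMeasure τ] in
-- Joint measurability in the regressors and the noises allows the bound for fixed `z` to be
-- integrated over the law of `z`.
theorem measurableSet_errorBound (hw : Measurable w) (rad δ : ℝ) :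
    MeasurableSet {p : (Fin N → Fin nx ⊕ Fin nu → ℝ) × (Fin N → E) |
      ErrorBound M τ w rad δ p.1 p.2} := by
  have h1 : Measurable fun p : (Fin N → Fin nx ⊕ Fin nu → ℝ) × (Fin N → E) =>
      estimationError M τ w p.1 p.2 := by
    refine Finset.measurable_sum _ fun i _ => ?_
    have h3 : Measurable fun p : (Fin N → Fin nx ⊕ Fin nu → ℝ) × (Fin N → E) =>
        hMatrix M p.1 i := (measurable_hMatrix M i).comp measurable_fst
    have h4 : Measurable fun p : (Fin N → Fin nx ⊕ Fin nu → ℝ) × (Fin N → E) =>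
        vecMulVec (w (p.2 i)) (w (p.2 i)) - secondMoment τ w :=
      (measurable_vecMulVec_sub (τ := τ) hw).comp
        ((measurable_pi_apply i).comp measurable_snd)
    exact measurable_svecAction h3 h4
  have h2 : Measurable fun p : (Fin N → Fin nx ⊕ Fin nu → ℝ) × (Fin N → E) =>
      betaW M rad δ p.1 • (1 : Matrix (Fin nw) (Fin nw) ℝ) := by
    rw [measurable_matrix_iff]
    intro i j
    exact ((measurable_betaW M rad δ).comp measurable_fst).mul_const _
  exact (isClosed_posSemidef.measurableSet.preimage (h2.sub h1)).inter
    (isClosed_posSemidef.measurableSet.preimage (h2.add h1))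

end Concentration


/-! ### Generic samples span the symmetric matrices -/

section Spanning

variable {n : Type} [Fintype n] [DecidableEq n]

theorem continuous_svec_vecMulVec :
    Continuous fun z : n → ℝ => svec (vecMulVec z z) := by
  refine continuous_pi fun s => ?_
  simp only [svec_apply, vecMulVec_apply]
  fun_prop

/-- By the spectral theorem every symmetric matrix is a combination of matrices `z zᵀ`. -/
theorem linearMap_eq_zero_of_svec_vecMulVec {f : (Sym2 n → ℝ) →ₗ[ℝ] ℝ}
    (h : ∀ z : n → ℝ, f (svec (vecMulVec z z)) = 0) : f = 0 := by
  ext1 s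
  refine LinearMap.ext fun r => ?_
  have key : ∀ x : Sym2 n → ℝ, f x = 0 := by
    intro x
    obtain ⟨U, a, -, -, hX⟩ := exists_orthogonal_diagonal
      (isHermitian_iff_isSymm.2 (isSymm_unsvec x))
    have h1 : unsvec x = ∑ i, a i • vecMulVec (fun k => U k i) (fun k => U k i) := by
      rw [hX]
      ext k l
      simp only [Matrix.mul_apply, diagonal_apply, mul_ite, mul_zero, Finset.sum_ite_eq',
        Finset.mem_univ, if_true, transpose_apply, Matrix.sum_apply, Matrix.smul_apply,
        vecMulVec_apply, smul_eq_mul]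
      exact Finset.sum_congr rfl fun i _ => by ring
    rw [← svec_unsvec x, h1, ← svecLin_apply, map_sum, map_sum]
    refine Finset.sum_eq_zero fun i _ => ?_
    rw [map_smul, map_smul, svecLin_apply, h, smul_zero]
  simpa using key _

theorem svec_vecMulVec_add_smul (z e : n → ℝ) (t : ℝ) :
    svec (vecMulVec (z + t • e) (z + t • e)) = svec (vecMulVec z z) +
      t • svec (vecMulVec z e + vecMulVec e z) + t ^ 2 • svec (vecMulVec e e) := by
  simp only [← svecLin_apply, ← map_smul, ← map_add]
  congr 1
  ext i j
  simp only [vecMulVec_apply, Matrix.add_apply, Matrix.smul_apply, Pi.add_apply, Pi.smul_apply,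
    smul_eq_mul]
  ring

/-- A nonzero quadratic form vanishes on a null set only. -/
theorem ae_linearMap_svec_vecMulVec_ne_zero {f : (Sym2 n → ℝ) →ₗ[ℝ] ℝ} (hf : f ≠ 0) :
    ∀ᵐ z : n → ℝ, f (svec (vecMulVec z z)) ≠ 0 := by
  obtain ⟨e, he⟩ : ∃ e : n → ℝ, f (svec (vecMulVec e e)) ≠ 0 := by
    by_contra! h
    exact hf (linearMap_eq_zero_of_svec_vecMulVec h)
  have hcont : Continuous fun z : n → ℝ => f (svec (vecMulVec z z)) :=
    (LinearMap.continuous_of_finiteDimensional f).comp continuous_svec_vecMulVec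
  have hs : MeasurableSet {z : n → ℝ | f (svec (vecMulVec z z)) ≠ 0} :=
    (isOpen_ne_fun hcont continuous_const).measurableSet
  -- It suffices to work on lines in direction `e`. There the form is a polynomial of degree two in
  -- `t`, whose leading coefficient is the nonzero value at `e`, so its roots are finite in number.
  refine ae_mem_of_ae_add_linearMap_mem (LinearMap.toSpanSingleton ℝ (n → ℝ) e) volume volume hs
    fun z => ?_
  set p : Polynomial ℝ := Polynomial.C (f (svec (vecMulVec z z))) +
    Polynomial.C (f (svec (vecMulVec z e + vecMulVec e z))) * Polynomial.X +
    Polynomial.C (f (svec (vecMulVec e e))) * Polynomial.X ^ 2 with hp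
  have hp0 : p ≠ 0 := by
    intro h0
    have := congrArg (fun q => Polynomial.coeff q 2) h0
    simp [hp] at this
    exact he this
  have hsub : {t : ℝ | ¬ (z + LinearMap.toSpanSingleton ℝ (n → ℝ) e t ∈
      {z : n → ℝ | f (svec (vecMulVec z z)) ≠ 0})} ⊆ {t | p.IsRoot t} := by
    intro t ht
    simp only [Set.mem_ofPred_eq, LinearMap.toSpanSingleton_apply, not_not] at ht
    rw [svec_vecMulVec_add_smul, map_add, map_add, map_smul, map_smul] at ht
    simp only [Set.mem_ofPred_eq, Polynomial.IsRoot, hp, Polynomial.eval_add, Polynomial.eval_mul,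
      Polynomial.eval_C, Polynomial.eval_X, Polynomial.eval_pow]
    simp only [smul_eq_mul] at ht
    linarith
  exact measure_mono_null hsub ((Polynomial.finite_setOfPred_isRoot hp0).measure_zero _)

/-- A proper subspace lies in the kernel of a nonzero functional, that is, in the zero set of a
nonzero quadratic form in `z`. -/
theorem ae_notMem_of_ne_top {S : Submodule ℝ (Sym2 n → ℝ)} (hS : S ≠ ⊤)
    {μ : Measure (n → ℝ)} (hμ : μ ≪ volume) :
    ∀ᵐ z ∂μ, svec (vecMulVec z z) ∉ S := by
  obtain ⟨f, hf, hle⟩ := Submodule.exists_le_ker_of_lt_top S (lt_top_iff_ne_top.2 hS)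
  filter_upwards [hμ.ae_le (ae_linearMap_svec_vecMulVec_ne_zero hf)] with z hz hmem
  exact hz (hle hmem)

/-- Samples are added one at a time: as long as there are fewer than the dimension, the previous
ones span a proper subspace, which a new independent sample avoids almost surely. -/
theorem ae_linearIndependent_svec : ∀ {k : ℕ}, k ≤ Fintype.card (Sym2 n) →
    ∀ (μ : Fin k → Measure (n → ℝ)) [∀ i, IsProbabilityMeasure (μ i)], (∀ i, μ i ≪ volume) →
    ∀ᵐ z ∂(Measure.pi μ), LinearIndependent ℝ fun i => svec (vecMulVec (z i) (z i)) := by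
  intro k
  induction k with
  | zero =>
    intro _ μ _ _
    exact Filter.Eventually.of_forall fun z => linearIndependent_empty_type
  | succ k ih =>
    intro hk μ _ hμ
    have hmeas : MeasurableSet {p : (n → ℝ) × (Fin k → n → ℝ) | LinearIndependent ℝ
        (Fin.cons (svec (vecMulVec p.1 p.1)) (fun i => svec (vecMulVec (p.2 i) (p.2 i))) :
          Fin (k + 1) → Sym2 n → ℝ)} := by
      have hc : Continuous fun p : (n → ℝ) × (Fin k → n → ℝ) =>
          (Fin.cons (svec (vecMulVec p.1 p.1)) (fun i => svec (vecMulVec (p.2 i) (p.2 i))) :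
          Fin (k + 1) → Sym2 n → ℝ) := by
        refine continuous_pi fun i => ?_
        refine Fin.cases ?_ (fun i => ?_) i
        · exact continuous_svec_vecMulVec.comp continuous_fst
        · exact continuous_svec_vecMulVec.comp ((continuous_apply i).comp continuous_snd)
      exact (isOpen_setOfPred_linearIndependent.preimage hc).measurableSet
    have hprod : ∀ᵐ p ∂((μ 0).prod (Measure.pi fun i : Fin k => μ i.succ)), LinearIndependent ℝ
        (Fin.cons (svec (vecMulVec p.1 p.1)) (fun i => svec (vecMulVec (p.2 i) (p.2 i))) :
          Fin (k + 1) → Sym2 n → ℝ) := by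
      -- The order of the quantifiers is exchanged so that the new sample is drawn after the other
      -- `k`, whose span is then fixed.
      rw [Measure.ae_prod_iff_ae_ae hmeas, Measure.ae_ae_comm hmeas]
      filter_upwards [ih (Nat.le_of_succ_le hk) (fun i => μ i.succ) fun i => hμ i.succ] with z hz
      have hne : Submodule.span ℝ (Set.range fun i => svec (vecMulVec (z i) (z i))) ≠ ⊤ := by
        intro h
        have h1 := finrank_span_eq_card hz
        rw [h, finrank_top, Module.finrank_fintype_fun_eq_card, Fintype.card_fin] at h1
        omega
      filter_upwards [ae_notMem_of_ne_top hne (hμ 0)] with z0 hz0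
      exact linearIndependent_finCons.2 ⟨hz, hz0⟩
    have hmp := measurePreserving_piFinSuccAbove μ 0
    filter_upwards [hmp.quasiMeasurePreserving.ae hprod] with z hz
    convert hz using 1
    ext i : 1
    refine Fin.cases ?_ (fun i => ?_) i
    · rfl
    · rfl

end Spanning

/-! ### The event of high probability -/

section GoodEvent

variable {nx nu nv nw N : ℕ} {A : Fin nv → Matrix (Fin nx) (Fin nx) ℝ}
  {B : Fin nv → Matrix (Fin nx) (Fin nu) ℝ} {M : Tensor (Fin nx) (Fin nx ⊕ Fin nu) (Fin nw)}
  {Ω : Type*} [MeasurableSpace Ω] {Pr : Measure Ω} [IsProbabilityMeasure Pr]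
  {ν : Measure (Fin nv → ℝ)} {z : Fin N → Ω → Fin nx ⊕ Fin nu → ℝ}
  {v : Fin N → Ω → Fin nv → ℝ} {y : Fin N → Ω → Fin nx → ℝ}

/-- The first `n(n+1)/2` samples are already almost surely a basis; further samples cannot shrink
the span. -/
theorem IsSample.ae_span_eq_top (h : IsSample Pr A B ν z v y)
    (hN : (nx + nu) * (nx + nu + 1) / 2 ≤ N) :
    ∀ᵐ ω ∂Pr, Submodule.span ℝ (Set.range fun i => svec (vecMulVec (z i ω) (z i ω))) = ⊤ := by
  have hcard : Fintype.card (Sym2 (Fin nx ⊕ Fin nu)) = (nx + nu) * (nx + nu + 1) / 2 := by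
    rw [Sym2.card, Nat.choose_two_right]
    simp [mul_comm]
  set d := (nx + nu) * (nx + nu + 1) / 2 with hd
  have hind : iIndepFun (fun i : Fin d => z (Fin.castLE hN i)) Pr := by
    have h1 : iIndepFun z Pr :=
      h.indep.comp (fun _ => Prod.fst) fun _ => measurable_fst
    exact h1.precomp (Fin.castLE_injective hN)
  have hlaw := (iIndepFun_iff_map_fun_eq_pi_map
    fun i : Fin d => (h.measurable_z (Fin.castLE hN i)).aemeasurable).1 hind
  have hprob : ∀ i : Fin d, IsProbabilityMeasure (Pr.map (z (Fin.castLE hN i))) := fun i =>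
    Measure.isProbabilityMeasure_map (h.measurable_z _).aemeasurable
  have hae := ae_linearIndependent_svec (k := d) hcard.ge
    (fun i => Pr.map (z (Fin.castLE hN i))) fun i => h.dominated_z _
  rw [← hlaw] at hae
  filter_upwards [ae_of_ae_map
    (measurable_pi_lambda _ fun i => h.measurable_z (Fin.castLE hN i)).aemeasurable hae] with ω hω
  rw [eq_top_iff, ← hω.span_eq_top_of_card_eq_finrank' (by simp [hcard])]
  refine Submodule.span_mono ?_
  rintro _ ⟨i, rfl⟩
  exact ⟨Fin.castLE hN i, rfl⟩

theorem measurable_modelNoise : Measurable (modelNoise A B M) := by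
  have : Continuous (modelNoise A B M) :=
    continuous_const.matrix_mulVec continuous_id
  exact this.measurable

/-- The joint law of the data factors into the law of all the regressors and the law of all the
noises. The bound for fixed `z` holds uniformly, so Fubini gives it for the data. -/
theorem IsSample.measure_not_errorBound_le [IsProbabilityMeasure ν]
    (h : IsSample Pr A B ν z v y) {rad δ : ℝ}
    (hrad : ∀ᵐ v ∂ν, ‖WithLp.toLp 2 (modelNoise A B M v)‖ ≤ rad) (hδ : 0 < δ) (hδ' : δ < 1) :
    Pr {ω | ¬ ErrorBound M ν (modelNoise A B M) rad δ (fun i => z i ω) (fun i => v i ω)} ≤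
      ENNReal.ofReal δ := by
  have hprob : ∀ i : Fin N, IsProbabilityMeasure (Pr.map (z i)) := fun i =>
    Measure.isProbabilityMeasure_map (h.measurable_z _).aemeasurable
  have hzv : ∀ i, Measurable fun ω => (z i ω, v i ω) := fun i =>
    (h.measurable_z i).prodMk (h.measurable_v i)
  have hlaw := (iIndepFun_iff_map_fun_eq_pi_map fun i => (hzv i).aemeasurable).1 h.indep
  have hfac : ∀ i, Pr.map (fun ω => (z i ω, v i ω)) = (Pr.map (z i)).prod ν := fun i => by
    rw [(indepFun_iff_map_prod_eq_prod_map_map (h.measurable_z i).aemeasurable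
      (h.measurable_v i).aemeasurable).1 (h.indep_z_v i), h.law_v]
  simp only [hfac] at hlaw
  have hmp := measurePreserving_arrowProdEquivProdArrow (Fin nx ⊕ Fin nu → ℝ) (Fin nv → ℝ) (Fin N)
    (fun i => Pr.map (z i)) (fun _ => ν)
  set S := {p : (Fin N → Fin nx ⊕ Fin nu → ℝ) × (Fin N → Fin nv → ℝ) |
    ErrorBound M ν (modelNoise A B M) rad δ p.1 p.2} with hS
  have hSm : MeasurableSet S := measurableSet_errorBound M measurable_modelNoise rad δ
  have hmeas : Measurable fun ω i => (z i ω, v i ω) := measurable_pi_lambda _ hzv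
  have e : Pr {ω | ¬ ErrorBound M ν (modelNoise A B M) rad δ (fun i => z i ω) (fun i => v i ω)} =
      ((Measure.pi fun i => Pr.map (z i)).prod (Measure.pi fun _ : Fin N => ν)) Sᶜ := by
    rw [← hmp.measure_preimage hSm.compl.nullMeasurableSet, ← hlaw,
      Measure.map_apply hmeas (hmp.measurable hSm.compl)]
    rfl
  rw [e, Measure.prod_apply hSm.compl]
  calc _ ≤ ∫⁻ _, ENNReal.ofReal δ ∂(Measure.pi fun i => Pr.map (z i)) :=
        lintegral_mono fun x => measure_pi_not_errorBound_le M measurable_modelNoise hrad hδ hδ' x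
    _ = ENNReal.ofReal δ := by simp

/-- With probability at least `1 - δ`, the confidence interval contains a matrix with the true
moment dynamics. -/
theorem IsSample.exists_good_event [IsProbabilityMeasure ν] (hM : ModelEquivalence A B M)
    (h : IsSample Pr A B ν z v y) {rad δ : ℝ}
    (hrad : ∀ᵐ v ∂ν, ‖WithLp.toLp 2 (modelNoise A B M v)‖ ≤ rad)
    (hN : (nx + nu) * (nx + nu + 1) / 2 ≤ N) (hδ : 0 < δ) (hδ' : δ < 1) :
    ∃ G : Set Ω, MeasurableSet G ∧ ENNReal.ofReal (1 - δ) ≤ Pr G ∧ ∀ ω ∈ G,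
      ∃ W : Matrix (Fin nw) (Fin nw) ℝ, W.IsSymm ∧
        Between (lowerW M rad δ (fun i => z i ω) (fun i => y i ω))
          (upperW M rad δ (fun i => z i ω) (fun i => y i ω)) W ∧
        ∀ Z : Matrix (Fin nx ⊕ Fin nu) (Fin nx ⊕ Fin nu) ℝ, Z.IsSymm →
          momentOp M W Z = momentOp M (trueMoment A B M ν) Z := by
  set S1 := {ω | ¬ ErrorBound M ν (modelNoise A B M) rad δ (fun i => z i ω) (fun i => v i ω)}
  set S2 := {ω | ¬ ((Submodule.span ℝ (Set.range fun i => svec (vecMulVec (z i ω) (z i ω))) = ⊤) ∧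
    ∀ i, y i ω = modeSum A (v i ω) *ᵥ (fun j => z i ω (Sum.inl j)) +
      modeSum B (v i ω) *ᵥ (fun j => z i ω (Sum.inr j)))}
  have hS2 : Pr S2 = 0 := ae_iff.1 ((h.ae_span_eq_top hN).and (ae_all_iff.2 h.output))
  -- The outputs are not assumed measurable, so the bad set is replaced by a measurable hull of
  -- equal measure.
  have hbad : Pr (toMeasurable Pr (S1 ∪ S2)) ≤ ENNReal.ofReal δ := by
    rw [measure_toMeasurable]
    refine (measure_union_le _ _).trans ?_
    rw [hS2, add_zero]
    exact h.measure_not_errorBound_le hrad hδ hδ'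
  refine ⟨(toMeasurable Pr (S1 ∪ S2))ᶜ, (measurableSet_toMeasurable _ _).compl, ?_, ?_⟩
  · rw [measure_compl (measurableSet_toMeasurable _ _) (measure_ne_top _ _), measure_univ,
      ENNReal.ofReal_sub _ hδ.le, ENNReal.ofReal_one]
    exact tsub_le_tsub_left hbad 1
  · intro ω hω
    have hω' : ω ∉ S1 ∪ S2 := fun hmem => hω (subset_toMeasurable _ _ hmem)
    rw [Set.mem_union, not_or] at hω'
    obtain ⟨h1, h2⟩ := hω'
    simp only [S1, S2, Set.mem_ofPred_eq, not_not] at h1 h2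
    have hWs : (trueMoment A B M ν).IsSymm := isSymm_secondMoment (τ := ν)
    -- The witness is the projection of the true moment onto what the data identify. The estimate is
    -- centred at this matrix, and it has the true dynamics.
    refine ⟨identifiedMoment M (fun i => z i ω) (trueMoment A B M ν), isSymm_identifiedMoment _ _,
      ?_, fun Z hZ => momentOp_identifiedMoment h2.1 hWs hZ⟩
    have hest := lsEstimate_eq (M := M) (z := fun i => z i ω) (y := fun i => y i ω)
      (w := fun i => modelNoise A B M (v i ω)) fun i => by rw [h2.2 i]; exact output_eq hM _ _
    have herr : lsEstimate M (fun i => z i ω) (fun i => y i ω) -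
        identifiedMoment M (fun i => z i ω) (trueMoment A B M ν) =
        estimationError M ν (modelNoise A B M) (fun i => z i ω) (fun i => v i ω) := by
      rw [hest, identifiedMoment, estimationError, ← Finset.sum_sub_distrib]
      refine Finset.sum_congr rfl fun i _ => ?_
      rw [← map_sub]
      rfl
    obtain ⟨h3, h4⟩ := h1
    rw [← herr] at h3 h4
    constructor
    · convert h3 using 1
      rw [lowerW]; abel
    · convert h4 using 1
      rw [upperW]; abel

end GoodEvent


/-! ### Traces and the semidefinite order -/

section TraceOrder

variable {n : Type} [Fintype n]

theorem trace_vecMulVec_mul (x : n → ℝ) (A : Matrix n n ℝ) :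
    (vecMulVec x x * A).trace = x ⬝ᵥ A *ᵥ x := by
  rw [vecMulVec_mul, trace_vecMulVec, dotProduct_mulVec, dotProduct_comm]

/-- The positive semidefinite cone is self-dual, and the rank one matrices suffice as tests. Matrix
inequalities can therefore be proved by pairing with moments `X`. -/
theorem posSemidef_of_trace {A : Matrix n n ℝ} (hA : A.IsSymm)
    (h : ∀ X : Matrix n n ℝ, X.PosSemidef → 0 ≤ (X * A).trace) : A.PosSemidef := by
  refine PosSemidef.of_dotProduct_mulVec_nonneg (isHermitian_iff_isSymm.2 hA) fun x => ?_
  rw [star_trivial, ← trace_vecMulVec_mul]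
  exact h _ (posSemidef_vecMulVec x)

omit [Fintype n] in
theorem isSymm_of_posSemidef {A : Matrix n n ℝ} (h : A.PosSemidef) : A.IsSymm :=
  isHermitian_iff_isSymm.1 h.isHermitian

theorem dotProduct_single_mulVec [DecidableEq n] (A : Matrix n n ℝ) (a b : n) :
    Pi.single a 1 ⬝ᵥ A *ᵥ Pi.single b 1 = A a b := by
  simp

theorem two_mul_apply_eq [DecidableEq n] {A : Matrix n n ℝ} (hA : A.IsSymm) (a b : n) :
    2 * A a b = (Pi.single a 1 + Pi.single b 1) ⬝ᵥ A *ᵥ (Pi.single a 1 + Pi.single b 1) -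
      A a a - A b b := by
  rw [mulVec_add, add_dotProduct, dotProduct_add, dotProduct_add, dotProduct_single_mulVec,
    dotProduct_single_mulVec, dotProduct_single_mulVec, dotProduct_single_mulVec, hA.apply a b]
  ring

/-- Testing at `e_a ± e_b` bounds an off-diagonal entry by the mean of two diagonal ones.
Convergence of traces to zero thereby gives convergence of positive semidefinite matrices. -/
theorem abs_apply_le_trace [DecidableEq n] {Y : Matrix n n ℝ} (hY : Y.PosSemidef) (a b : n) :
    |Y a b| ≤ Y.trace := by
  have hs := isSymm_of_posSemidef hY
  have h1 := hY.dotProduct_mulVec_nonneg (Pi.single a 1 + Pi.single b 1)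
  have h2 := hY.dotProduct_mulVec_nonneg (Pi.single a 1 - Pi.single b 1)
  rw [star_trivial] at h1 h2
  rw [mulVec_add, add_dotProduct, dotProduct_add, dotProduct_add, dotProduct_single_mulVec,
    dotProduct_single_mulVec, dotProduct_single_mulVec, dotProduct_single_mulVec,
    hs.apply a b] at h1
  rw [mulVec_sub, sub_dotProduct, dotProduct_sub, dotProduct_sub, dotProduct_single_mulVec,
    dotProduct_single_mulVec, dotProduct_single_mulVec, dotProduct_single_mulVec,
    hs.apply a b] at h2
  have hd : ∀ i, Y i i ≤ Y.trace := fun i =>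
    Finset.single_le_sum (f := fun i => Y i i) (fun j _ => hY.diag_nonneg) (Finset.mem_univ i)
  have := hd a
  have := hd b
  rw [abs_le]
  constructor <;> linarith

theorem exists_smul_one_sub_posSemidef [DecidableEq n] {B : Matrix n n ℝ} (hB : B.IsSymm) :
    ∃ b : ℝ, 0 < b ∧ (b • (1 : Matrix n n ℝ) - B).PosSemidef := by
  obtain ⟨U, a, hU1, hU2, rfl⟩ := exists_orthogonal_diagonal (isHermitian_iff_isSymm.2 hB)
  have hpos : 0 ≤ ∑ i, |a i| := Finset.sum_nonneg fun i _ => abs_nonneg _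
  refine ⟨∑ i, |a i| + 1, by linarith, ?_⟩
  have hone : ∀ r : ℝ, r • (1 : Matrix n n ℝ) = U * diagonal (fun _ => r) * Uᵀ := fun r => by
    rw [← smul_one_eq_diagonal, Matrix.mul_smul, Matrix.smul_mul, Matrix.mul_one, hU2]
  rw [hone, ← Matrix.sub_mul, ← Matrix.mul_sub, diagonal_sub]
  refine (PosSemidef.diagonal fun i => ?_).mul_mul_conjTranspose_same U
  have h1 := Finset.single_le_sum (f := fun i => |a i|) (fun j _ => abs_nonneg _)
    (Finset.mem_univ i)
  have h2 := le_abs_self (a i)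
  simp only [Pi.zero_apply, sub_nonneg]
  linarith

theorem exists_sub_smul_one_posSemidef [DecidableEq n] {A : Matrix n n ℝ} (hA : A.PosDef) :
    ∃ a : ℝ, 0 < a ∧ (A - a • (1 : Matrix n n ℝ)).PosSemidef := by
  obtain ⟨b, hb, h⟩ := exists_smul_one_sub_posSemidef (isSymm_of_posSemidef hA.inv.posSemidef)
  refine ⟨b⁻¹, inv_pos.2 hb, ?_⟩
  obtain ⟨U, a, hU1, hU2, rfl⟩ := exists_orthogonal_diagonal hA.isHermitian
  have hUinv : IsUnit U := IsUnit.of_mul_eq_one_right _ hU1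
  have hone : ∀ r : ℝ, r • (1 : Matrix n n ℝ) = U * diagonal (fun _ => r) * Uᵀ := fun r => by
    rw [← smul_one_eq_diagonal, Matrix.mul_smul, Matrix.smul_mul, Matrix.mul_one, hU2]
  have hapos : ∀ i, 0 < a i := by
    rw [← posDef_diagonal_iff]
    exact (hUinv.posDef_star_right_conjugate_iff).1 hA
  have hinv : (U * diagonal a * Uᵀ)⁻¹ = U * diagonal (fun i => (a i)⁻¹) * Uᵀ := by
    apply Matrix.inv_eq_left_inv
    rw [orthogonal_diagonal_mul hU1, orthogonal_diagonal_one hU2]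
    congr 3
    ext i
    exact inv_mul_cancel₀ (hapos i).ne'
  rw [hinv, hone, ← Matrix.sub_mul, ← Matrix.mul_sub, diagonal_sub] at h
  have h' := posSemidef_diagonal_iff.1 ((hUinv.posSemidef_star_right_conjugate_iff).1 h)
  rw [hone, ← Matrix.sub_mul, ← Matrix.mul_sub, diagonal_sub]
  refine (PosSemidef.diagonal fun i => ?_).mul_mul_conjTranspose_same U
  have h1 := sub_nonneg.1 (h' i)
  exact sub_nonneg.2 (inv_le_of_inv_le₀ (hapos i) h1)

/-- With `A ⪰ a I` and `B ⪯ b I`, both traces are compared with `tr X`, which gives the ratio `a /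
b`. The cap at one half keeps `1 - ε` positive, so that it can serve as a contraction rate. -/
theorem exists_sub_smul_posSemidef [DecidableEq n] {A B : Matrix n n ℝ} (hA : A.PosDef)
    (hB : B.IsSymm) : ∃ ε : ℝ, 0 < ε ∧ ε < 1 ∧ ∀ X : Matrix n n ℝ, X.PosSemidef →
      0 ≤ (B * X).trace → ε * (B * X).trace ≤ (A * X).trace := by
  obtain ⟨a, ha, h1⟩ := exists_sub_smul_one_posSemidef hA
  obtain ⟨b, hb, h2⟩ := exists_smul_one_sub_posSemidef hB
  have hm : 0 < min (a / b) (1 / 2) := lt_min (by positivity) (by norm_num)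
  refine ⟨min (a / b) (1 / 2), hm, (min_le_right _ _).trans_lt (by norm_num), fun X hX h0 => ?_⟩
  have h3 := trace_mul_nonneg h1 hX
  have h4 := trace_mul_nonneg h2 hX
  rw [Matrix.sub_mul, Matrix.trace_sub, Matrix.smul_mul, Matrix.trace_smul, Matrix.one_mul,
    smul_eq_mul] at h3 h4
  calc min (a / b) (1 / 2) * (B * X).trace ≤ a / b * (B * X).trace :=
        mul_le_mul_of_nonneg_right (min_le_left _ _) h0
    _ ≤ a / b * (b * X.trace) := mul_le_mul_of_nonneg_left (by linarith) (by positivity)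
    _ = a * X.trace := by field_simp
    _ ≤ _ := by linarith

end TraceOrder

/-! ### The adjoint of the moment dynamics -/

section Adjoint

variable {nx nu nw : ℕ} {M : Tensor (Fin nx) (Fin nx ⊕ Fin nu) (Fin nw)}
  {W : Matrix (Fin nw) (Fin nw) ℝ} {P : Matrix (Fin nx) (Fin nx) ℝ}

/-- The adjoint of the moment dynamics. -/
noncomputable def adjOp (M : Tensor (Fin nx) (Fin nx ⊕ Fin nu) (Fin nw))
    (W : Matrix (Fin nw) (Fin nw) ℝ) (P : Matrix (Fin nx) (Fin nx) ℝ) :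
    Matrix (Fin nx ⊕ Fin nu) (Fin nx ⊕ Fin nu) ℝ :=
  mat2 M * (W ⊗ₖ P) * (mat2 M)ᵀ

theorem mat2_eq_fromRows (M : Tensor (Fin nx) (Fin nx ⊕ Fin nu) (Fin nw)) :
    mat2 M = fromRows (mat2 (tensorA M)) (mat2 (tensorB M)) := by
  ext (i | i) p <;> rfl

theorem adjOp_eq_fromBlocks (hW : W.IsSymm) (hP : P.IsSymm) :
    adjOp M W P = fromBlocks (adjF M W P) (adjH M W P)ᵀ (adjH M W P) (adjG M W P) := by
  rw [adjOp, mat2_eq_fromRows, fromRows_mul, transpose_fromRows, fromRows_mul_fromCols]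
  congr 1
  rw [adjH, transpose_mul, transpose_mul, transpose_transpose, ← kroneckerMap_transpose, hW, hP,
    Matrix.mul_assoc]

theorem adjOp_apply (b b' : Fin nx ⊕ Fin nu) :
    adjOp M W P b b' = ∑ i : Fin nx × Fin nx, ∑ c : Fin nw × Fin nw,
      P i.1 i.2 * W c.1 c.2 * (M i.1 b c.1 * M i.2 b' c.2) := by
  simp only [adjOp, Matrix.mul_apply, mat2, kroneckerMap_apply, Matrix.transpose_apply,
    Finset.sum_mul]
  simp only [← Fintype.sum_prod_type']
  let e : ((Fin nw × Fin nx) × (Fin nw × Fin nx)) ≃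
      ((Fin nx × Fin nx) × (Fin nw × Fin nw)) :=
    { toFun := fun p => ((p.2.2, p.1.2), (p.2.1, p.1.1))
      invFun := fun p => ((p.2.2, p.1.2), (p.2.1, p.1.1))
      left_inv := fun _ => rfl
      right_inv := fun _ => rfl }
  refine Fintype.sum_equiv e _ _ fun p => ?_
  simp only [e, Equiv.coe_fn_mk]
  ring

/-- Both sides are the same multiple sum up to an exchange of the two mode indices, which is where
the symmetry of `W` enters. -/
theorem trace_mul_momentOp (hW : W.IsSymm) (P : Matrix (Fin nx) (Fin nx) ℝ)
    (Z : Matrix (Fin nx ⊕ Fin nu) (Fin nx ⊕ Fin nu) ℝ) :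
    (P * momentOp M W Z).trace = (Z * adjOp M W P).trace := by
  have h1 : (P * momentOp M W Z).trace = ∑ i : Fin nx × Fin nx,
      ∑ b : (Fin nx ⊕ Fin nu) × (Fin nx ⊕ Fin nu), ∑ c : Fin nw × Fin nw,
      P i.1 i.2 * (Z b.1 b.2 * W c.1 c.2 * (M i.2 b.1 c.1 * M i.1 b.2 c.2)) := by
    rw [Fintype.sum_prod_type]
    simp only [Matrix.trace, Matrix.diag_apply, Matrix.mul_apply, momentOp_apply, Finset.mul_sum]
  have h2 : (Z * adjOp M W P).trace = ∑ b : (Fin nx ⊕ Fin nu) × (Fin nx ⊕ Fin nu),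
      ∑ i : Fin nx × Fin nx, ∑ c : Fin nw × Fin nw,
      Z b.1 b.2 * (P i.1 i.2 * W c.1 c.2 * (M i.1 b.2 c.1 * M i.2 b.1 c.2)) := by
    rw [Fintype.sum_prod_type]
    simp only [Matrix.trace, Matrix.diag_apply, Matrix.mul_apply, adjOp_apply, Finset.mul_sum]
  rw [h1, h2, Finset.sum_comm]
  refine Finset.sum_congr rfl fun b _ => Finset.sum_congr rfl fun i _ => ?_
  refine Fintype.sum_equiv (Equiv.prodComm _ _) _ _ fun c => ?_
  simp only [Equiv.prodComm_apply, Prod.fst_swap, Prod.snd_swap, hW.apply c.1 c.2]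
  ring

theorem posSemidef_momentOp (hW : W.PosSemidef)
    {Z : Matrix (Fin nx ⊕ Fin nu) (Fin nx ⊕ Fin nu) ℝ} (hZ : Z.PosSemidef) :
    (momentOp M W Z).PosSemidef :=
  (hW.kronecker hZ).mul_mul_conjTranspose_same _

theorem isSymm_adjOp (hW : W.IsSymm) (hP : P.IsSymm) : (adjOp M W P).IsSymm := by
  rw [Matrix.IsSymm, adjOp, transpose_mul, transpose_mul, transpose_transpose,
    ← Matrix.mul_assoc, ← kroneckerMap_transpose, hW, hP]

/-- The adjoint depends on the moment dynamics on the symmetric matrices only. -/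
theorem adjOp_congr {W W' : Matrix (Fin nw) (Fin nw) ℝ} (hW : W.IsSymm) (hW' : W'.IsSymm)
    (h : ∀ Z : Matrix (Fin nx ⊕ Fin nu) (Fin nx ⊕ Fin nu) ℝ, Z.IsSymm →
      momentOp M W Z = momentOp M W' Z) (hP : P.IsSymm) : adjOp M W P = adjOp M W' P := by
  set D := adjOp M W P - adjOp M W' P with hD
  have hDs : D.IsSymm := (isSymm_adjOp hW hP).sub (isSymm_adjOp hW' hP)
  -- The difference of the adjoints is itself a symmetric matrix, so duality can be tested against
  -- it and shows that its Frobenius norm is zero.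
  have h1 : (D * D).trace = 0 := by
    nth_rewrite 2 [hD]
    rw [Matrix.mul_sub, Matrix.trace_sub, ← trace_mul_momentOp hW, ← trace_mul_momentOp hW',
      h D hDs, sub_self]
  have h2 : Dᴴ = D := isHermitian_iff_isSymm.2 hDs
  have h3 : D = 0 := trace_conjTranspose_mul_self_eq_zero_iff.1 (by rw [h2]; exact h1)
  exact sub_eq_zero.1 h3

theorem adj_blocks_congr {W W' : Matrix (Fin nw) (Fin nw) ℝ} (hW : W.IsSymm) (hW' : W'.IsSymm)
    (h : ∀ Z : Matrix (Fin nx ⊕ Fin nu) (Fin nx ⊕ Fin nu) ℝ, Z.IsSymm →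
      momentOp M W Z = momentOp M W' Z) (hP : P.IsSymm) :
    adjF M W P = adjF M W' P ∧ adjG M W P = adjG M W' P ∧ adjH M W P = adjH M W' P := by
  have h1 := adjOp_congr hW hW' h hP
  rw [adjOp_eq_fromBlocks hW hP, adjOp_eq_fromBlocks hW' hP, fromBlocks_inj] at h1
  exact ⟨h1.1, h1.2.2.2, h1.2.2.1⟩

/-- The Riccati equation sees `W` only through the dynamics on symmetric matrices. A confidence
bound that is not positive semidefinite may thus be exchanged for an equivalent one that is. -/
theorem isRiccatiPair_congr {W W' : Matrix (Fin nw) (Fin nw) ℝ} (hW : W.IsSymm) (hW' : W'.IsSymm)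
    (h : ∀ Z : Matrix (Fin nx ⊕ Fin nu) (Fin nx ⊕ Fin nu) ℝ, Z.IsSymm →
      momentOp M W Z = momentOp M W' Z) {Q : Matrix (Fin nx) (Fin nx) ℝ}
    {R : Matrix (Fin nu) (Fin nu) ℝ} {K : Matrix (Fin nu) (Fin nx) ℝ} :
    IsRiccatiPair M Q R W P K ↔ IsRiccatiPair M Q R W' P K := by
  refine and_congr_right fun hP => ?_
  obtain ⟨hF, hG, hH⟩ := adj_blocks_congr hW hW' h (isSymm_of_posSemidef hP.posSemidef)
  rw [hF, hG, hH]

end Adjoint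

/-! ### Linear policies and closed loops -/

section Policy

variable {nx nu nw : ℕ} {M : Tensor (Fin nx) (Fin nx ⊕ Fin nu) (Fin nw)}
  {W : Matrix (Fin nw) (Fin nw) ℝ} {K : Matrix (Fin nu) (Fin nx) ℝ}
  {X : Matrix (Fin nx) (Fin nx) ℝ}

theorem policyOp_eq (K : Matrix (Fin nu) (Fin nx) ℝ) (X : Matrix (Fin nx) (Fin nx) ℝ) :
    policyOp K X = fromRows 1 K * X * (fromRows 1 K)ᵀ := by
  rw [policyOp, transpose_fromRows, transpose_one]

theorem policyOp_eq_fromBlocks (K : Matrix (Fin nu) (Fin nx) ℝ) (X : Matrix (Fin nx) (Fin nx) ℝ) :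
    policyOp K X = fromBlocks X (X * Kᵀ) (K * X) (K * X * Kᵀ) := by
  rw [policyOp, fromRows_mul, fromRows_mul_fromCols, Matrix.one_mul, Matrix.mul_one,
    Matrix.mul_one]

theorem toBlocks₁₁_policyOp : (policyOp K X).toBlocks₁₁ = X := by
  rw [policyOp_eq_fromBlocks, toBlocks_fromBlocks₁₁]

theorem posSemidef_policyOp (hX : X.PosSemidef) : (policyOp K X).PosSemidef := by
  rw [policyOp_eq]
  exact hX.mul_mul_conjTranspose_same _

theorem isSymm_policyOp (hX : X.IsSymm) : (policyOp K X).IsSymm := by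
  rw [policyOp_eq, Matrix.IsSymm, transpose_mul, transpose_mul, transpose_transpose, hX,
    Matrix.mul_assoc]

theorem posSemidef_closedLoop (hW : W.PosSemidef) (hX : X.PosSemidef) :
    (closedLoop M W K X).PosSemidef :=
  posSemidef_momentOp hW (posSemidef_policyOp hX)

theorem isSymm_closedLoop (hW : W.IsSymm) (hX : X.IsSymm) : (closedLoop M W K X).IsSymm :=
  isSymm_momentOp M hW (isSymm_policyOp hX)

/-- The closed loop as a linear map. -/
noncomputable def closedLoopLin (M : Tensor (Fin nx) (Fin nx ⊕ Fin nu) (Fin nw))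
    (W : Matrix (Fin nw) (Fin nw) ℝ) (K : Matrix (Fin nu) (Fin nx) ℝ) :
    Matrix (Fin nx) (Fin nx) ℝ →ₗ[ℝ] Matrix (Fin nx) (Fin nx) ℝ where
  toFun := closedLoop M W K
  map_add' X Y := by
    rw [closedLoop, policyOp, Matrix.mul_add, Matrix.add_mul, ← momentLin_apply, map_add]; rfl
  map_smul' c X := by
    rw [closedLoop, policyOp, Matrix.mul_smul, Matrix.smul_mul, ← momentLin_apply, map_smul]; rfl

theorem posSemidef_iterate_closedLoop (hW : W.PosSemidef) (hX : X.PosSemidef) (t : ℕ) :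
    ((closedLoop M W K)^[t] X).PosSemidef := by
  induction t with
  | zero => exact hX
  | succ t ih => rw [Function.iterate_succ_apply']; exact posSemidef_closedLoop hW ih

theorem posSemidef_toBlocks₁₁ {Z : Matrix (Fin nx ⊕ Fin nu) (Fin nx ⊕ Fin nu) ℝ}
    (hZ : Z.PosSemidef) : Z.toBlocks₁₁.PosSemidef :=
  hZ.submatrix Sum.inl

theorem posSemidef_toBlocks₂₂ {Z : Matrix (Fin nx ⊕ Fin nu) (Fin nx ⊕ Fin nu) ℝ}
    (hZ : Z.PosSemidef) : Z.toBlocks₂₂.PosSemidef :=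
  hZ.submatrix Sum.inr

theorem trace_mul_fromBlocks (Z : Matrix (Fin nx ⊕ Fin nu) (Fin nx ⊕ Fin nu) ℝ)
    (Q : Matrix (Fin nx) (Fin nx) ℝ) (R : Matrix (Fin nu) (Fin nu) ℝ) :
    (Z * fromBlocks Q 0 0 R).trace = (Z.toBlocks₁₁ * Q).trace + (Z.toBlocks₂₂ * R).trace := by
  conv_lhs => rw [← fromBlocks_toBlocks Z]
  rw [fromBlocks_multiply]
  simp [Matrix.trace, Fintype.sum_sum_type]

end Policy


/-! ### The Riccati equation: Bellman identity, stability, uniqueness, existence -/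

section Riccati

variable {nx nu nw : ℕ} {M : Tensor (Fin nx) (Fin nx ⊕ Fin nu) (Fin nw)}
  {W : Matrix (Fin nw) (Fin nw) ℝ} {Q : Matrix (Fin nx) (Fin nx) ℝ}
  {R : Matrix (Fin nu) (Fin nu) ℝ} {P : Matrix (Fin nx) (Fin nx) ℝ}

/-- The Riccati operator. -/
noncomputable def riccatiOp (M : Tensor (Fin nx) (Fin nx ⊕ Fin nu) (Fin nw))
    (Q : Matrix (Fin nx) (Fin nx) ℝ) (R : Matrix (Fin nu) (Fin nu) ℝ)
    (W : Matrix (Fin nw) (Fin nw) ℝ) (P : Matrix (Fin nx) (Fin nx) ℝ) :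
    Matrix (Fin nx) (Fin nx) ℝ :=
  Q + adjF M W P - (adjH M W P)ᵀ * (R + adjG M W P)⁻¹ * adjH M W P

/-- The optimal gain for the value matrix `P`. -/
noncomputable def riccatiGain (M : Tensor (Fin nx) (Fin nx ⊕ Fin nu) (Fin nw))
    (R : Matrix (Fin nu) (Fin nu) ℝ) (W : Matrix (Fin nw) (Fin nw) ℝ)
    (P : Matrix (Fin nx) (Fin nx) ℝ) : Matrix (Fin nu) (Fin nx) ℝ :=
  -((R + adjG M W P)⁻¹ * adjH M W P)

/-- The matrix `[-K, I]` for the optimal gain `K`. -/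
noncomputable def innovation (M : Tensor (Fin nx) (Fin nx ⊕ Fin nu) (Fin nw))
    (R : Matrix (Fin nu) (Fin nu) ℝ) (W : Matrix (Fin nw) (Fin nw) ℝ)
    (P : Matrix (Fin nx) (Fin nx) ℝ) : Matrix (Fin nu) (Fin nx ⊕ Fin nu) ℝ :=
  fromCols (-riccatiGain M R W P) 1

theorem posSemidef_adjG (hW : W.PosSemidef) (hP : P.PosSemidef) : (adjG M W P).PosSemidef :=
  (hW.kronecker hP).mul_mul_conjTranspose_same _

theorem posDef_add_adjG (hR : R.PosDef) (hW : W.PosSemidef) (hP : P.PosSemidef) :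
    (R + adjG M W P).PosDef :=
  hR.add_posSemidef (posSemidef_adjG hW hP)

theorem isSymm_riccatiOp (hQ : Q.IsSymm) (hR : R.IsSymm) (hW : W.IsSymm) (hP : P.IsSymm) :
    (riccatiOp M Q R W P).IsSymm := by
  have hk : (W ⊗ₖ P)ᵀ = W ⊗ₖ P := by rw [← kroneckerMap_transpose, hW, hP]
  have hF : (adjF M W P)ᵀ = adjF M W P := by
    rw [adjF, transpose_mul, transpose_mul, transpose_transpose, hk, Matrix.mul_assoc]
  have hG : (adjG M W P)ᵀ = adjG M W P := by
    rw [adjG, transpose_mul, transpose_mul, transpose_transpose, hk, Matrix.mul_assoc]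
  rw [Matrix.IsSymm, riccatiOp, transpose_sub, transpose_add, transpose_mul, transpose_mul,
    transpose_transpose, transpose_nonsing_inv, transpose_add, hF, hG, hQ, hR, Matrix.mul_assoc]

/-- Completion of squares for the Bellman operator. -/
theorem adjOp_add_fromBlocks (hR : R.PosDef) (hW : W.PosSemidef) (hP : P.PosSemidef) :
    adjOp M W P + fromBlocks Q 0 0 R = fromBlocks (riccatiOp M Q R W P) 0 0 0 +
      (innovation M R W P)ᵀ * (R + adjG M W P) *
        innovation M R W P := by
  have hS := posDef_add_adjG (M := M) hR hW hP
  set S := R + adjG M W P with hSdef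
  have hSs : Sᵀ = S := isSymm_of_posSemidef hS.posSemidef
  have hdet : IsUnit S.det := (Matrix.isUnit_iff_isUnit_det _).1 hS.isUnit
  rw [adjOp_eq_fromBlocks (isSymm_of_posSemidef hW) (isSymm_of_posSemidef hP), fromBlocks_add,
    innovation, riccatiGain, neg_neg, transpose_fromCols, fromRows_mul, fromRows_mul_fromCols, fromBlocks_add,
    transpose_mul, transpose_nonsing_inv, ← hSdef, hSs, transpose_one]
  simp only [Matrix.one_mul, Matrix.mul_one, zero_add, add_zero]
  rw [Matrix.mul_assoc _ S⁻¹ S, Matrix.nonsing_inv_mul _ hdet, Matrix.mul_one, ← Matrix.mul_assoc S,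
    Matrix.mul_nonsing_inv _ hdet, Matrix.one_mul, riccatiOp, ← hSdef]
  congr 1
  · rw [← Matrix.mul_assoc]; abel
  · rw [hSdef]; abel

/-- The completed square is paired with `Z`. The last term is nonnegative for `Z ⪰ 0`, which gives
the Bellman inequality, and it vanishes for the optimal gain, which gives equality. -/
theorem bellman_eq (hR : R.PosDef) (hW : W.PosSemidef) (hP : P.PosSemidef)
    (Z : Matrix (Fin nx ⊕ Fin nu) (Fin nx ⊕ Fin nu) ℝ) :
    (Z * fromBlocks Q 0 0 R).trace + (P * momentOp M W Z).trace =
      (Z.toBlocks₁₁ * riccatiOp M Q R W P).trace +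
      ((R + adjG M W P) * (innovation M R W P * Z *
        (innovation M R W P)ᵀ)).trace := by
  rw [trace_mul_momentOp (isSymm_of_posSemidef hW), add_comm, ← Matrix.trace_add,
    ← Matrix.mul_add, adjOp_add_fromBlocks hR hW hP, Matrix.mul_add, Matrix.trace_add,
    trace_mul_fromBlocks, Matrix.mul_zero, Matrix.trace_zero, add_zero, Matrix.mul_assoc _ _
    (innovation M R W P), ← Matrix.mul_assoc Z, Matrix.trace_mul_comm (Z * _)]
  simp only [Matrix.mul_assoc]

theorem bellman_le (hR : R.PosDef) (hW : W.PosSemidef) (hP : P.PosSemidef)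
    {Z : Matrix (Fin nx ⊕ Fin nu) (Fin nx ⊕ Fin nu) ℝ} (hZ : Z.PosSemidef) :
    (Z.toBlocks₁₁ * riccatiOp M Q R W P).trace ≤
      (Z * fromBlocks Q 0 0 R).trace + (P * momentOp M W Z).trace := by
  rw [bellman_eq hR hW hP]
  have := trace_mul_nonneg (posDef_add_adjG (M := M) hR hW hP).posSemidef
    (hZ.mul_mul_conjTranspose_same (innovation M R W P))
  rw [conjTranspose_eq_transpose_of_trivial] at this
  linarith

theorem bellman_policy_le (hR : R.PosDef) (hW : W.PosSemidef) (hP : P.PosSemidef)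
    {X : Matrix (Fin nx) (Fin nx) ℝ} (hX : X.PosSemidef) (K : Matrix (Fin nu) (Fin nx) ℝ) :
    (X * riccatiOp M Q R W P).trace ≤
      (policyOp K X * fromBlocks Q 0 0 R).trace + (P * closedLoop M W K X).trace := by
  have := bellman_le (Q := Q) (M := M) hR hW hP (posSemidef_policyOp (K := K) hX)
  rwa [toBlocks₁₁_policyOp] at this

/-- The matrix `[-K, I]` annihilates `[I; K]`, so the square in the Bellman identity disappears. -/
theorem bellman_gain_eq (hR : R.PosDef) (hW : W.PosSemidef) (hP : P.PosSemidef)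
    (X : Matrix (Fin nx) (Fin nx) ℝ) :
    (policyOp (riccatiGain M R W P) X * fromBlocks Q 0 0 R).trace +
      (P * closedLoop M W (riccatiGain M R W P) X).trace =
      (X * riccatiOp M Q R W P).trace := by
  have h0 : innovation M R W P *
      fromRows (1 : Matrix (Fin nx) (Fin nx) ℝ) (riccatiGain M R W P) = 0 := by
    rw [innovation, fromCols_mul_fromRows, Matrix.mul_one, Matrix.one_mul, neg_add_cancel]
  rw [closedLoop, bellman_eq hR hW hP, toBlocks₁₁_policyOp, policyOp,
    ← Matrix.mul_assoc (innovation M R W P), ← Matrix.mul_assoc (innovation M R W P), h0]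
  simp

theorem trace_policy_cost_ge (hR : R.PosDef)
    {Z : Matrix (Fin nx ⊕ Fin nu) (Fin nx ⊕ Fin nu) ℝ} (hZ : Z.PosSemidef) :
    (Q * Z.toBlocks₁₁).trace ≤ (Z * fromBlocks Q 0 0 R).trace := by
  rw [trace_mul_fromBlocks, Matrix.trace_mul_comm Q]
  have := trace_mul_nonneg (posSemidef_toBlocks₂₂ hZ) hR.posSemidef
  linarith

theorem trace_cost_nonneg (hQ : Q.PosDef) (hR : R.PosDef)
    {Z : Matrix (Fin nx ⊕ Fin nu) (Fin nx ⊕ Fin nu) ℝ} (hZ : Z.PosSemidef) :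
    0 ≤ (Z * fromBlocks Q 0 0 R).trace :=
  (trace_mul_nonneg hQ.posSemidef (posSemidef_toBlocks₁₁ hZ)).trans (trace_policy_cost_ge hR hZ)

theorem trace_mul_le_riccatiOp (hR : R.PosDef) (hW : W.PosSemidef)
    (hP : P.PosSemidef) {X : Matrix (Fin nx) (Fin nx) ℝ} (hX : X.PosSemidef) :
    (X * Q).trace ≤ (X * riccatiOp M Q R W P).trace := by
  rw [← bellman_gain_eq hR hW hP]
  have h1 := trace_policy_cost_ge (Q := Q) hR (posSemidef_policyOp (K := riccatiGain M R W P) hX)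
  rw [toBlocks₁₁_policyOp, Matrix.trace_mul_comm] at h1
  have h2 := trace_mul_nonneg hP (posSemidef_closedLoop (M := M) (K := riccatiGain M R W P) hW hX)
  linarith

theorem posSemidef_riccatiOp_sub (hQ : Q.PosDef) (hR : R.PosDef) (hW : W.PosSemidef)
    (hP : P.PosSemidef) : (riccatiOp M Q R W P - Q).PosSemidef := by
  refine posSemidef_of_trace ?_ fun X hX => ?_
  · exact (isSymm_riccatiOp (isSymm_of_posSemidef hQ.posSemidef)
      (isSymm_of_posSemidef hR.posSemidef) (isSymm_of_posSemidef hW)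
      (isSymm_of_posSemidef hP)).sub (isSymm_of_posSemidef hQ.posSemidef)
  · rw [Matrix.mul_sub, Matrix.trace_sub]
    linarith [trace_mul_le_riccatiOp (M := M) (Q := Q) hR hW hP hX]

theorem posDef_riccatiOp (hQ : Q.PosDef) (hR : R.PosDef) (hW : W.PosSemidef)
    (hP : P.PosSemidef) : (riccatiOp M Q R W P).PosDef := by
  have := hQ.add_posSemidef (posSemidef_riccatiOp_sub (M := M) hQ hR hW hP)
  rwa [add_sub_cancel] at this

/-- The gain that is optimal for the larger matrix is an admissible, possibly suboptimal, choice for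
the smaller one. -/
theorem riccatiOp_mono (hR : R.PosDef) (hW : W.PosSemidef) (hP : P.PosSemidef)
    {P' : Matrix (Fin nx) (Fin nx) ℝ} (hP' : P'.PosSemidef)
    (h : ∀ X : Matrix (Fin nx) (Fin nx) ℝ, X.PosSemidef → (X * P).trace ≤ (X * P').trace)
    {X : Matrix (Fin nx) (Fin nx) ℝ} (hX : X.PosSemidef) :
    (X * riccatiOp M Q R W P).trace ≤ (X * riccatiOp M Q R W P').trace := by
  rw [← bellman_gain_eq hR hW hP']
  refine (bellman_policy_le hR hW hP hX (riccatiGain M R W P')).trans ?_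
  have := h _ (posSemidef_closedLoop (M := M) (K := riccatiGain M R W P') hW hX)
  rw [Matrix.trace_mul_comm P, Matrix.trace_mul_comm P']
  linarith

/-- Asymptotic stability of a closed loop on the symmetric matrices. -/
def IsStable (S : Matrix (Fin nx) (Fin nx) ℝ → Matrix (Fin nx) (Fin nx) ℝ) : Prop :=
  ∀ X : Matrix (Fin nx) (Fin nx) ℝ, X.IsSymm →
    Filter.Tendsto (fun t => S^[t] X) Filter.atTop (nhds 0)

theorem closedLoop_iterate_eq (K : Matrix (Fin nu) (Fin nx) ℝ) (t : ℕ) :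
    (closedLoop M W K)^[t] = ((closedLoopLin M W K) ^ t : _ →ₗ[ℝ] _) := by
  rw [Module.End.coe_pow]
  rfl

/-- Lyapunov's criterion. -/
theorem isStable_of_lyapunov (hW : W.PosSemidef) {K : Matrix (Fin nu) (Fin nx) ℝ} (hP : P.PosDef)
    {ε : ℝ} (hε : 0 < ε) (hε1 : ε < 1)
    (h : ∀ X : Matrix (Fin nx) (Fin nx) ℝ, X.PosSemidef →
      (P * closedLoop M W K X).trace ≤ (1 - ε) * (P * X).trace) :
    IsStable (closedLoop M W K) := by
  obtain ⟨p, hp, hp1⟩ := exists_sub_smul_one_posSemidef hP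
  have hdecay : ∀ X : Matrix (Fin nx) (Fin nx) ℝ, X.PosSemidef → ∀ t,
      (P * (closedLoop M W K)^[t] X).trace ≤ (1 - ε) ^ t * (P * X).trace := by
    intro X hX t
    induction t with
    | zero => simp
    | succ t ih =>
      rw [Function.iterate_succ_apply']
      refine (h _ (posSemidef_iterate_closedLoop hW hX t)).trans ?_
      rw [pow_succ', mul_assoc]
      exact mul_le_mul_of_nonneg_left ih (by linarith)
  have hpsd : ∀ X : Matrix (Fin nx) (Fin nx) ℝ, X.PosSemidef →
      Filter.Tendsto (fun t => (closedLoop M W K)^[t] X) Filter.atTop (nhds 0) := by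
    intro X hX
    refine tendsto_pi_nhds.2 fun a => tendsto_pi_nhds.2 fun b => ?_
    have hb : Filter.Tendsto (fun t : ℕ => p⁻¹ * ((1 - ε) ^ t * (P * X).trace)) Filter.atTop
        (nhds 0) := by
      have := (tendsto_pow_atTop_nhds_zero_of_lt_one (r := 1 - ε) (by linarith)
        (by linarith)).mul_const (P * X).trace
      simpa using this.const_mul p⁻¹
    refine squeeze_zero_norm (fun t => ?_) hb
    have hY := posSemidef_iterate_closedLoop (M := M) (K := K) hW hX t
    refine (abs_apply_le_trace hY a b).trans ?_
    have h1 := trace_mul_nonneg hp1 hY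
    rw [Matrix.sub_mul, Matrix.trace_sub, Matrix.smul_mul, Matrix.trace_smul, Matrix.one_mul,
      smul_eq_mul] at h1
    rw [le_inv_mul_iff₀ hp]
    linarith [hdecay X hX t]
  intro X hX
  -- Decay on the cone extends to every symmetric matrix by writing it as `b I - (b I - X)`.
  obtain ⟨b, hb, hbX⟩ := exists_smul_one_sub_posSemidef hX
  have h1 := hpsd _ (PosSemidef.one.smul hb.le : (b • (1 : Matrix (Fin nx) (Fin nx) ℝ)).PosSemidef)
  have h2 := hpsd _ hbX
  have h3 := h1.sub h2
  rw [sub_zero] at h3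
  refine h3.congr fun t => ?_
  rw [closedLoop_iterate_eq, ← map_sub, sub_sub_cancel]

theorem IsRiccatiPair.eq_gain {K : Matrix (Fin nu) (Fin nx) ℝ} (h : IsRiccatiPair M Q R W P K) :
    K = riccatiGain M R W P := h.2.2

theorem IsRiccatiPair.riccatiOp_eq {K : Matrix (Fin nu) (Fin nx) ℝ}
    (h : IsRiccatiPair M Q R W P K) : riccatiOp M Q R W P = P := h.2.1.symm

theorem IsRiccatiPair.trace_eq {K : Matrix (Fin nu) (Fin nx) ℝ} (h : IsRiccatiPair M Q R W P K)
    (hR : R.PosDef) (hW : W.PosSemidef) (X : Matrix (Fin nx) (Fin nx) ℝ) :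
    (policyOp K X * fromBlocks Q 0 0 R).trace + (P * closedLoop M W K X).trace =
      (P * X).trace := by
  have := bellman_gain_eq (Q := Q) (M := M) hR hW h.1.posSemidef X
  rw [h.riccatiOp_eq, ← h.eq_gain, Matrix.trace_mul_comm X] at this
  exact this

/-- Along the closed loop `tr(P X)` drops by the stage cost, which is at least `tr(Q X)` and hence
at least a fixed fraction of `tr(P X)`. -/
theorem IsRiccatiPair.exists_contraction {K : Matrix (Fin nu) (Fin nx) ℝ}
    (h : IsRiccatiPair M Q R W P K) (hQ : Q.PosDef) (hR : R.PosDef) (hW : W.PosSemidef) :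
    ∃ ε : ℝ, 0 < ε ∧ ε < 1 ∧ ∀ X : Matrix (Fin nx) (Fin nx) ℝ, X.PosSemidef →
      (P * closedLoop M W K X).trace ≤ (1 - ε) * (P * X).trace := by
  obtain ⟨ε, h0, h1, h2⟩ := exists_sub_smul_posSemidef hQ (isSymm_of_posSemidef h.1.posSemidef)
  refine ⟨ε, h0, h1, fun X hX => ?_⟩
  have h3 := h2 X hX (trace_mul_nonneg h.1.posSemidef hX)
  have h4 := h.trace_eq hR hW X
  have h5 := trace_policy_cost_ge (Q := Q) hR (posSemidef_policyOp (K := K) hX)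
  rw [toBlocks₁₁_policyOp] at h5
  linarith

/-- The Riccati gain stabilizes every smaller moment dynamics. -/
theorem IsRiccatiPair.isStable_of_le {K : Matrix (Fin nu) (Fin nx) ℝ}
    (h : IsRiccatiPair M Q R W P K) (hQ : Q.PosDef) (hR : R.PosDef) (hW : W.PosSemidef)
    {W' : Matrix (Fin nw) (Fin nw) ℝ} (hW' : W'.PosSemidef) (hle : (W - W').PosSemidef) :
    IsStable (closedLoop M W' K) := by
  obtain ⟨ε, h0, h1, h2⟩ := h.exists_contraction hQ hR hW
  refine isStable_of_lyapunov hW' h.1 h0 h1 fun X hX => le_trans ?_ (h2 X hX)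
  have h3 := trace_mul_nonneg h.1.posSemidef
    (posSemidef_momentOp (M := M) hle (posSemidef_policyOp (K := K) hX))
  rw [← momentLin_apply, map_sub, LinearMap.sub_apply, Matrix.mul_sub, Matrix.trace_sub] at h3
  exact sub_nonneg.1 h3

theorem tendsto_trace_mul_zero {Y : ℕ → Matrix (Fin nx) (Fin nx) ℝ}
    (h : Filter.Tendsto Y Filter.atTop (nhds 0)) (P : Matrix (Fin nx) (Fin nx) ℝ) :
    Filter.Tendsto (fun t => (P * Y t).trace) Filter.atTop (nhds 0) := by
  have hc : Continuous fun Y : Matrix (Fin nx) (Fin nx) ℝ => (P * Y).trace := by fun_prop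
  have := (hc.tendsto 0).comp h
  rwa [Matrix.mul_zero, Matrix.trace_zero] at this

/-- Under the gain `K'` the Bellman relation is an equality for `P'` and an inequality for `P`, so
`tr((P - P') X_t)` is nondecreasing in `t`. It tends to zero because `K'` is stabilizing, so it
starts nonpositive. -/
theorem IsRiccatiPair.trace_le {K : Matrix (Fin nu) (Fin nx) ℝ} {P' : Matrix (Fin nx) (Fin nx) ℝ}
    {K' : Matrix (Fin nu) (Fin nx) ℝ} (h : IsRiccatiPair M Q R W P K)
    (h' : IsRiccatiPair M Q R W P' K') (hQ : Q.PosDef) (hR : R.PosDef) (hW : W.PosSemidef)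
    {X : Matrix (Fin nx) (Fin nx) ℝ} (hX : X.PosSemidef) : (P * X).trace ≤ (P' * X).trace := by
  have hstab : IsStable (closedLoop M W K') :=
    h'.isStable_of_le hQ hR hW hW (by simp [PosSemidef.zero])
  have hstep : ∀ X : Matrix (Fin nx) (Fin nx) ℝ, X.PosSemidef →
      ((P - P') * X).trace ≤ ((P - P') * closedLoop M W K' X).trace := by
    intro X hX
    have h1 := bellman_policy_le (Q := Q) (M := M) hR hW h.1.posSemidef hX K'
    rw [h.riccatiOp_eq, Matrix.trace_mul_comm X] at h1
    have h2 := h'.trace_eq hR hW X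
    rw [Matrix.sub_mul, Matrix.sub_mul, Matrix.trace_sub, Matrix.trace_sub]
    linarith
  have hiter : ∀ t, ((P - P') * X).trace ≤ ((P - P') * (closedLoop M W K')^[t] X).trace := by
    intro t
    induction t with
    | zero => simp
    | succ t ih =>
      rw [Function.iterate_succ_apply']
      exact ih.trans (hstep _ (posSemidef_iterate_closedLoop hW hX t))
  have := ge_of_tendsto' (tendsto_trace_mul_zero (hstab X (isSymm_of_posSemidef hX)) (P - P')) hiter
  rw [Matrix.sub_mul, Matrix.trace_sub] at this
  linarith

theorem IsRiccatiPair.unique {K : Matrix (Fin nu) (Fin nx) ℝ} {P' : Matrix (Fin nx) (Fin nx) ℝ}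
    {K' : Matrix (Fin nu) (Fin nx) ℝ} (h : IsRiccatiPair M Q R W P K)
    (h' : IsRiccatiPair M Q R W P' K') (hQ : Q.PosDef) (hR : R.PosDef) (hW : W.PosSemidef) :
    P = P' ∧ K = K' := by
  have key : ∀ {P P' : Matrix (Fin nx) (Fin nx) ℝ} {K K' : Matrix (Fin nu) (Fin nx) ℝ},
      IsRiccatiPair M Q R W P K → IsRiccatiPair M Q R W P' K' → (P' - P).PosSemidef := by
    intro P P' K K' h h'
    refine posSemidef_of_trace ((isSymm_of_posSemidef h'.1.posSemidef).sub
      (isSymm_of_posSemidef h.1.posSemidef)) fun X hX => ?_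
    have := h.trace_le h' hQ hR hW hX
    rw [Matrix.mul_sub, Matrix.trace_sub, Matrix.trace_mul_comm X, Matrix.trace_mul_comm X]
    linarith
  have h1 := key h h'
  have h2 := key h' h
  have htr : (P' - P).trace = 0 := by
    have := h1.trace_nonneg
    have := h2.trace_nonneg
    rw [Matrix.trace_sub] at *
    linarith
  have hP : P = P' := (sub_eq_zero.1 (h1.trace_eq_zero_iff.1 htr)).symm
  exact ⟨hP, by rw [h.eq_gain, h'.eq_gain, hP]⟩

theorem continuousAt_riccatiOp (hR : R.PosDef) (hW : W.PosSemidef) (hP : P.PosSemidef) :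
    ContinuousAt (riccatiOp M Q R W) P := by
  have hF : Continuous (adjF M W) := by
    unfold adjF
    refine (continuous_const.matrix_mul ?_).matrix_mul continuous_const
    exact continuous_matrix fun i j => by simp only [kroneckerMap_apply]; fun_prop
  have hG : Continuous (adjG M W) := by
    unfold adjG
    refine (continuous_const.matrix_mul ?_).matrix_mul continuous_const
    exact continuous_matrix fun i j => by simp only [kroneckerMap_apply]; fun_prop
  have hH : Continuous (adjH M W) := by
    unfold adjH
    refine (continuous_const.matrix_mul ?_).matrix_mul continuous_const
    exact continuous_matrix fun i j => by simp only [kroneckerMap_apply]; fun_prop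
  have hinv : ContinuousAt (fun P => (R + adjG M W P)⁻¹) P := by
    have hdet : (R + adjG M W P).det ≠ 0 :=
      ((Matrix.isUnit_iff_isUnit_det _).1 (posDef_add_adjG hR hW hP).isUnit).ne_zero
    have h1 : ContinuousAt (fun S : Matrix (Fin nu) (Fin nu) ℝ => S⁻¹) (R + adjG M W P) :=
      continuousAt_matrix_inv _ (by
        rw [Ring.inverse_eq_inv']; exact continuousAt_inv₀ hdet)
    exact ContinuousAt.comp (f := fun P => R + adjG M W P) h1
      (continuous_const.add hG).continuousAt
  have hc3 : Continuous fun q : Matrix (Fin nx) (Fin nx) ℝ × Matrix (Fin nu) (Fin nu) ℝ =>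
      Q + adjF M W q.1 - (adjH M W q.1)ᵀ * q.2 * adjH M W q.1 :=
    (continuous_const.add (hF.comp continuous_fst)).sub
      (((hH.comp continuous_fst).matrix_transpose.matrix_mul continuous_snd).matrix_mul
        (hH.comp continuous_fst))
  exact ContinuousAt.comp (f := fun P => (P, (R + adjG M W P)⁻¹)) hc3.continuousAt
    (continuousAt_id.prodMk hinv)

/-- Value iteration converges if some gain has finite cost. -/
theorem exists_isRiccatiPair (hQ : Q.PosDef) (hR : R.PosDef) (hW : W.PosSemidef)
    (K : Matrix (Fin nu) (Fin nx) ℝ)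
    (hK : ∀ X : Matrix (Fin nx) (Fin nx) ℝ, X.PosSemidef →
      Summable fun t => (policyOp K ((closedLoop M W K)^[t] X) * fromBlocks Q 0 0 R).trace) :
    ∃ (P : Matrix (Fin nx) (Fin nx) ℝ) (K : Matrix (Fin nu) (Fin nx) ℝ),
      IsRiccatiPair M Q R W P K := by
  -- The iterate `V t` represents the optimal cost over `t` stages with no terminal cost; starting
  -- from zero makes the sequence increasing.
  set V : ℕ → Matrix (Fin nx) (Fin nx) ℝ := fun t => (riccatiOp M Q R W)^[t] 0 with hV
  have hVs : ∀ t, V (t + 1) = riccatiOp M Q R W (V t) := fun t =>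
    Function.iterate_succ_apply' _ _ _
  have hpsd : ∀ t, (V t).PosSemidef := by
    intro t
    induction t with
    | zero => exact PosSemidef.zero
    | succ t ih => rw [hVs]; exact (posDef_riccatiOp hQ hR hW ih).posSemidef
  have hmono : ∀ t, ∀ X : Matrix (Fin nx) (Fin nx) ℝ, X.PosSemidef →
      (X * V t).trace ≤ (X * V (t + 1)).trace := by
    intro t
    induction t with
    | zero =>
      intro X hX
      have : V 0 = 0 := rfl
      rw [this, Matrix.mul_zero, Matrix.trace_zero]
      exact trace_mul_nonneg hX (hpsd 1)
    | succ t ih =>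
      intro X hX
      rw [hVs t, hVs (t + 1)]
      exact riccatiOp_mono hR hW (hpsd t) (hpsd (t + 1)) ih hX
  -- The optimal cost over `t` stages is at most the cost of the fixed gain `K` over those stages,
  -- and by summability this stays bounded as `t` grows.
  have hbound : ∀ t, ∀ X : Matrix (Fin nx) (Fin nx) ℝ, X.PosSemidef → (X * V t).trace ≤
      ∑ j ∈ Finset.range t,
        (policyOp K ((closedLoop M W K)^[j] X) * fromBlocks Q 0 0 R).trace := by
    intro t
    induction t with
    | zero =>
      intro X hX
      have : V 0 = 0 := rfl
      simp [this]
    | succ t ih =>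
      intro X hX
      rw [hVs, Finset.sum_range_succ']
      refine (bellman_policy_le hR hW (hpsd t) hX K).trans ?_
      have := ih _ (posSemidef_closedLoop (M := M) (K := K) hW hX)
      rw [Matrix.trace_mul_comm] at this
      simp only [Function.iterate_succ_apply, Function.iterate_zero, id] at *
      linarith
  have hconv : ∀ x : Fin nx → ℝ, ∃ l, Filter.Tendsto (fun t => x ⬝ᵥ V t *ᵥ x) Filter.atTop
      (nhds l) := by
    intro x
    have hx := posSemidef_vecMulVec x
    simp only [← trace_vecMulVec_mul]
    refine ⟨_, tendsto_atTop_ciSup (monotone_nat_of_le_succ fun t => hmono t _ hx) ?_⟩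
    refine ⟨∑' j, (policyOp K ((closedLoop M W K)^[j] (vecMulVec x x)) *
      fromBlocks Q 0 0 R).trace, ?_⟩
    rintro _ ⟨t, rfl⟩
    refine (hbound t _ hx).trans ((hK _ hx).sum_le_tsum _ fun j _ => ?_)
    exact trace_cost_nonneg hQ hR (posSemidef_policyOp (posSemidef_iterate_closedLoop hW hx j))
  choose q hq using hconv
  -- Polarization recovers the entries of the limit from the limits of the quadratic forms at `e_a`,
  -- `e_b` and `e_a + e_b`.
  have hlim : ∃ P, Filter.Tendsto V Filter.atTop (nhds P) := by
    refine ⟨Matrix.of fun a b => (q (Pi.single a 1 + Pi.single b 1) - q (Pi.single a 1) -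
      q (Pi.single b 1)) / 2, ?_⟩
    refine tendsto_pi_nhds.2 fun a => tendsto_pi_nhds.2 fun b => ?_
    have h1 := (((hq (Pi.single a 1 + Pi.single b 1)).sub (hq (Pi.single a 1))).sub
      (hq (Pi.single b 1))).div_const 2
    refine h1.congr fun t => ?_
    have := two_mul_apply_eq (isSymm_of_posSemidef (hpsd t)) a b
    rw [dotProduct_single_mulVec, dotProduct_single_mulVec]
    linarith
  obtain ⟨P, hP⟩ := hlim
  have hPpsd : P.PosSemidef :=
    isClosed_posSemidef.mem_of_tendsto hP (Filter.Eventually.of_forall hpsd)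
  have hfix : riccatiOp M Q R W P = P := by
    have h1 : Filter.Tendsto (fun t => V (t + 1)) Filter.atTop
        (nhds (riccatiOp M Q R W P)) := by
      simp only [hVs]
      exact (continuousAt_riccatiOp hR hW hPpsd).tendsto.comp hP
    exact tendsto_nhds_unique h1 (hP.comp (Filter.tendsto_add_atTop_nat 1))
  refine ⟨P, riccatiGain M R W P, ?_, hfix.symm, rfl⟩
  have := posDef_riccatiOp (M := M) hQ hR hW hPpsd
  rwa [hfix] at this

end Riccati

/-! ### Values of the moment control problems -/

section Value

variable {nx nu nw : ℕ} {M : Tensor (Fin nx) (Fin nx ⊕ Fin nu) (Fin nw)}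
  {W : Matrix (Fin nw) (Fin nw) ℝ} {Q : Matrix (Fin nx) (Fin nx) ℝ}
  {R : Matrix (Fin nu) (Fin nu) ℝ} {P : Matrix (Fin nx) (Fin nx) ℝ}
  {K : Matrix (Fin nu) (Fin nx) ℝ} {X₀ : Matrix (Fin nx) (Fin nx) ℝ}

/-- The Bellman inequality telescopes to a bound with terminal term `tr(P X_t)`. A trajectory of
infinite cost is trivial, and finite cost makes the terminal term vanish in the limit. -/
theorem IsRiccatiPair.le_momentCost (h : IsRiccatiPair M Q R W P K) (hQ : Q.PosDef)
    (hR : R.PosDef) (hW : W.PosSemidef)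
    {Z : ℕ → Matrix (Fin nx ⊕ Fin nu) (Fin nx ⊕ Fin nu) ℝ} (hZ : IsFeasible M W X₀ Z) :
    ENNReal.ofReal (P * X₀).trace ≤ momentCost Q R Z := by
  obtain ⟨hpsd, h0, hstep⟩ := hZ
  set c : ℕ → ℝ := fun t => (Z t * fromBlocks Q 0 0 R).trace with hc
  have hc0 : ∀ t, 0 ≤ c t := fun t => trace_cost_nonneg hQ hR (hpsd t)
  rcases eq_or_ne (momentCost Q R Z) ⊤ with htop | htop
  · rw [htop]; exact le_top
  have hsum : Summable c := by
    have := ENNReal.summable_toReal htop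
    exact this.congr fun t => ENNReal.toReal_ofReal (hc0 t)
  have hcost : momentCost Q R Z = ENNReal.ofReal (∑' t, c t) :=
    (ENNReal.ofReal_tsum_of_nonneg hc0 hsum).symm
  rw [hcost]
  refine ENNReal.ofReal_le_ofReal ?_
  have hle : ∀ t, (P * (Z t).toBlocks₁₁).trace ≤ c t + (P * (Z (t + 1)).toBlocks₁₁).trace := by
    intro t
    have := bellman_le (Q := Q) (M := M) hR hW h.1.posSemidef (hpsd t)
    rwa [h.riccatiOp_eq, Matrix.trace_mul_comm, ← hstep] at this
  have hpart : ∀ t, (P * X₀).trace ≤ ∑ s ∈ Finset.range t, c s + (P * (Z t).toBlocks₁₁).trace := by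
    intro t
    induction t with
    | zero => simp [h0]
    | succ t ih =>
      rw [Finset.sum_range_succ]
      linarith [hle t]
  -- Since `Q ≻ 0`, the terminal term is at most a constant times the stage cost, which tends to
  -- zero by summability.
  obtain ⟨ε, hε, -, hεP⟩ := exists_sub_smul_posSemidef hQ (isSymm_of_posSemidef h.1.posSemidef)
  have htail : Filter.Tendsto (fun t => (P * (Z t).toBlocks₁₁).trace) Filter.atTop (nhds 0) := by
    have h1 : Filter.Tendsto (fun t => ε⁻¹ * c t) Filter.atTop (nhds 0) := by
      simpa using hsum.tendsto_atTop_zero.const_mul ε⁻¹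
    refine squeeze_zero (fun t => trace_mul_nonneg h.1.posSemidef (posSemidef_toBlocks₁₁ (hpsd t)))
      (fun t => ?_) h1
    rw [le_inv_mul_iff₀ hε]
    exact (hεP _ (posSemidef_toBlocks₁₁ (hpsd t)) (trace_mul_nonneg h.1.posSemidef
      (posSemidef_toBlocks₁₁ (hpsd t)))).trans (trace_policy_cost_ge hR (hpsd t))
  have := hsum.hasSum.tendsto_sum_nat.add htail
  rw [add_zero] at this
  exact ge_of_tendsto' this hpart

/-- For the Riccati gain the telescoped relation is an equality, and the nonnegative terminal term
may be dropped. -/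
theorem IsRiccatiPair.momentCost_le (h : IsRiccatiPair M Q R W P K) (hQ : Q.PosDef)
    (hR : R.PosDef) (hW : W.PosSemidef)
    {Z : ℕ → Matrix (Fin nx ⊕ Fin nu) (Fin nx ⊕ Fin nu) ℝ} (hZ : IsFeasible M W X₀ Z)
    (hK : ∀ t, Z t = policyOp K (Z t).toBlocks₁₁) :
    momentCost Q R Z ≤ ENNReal.ofReal (P * X₀).trace := by
  obtain ⟨hpsd, h0, hstep⟩ := hZ
  have hpart : ∀ t, ∑ s ∈ Finset.range t, (Z s * fromBlocks Q 0 0 R).trace +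
      (P * (Z t).toBlocks₁₁).trace = (P * X₀).trace := by
    intro t
    induction t with
    | zero => simp [h0]
    | succ t ih =>
      have := h.trace_eq hR hW (Z t).toBlocks₁₁
      rw [closedLoop, ← hK, ← hstep] at this
      rw [Finset.sum_range_succ]
      linarith
  rw [momentCost, ENNReal.tsum_eq_iSup_nat]
  refine iSup_le fun t => ?_
  rw [← ENNReal.ofReal_sum_of_nonneg fun s _ => trace_cost_nonneg hQ hR (hpsd s)]
  refine ENNReal.ofReal_le_ofReal ?_
  have := trace_mul_nonneg h.1.posSemidef (posSemidef_toBlocks₁₁ (hpsd t))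
  linarith [hpart t]

theorem IsRiccatiPair.le_valCP (h : IsRiccatiPair M Q R W P K) (hQ : Q.PosDef)
    (hR : R.PosDef) (hW : W.PosSemidef) :
    ENNReal.ofReal (P * X₀).trace ≤ valCP M Q R W X₀ :=
  le_iInf₂ fun _ hZ => h.le_momentCost hQ hR hW hZ

/-- The robust value dominates the value of each moment dynamics in the interval. -/
theorem valCP_le_valDR (hW : W.PosSemidef) (hX₀ : X₀.PosSemidef)
    {W₁ W₂ W' : Matrix (Fin nw) (Fin nw) ℝ} (hb : Between W₁ W₂ W')
    (h : ∀ Z : Matrix (Fin nx ⊕ Fin nu) (Fin nx ⊕ Fin nu) ℝ, Z.IsSymm →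
      momentOp M W' Z = momentOp M W Z) :
    valCP M Q R W X₀ ≤ valDR M Q R W₁ W₂ X₀ := by
  refine le_iInf₂ fun π hπ => ?_
  -- the history generated by the policy
  let hist : (t : ℕ) → Fin (t + 1) → Matrix (Fin nx) (Fin nx) ℝ := fun t =>
    Nat.rec (fun _ => X₀) (fun t ht => Fin.snoc ht (momentOp M W' (π t ht))) t
  let Z : ℕ → Matrix (Fin nx ⊕ Fin nu) (Fin nx ⊕ Fin nu) ℝ := fun t => π t (hist t)
  have hhist : ∀ t, hist (t + 1) = Fin.snoc (hist t) (momentOp M W' (Z t)) := fun t => rfl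
  have hpsd : ∀ t s, (hist t s).PosSemidef := by
    intro t
    induction t with
    | zero => exact fun _ => hX₀
    | succ t ih =>
      intro s
      rw [hhist]
      refine Fin.lastCases ?_ (fun s => ?_) s
      -- `W'` need not be positive semidefinite, so the next moment is shown to stay in the cone
      -- through the equivalent `W`, which is.
      · rw [Fin.snoc_last, h _ (isSymm_of_posSemidef (hπ t _ ih).1)]
        exact posSemidef_momentOp hW (hπ t _ ih).1
      · rw [Fin.snoc_castSucc]
        exact ih s
  have hZ : ∀ t, (Z t).PosSemidef := fun t => (hπ t _ (hpsd t)).1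
  have hblock : ∀ t, (Z t).toBlocks₁₁ = hist t (Fin.last t) := fun t => (hπ t _ (hpsd t)).2
  have hhistZ : ∀ t, ∀ s : Fin (t + 1), hist t s = (Z s).toBlocks₁₁ := by
    intro t
    induction t with
    | zero => intro s; rw [Fin.fin_one_eq_zero s]; exact (hblock 0).symm
    | succ t ih =>
      intro s
      refine Fin.lastCases ?_ (fun s => ?_) s
      · exact (hblock (t + 1)).symm
      · rw [hhist, Fin.snoc_castSucc, ih s]; rfl
  have hstep : ∀ t, (Z (t + 1)).toBlocks₁₁ = momentOp M W' (Z t) := fun t => by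
    rw [hblock, hhist, Fin.snoc_last]
  have hfeas : IsFeasible M W X₀ Z := ⟨hZ, hblock 0, fun t => by
    rw [hstep, h _ (isSymm_of_posSemidef (hZ t))]⟩
  have hfeas' : IsFeasible M W' X₀ Z := ⟨hZ, hblock 0, hstep⟩
  have hfol : Follows π Z := fun t => by
    change π t (hist t) = _
    congr 1
    exact funext (hhistZ t)
  calc valCP M Q R W X₀ ≤ momentCost Q R Z := iInf₂_le Z hfeas
    _ ≤ ⨆ (Z) (_ : IsFeasible M W' X₀ Z ∧ Follows π Z), momentCost Q R Z :=
      le_iSup₂ (f := fun Z (_ : IsFeasible M W' X₀ Z ∧ Follows π Z) => momentCost Q R Z)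
        Z ⟨hfeas', hfol⟩
    _ ≤ _ := le_iSup₂ (f := fun W (_ : Between W₁ W₂ W) =>
      ⨆ (Z) (_ : IsFeasible M W X₀ Z ∧ Follows π Z), momentCost Q R Z) W' hb

end Value


/-! ### Spectral radius and iterates -/

section Rho

open scoped Matrix.Norms.Operator

variable {n : Type} [Fintype n] [DecidableEq n]

theorem opMatrix_mulVec_svec (S : Matrix n n ℝ →ₗ[ℝ] Matrix n n ℝ) {X : Matrix n n ℝ}
    (hX : X.IsSymm) : opMatrix S *ᵥ svec X = svec (S X) := by
  have h : opMatrix S = LinearMap.toMatrix' (svecLin n ∘ₗ S ∘ₗ unsvecLin n) := by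
    ext p q
    rw [LinearMap.toMatrix'_apply]
    rfl
  rw [h, LinearMap.toMatrix'_mulVec]
  simp only [LinearMap.comp_apply, svecLin_apply, unsvecLin_apply, unsvec_svec hX]

/-- This passes between real iterates and powers of the complex matrix that defines the spectral
radius. Invariance of the symmetric matrices is needed at each step, since `svec` is faithful only
there. -/
theorem opMatrix_complex_pow_mulVec (S : Matrix n n ℝ →ₗ[ℝ] Matrix n n ℝ)
    (hS : ∀ X : Matrix n n ℝ, X.IsSymm → (S X).IsSymm) {X : Matrix n n ℝ} (hX : X.IsSymm) (t : ℕ) :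
    ((opMatrix S).map Complex.ofReal) ^ t *ᵥ (fun p => (svec X p : ℂ)) =
      fun p => (svec (S^[t] X) p : ℂ) := by
  have hsymm : ∀ t, (S^[t] X).IsSymm := by
    intro t
    induction t with
    | zero => exact hX
    | succ t ih => rw [Function.iterate_succ_apply']; exact hS _ ih
  induction t with
  | zero => simp
  | succ t ih =>
    rw [pow_succ', ← mulVec_mulVec, ih, Function.iterate_succ_apply',
      ← opMatrix_mulVec_svec S (hsymm t)]
    ext p
    exact (RingHom.map_mulVec Complex.ofRealHom (opMatrix S) (svec (S^[t] X)) p).symm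

theorem norm_ofReal_comp {ι : Type} [Fintype ι] (x : ι → ℝ) : ‖fun i => (x i : ℂ)‖ = ‖x‖ := by
  simp only [Pi.norm_def, ← Complex.nnnorm_real]

/-- Powers of a matrix with spectral radius less than one are summable. -/
theorem summable_norm_pow_of_spectralRadius_lt_one {ι : Type} [Fintype ι] [DecidableEq ι]
    {L : Matrix ι ι ℂ} (h : spectralRadius ℂ L < 1) : Summable fun t => ‖L ^ t‖ := by
  obtain ⟨r, hr, hr1⟩ := ENNReal.lt_iff_exists_nnreal_btwn.1 h
  have hr1' : r < 1 := by exact_mod_cast hr1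
  -- By Gelfand's formula the norms of the powers are eventually below those of a geometric sequence
  -- with a ratio `r` between the spectral radius and one.
  have hev := (spectrum.pow_nnnorm_pow_one_div_tendsto_nhds_spectralRadius L).eventually_lt_const hr
  refine Summable.of_norm_bounded_eventually_nat (g := fun t => (r : ℝ) ^ t)
    (summable_geometric_of_lt_one r.2 (by exact_mod_cast hr1')) ?_
  filter_upwards [hev, Filter.eventually_gt_atTop 0] with t ht ht0
  rw [norm_norm]
  have ht0' : (0 : ℝ) < t := by exact_mod_cast ht0
  rw [one_div, ENNReal.rpow_inv_lt_iff ht0', ENNReal.rpow_natCast, ← ENNReal.coe_pow,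
    ENNReal.coe_lt_coe] at ht
  exact_mod_cast ht.le

/-- The spectral radius is at most `(‖Lᵗ⁺¹‖ ‖1‖)^(1/(t+1))` for every `t`, and one power small
enough to make the base less than one suffices. -/
theorem spectralRadius_lt_one_of_tendsto {ι : Type} [Fintype ι] [DecidableEq ι]
    {L : Matrix ι ι ℂ} (h : Filter.Tendsto (fun t => L ^ t) Filter.atTop (nhds 0)) :
    spectralRadius ℂ L < 1 := by
  have h1 : Filter.Tendsto (fun t => ‖L ^ (t + 1)‖₊ * ‖(1 : Matrix ι ι ℂ)‖₊) Filter.atTop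
      (nhds 0) := by
    have := ((h.comp (Filter.tendsto_add_atTop_nat 1)).nnnorm).mul_const ‖(1 : Matrix ι ι ℂ)‖₊
    simpa using this
  obtain ⟨t, ht⟩ := (h1.eventually_lt_const zero_lt_one).exists
  refine (spectrum.spectralRadius_le_pow_nnnorm_pow_one_div ℂ L t).trans_lt ?_
  have hpos : (0 : ℝ) < 1 / (t + 1) := by positivity
  rw [← ENNReal.mul_rpow_of_nonneg _ _ hpos.le]
  refine ENNReal.rpow_lt_one ?_ hpos
  exact_mod_cast ht

/-- Iterates of a map with spectral radius less than one are summable. -/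
theorem summable_iterate_of_rho_lt_one {S : Matrix n n ℝ →ₗ[ℝ] Matrix n n ℝ}
    (hS : ∀ X : Matrix n n ℝ, X.IsSymm → (S X).IsSymm) (h : rho S < 1) {X : Matrix n n ℝ}
    (hX : X.IsSymm) (f : Matrix n n ℝ →ₗ[ℝ] ℝ) : Summable fun t => f (S^[t] X) := by
  have hsymm : ∀ t, (S^[t] X).IsSymm := by
    intro t
    induction t with
    | zero => exact hX
    | succ t ih => rw [Function.iterate_succ_apply']; exact hS _ ih
  have h1 : Summable fun t => svec (S^[t] X) := by
    refine Summable.of_norm_bounded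
      ((summable_norm_pow_of_spectralRadius_lt_one h).mul_right ‖svec X‖) fun t => ?_
    rw [← norm_ofReal_comp, ← opMatrix_complex_pow_mulVec S hS hX t, ← norm_ofReal_comp (svec X)]
    exact Matrix.linfty_opNorm_mulVec _ _
  have h2 := (LinearMap.toContinuousLinearMap (f ∘ₗ unsvecLin n)).summable h1
  refine h2.congr fun t => ?_
  simp [unsvecLin_apply, unsvec_svec (hsymm t)]

/-- The columns of the powers of the matrix are the iterates of the symmetric basis matrices in
`svec` coordinates, so convergence of the iterates is convergence of the powers. -/
theorem rho_lt_one_of_tendsto {S : Matrix n n ℝ →ₗ[ℝ] Matrix n n ℝ}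
    (hS : ∀ X : Matrix n n ℝ, X.IsSymm → (S X).IsSymm)
    (h : ∀ X : Matrix n n ℝ, X.IsSymm →
      Filter.Tendsto (fun t => S^[t] X) Filter.atTop (nhds 0)) : rho S < 1 := by
  refine spectralRadius_lt_one_of_tendsto ?_
  refine tendsto_pi_nhds.2 fun p => tendsto_pi_nhds.2 fun q => ?_
  have h1 := opMatrix_complex_pow_mulVec S hS (isSymm_unsvec (Pi.single q 1))
  have h2 : ∀ t, (((opMatrix S).map Complex.ofReal) ^ t) p q =
      (svec (S^[t] (unsvec (Pi.single q 1))) p : ℂ) := by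
    intro t
    rw [← congrFun (h1 t) p, svec_unsvec]
    have h3 : (fun p => ((Pi.single q (1 : ℝ) : Sym2 n → ℝ) p : ℂ)) = Pi.single q 1 := by
      ext p
      rcases eq_or_ne p q with rfl | hpq
      · simp
      · simp [hpq]
    rw [h3, mulVec_single_one]
    rfl
  simp only [h2]
  have h4 : Continuous fun X : Matrix n n ℝ => (svec X p : ℂ) := by
    unfold svec
    fun_prop
  have h5 := (h4.tendsto 0).comp (h _ (isSymm_unsvec (Pi.single q 1)))
  have h6 : svec (0 : Matrix n n ℝ) = 0 := map_zero (svecLin n)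
  rw [h6] at h5
  simpa [Function.comp_def] using h5

end Rho

/-! ### Spectral radius of the closed loop -/

section ClosedLoop

variable {nx nu nw : ℕ} {M : Tensor (Fin nx) (Fin nx ⊕ Fin nu) (Fin nw)}
  {W : Matrix (Fin nw) (Fin nw) ℝ} {K : Matrix (Fin nu) (Fin nx) ℝ}

theorem IsStable.rho_lt_one (hW : W.IsSymm) (h : IsStable (closedLoop M W K)) :
    rho (closedLoop M W K) < 1 :=
  rho_lt_one_of_tendsto (S := closedLoopLin M W K) (fun _ hX => isSymm_closedLoop hW hX) h

theorem summable_policy_cost (hW : W.IsSymm) (h : rho (closedLoop M W K) < 1)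
    (H : Matrix (Fin nx ⊕ Fin nu) (Fin nx ⊕ Fin nu) ℝ) {X : Matrix (Fin nx) (Fin nx) ℝ}
    (hX : X.IsSymm) : Summable fun t => (policyOp K ((closedLoop M W K)^[t] X) * H).trace :=
  summable_iterate_of_rho_lt_one (S := closedLoopLin M W K)
    (fun _ hX => isSymm_closedLoop hW hX) h hX
    { toFun := fun X => (policyOp K X * H).trace
      map_add' := fun X Y => by
        simp only [policyOp, Matrix.mul_add, Matrix.add_mul, Matrix.trace_add]
      map_smul' := fun c X => by
        simp only [policyOp, Matrix.mul_smul, Matrix.smul_mul, Matrix.trace_smul,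
          RingHom.id_apply] }

theorem rho_closedLoop_congr {W' : Matrix (Fin nw) (Fin nw) ℝ}
    (h : ∀ Z : Matrix (Fin nx ⊕ Fin nu) (Fin nx ⊕ Fin nu) ℝ, Z.IsSymm →
      momentOp M W' Z = momentOp M W Z) :
    rho (closedLoop M W' K) = rho (closedLoop M W K) := by
  have : opMatrix (closedLoop M W' K) = opMatrix (closedLoop M W K) := by
    ext p q
    simp only [opMatrix, closedLoop, h _ (isSymm_policyOp (K := K) (isSymm_unsvec _))]
  rw [rho, rho, this]

end ClosedLoop


/-! ### One step of the stochastic system and its second moments -/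

section OneStep

variable {nx nu nv nw : ℕ} {A : Fin nv → Matrix (Fin nx) (Fin nx) ℝ}
  {B : Fin nv → Matrix (Fin nx) (Fin nu) ℝ} {M : Tensor (Fin nx) (Fin nx ⊕ Fin nu) (Fin nw)}
  {Ω : Type*} {mΩ : MeasurableSpace Ω} {μ : Measure Ω} {ν : Measure (Fin nv → ℝ)} {rad : ℝ}
  {V : Ω → Fin nv → ℝ} {ζ : Ω → Fin nx ⊕ Fin nu → ℝ}

theorem integrable_mul_of_memLp {ι : Type} {ζ : Ω → ι → ℝ}
    (hζ : ∀ j, MemLp (fun ω => ζ ω j) 2 μ) (i j : ι) :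
    Integrable (fun ω => ζ ω i * ζ ω j) μ :=
  (hζ i).integrable_mul (hζ j)

theorem memLp_mulVec {ι κ : Type} [Fintype ι] {ζ : Ω → ι → ℝ}
    (hζ : ∀ j, MemLp (fun ω => ζ ω j) 2 μ) (L : Matrix κ ι ℝ) (j : κ) :
    MemLp (fun ω => (L *ᵥ ζ ω) j) 2 μ :=
  memLp_finsetSum _ fun i _ => (hζ i).const_mul (L j i)

theorem secondMoment_mulVec {ι κ : Type} [Fintype ι] {ζ : Ω → ι → ℝ}
    (hζ : ∀ j, MemLp (fun ω => ζ ω j) 2 μ) (L : Matrix κ ι ℝ) :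
    secondMoment μ (fun ω => L *ᵥ ζ ω) = L * secondMoment μ ζ * Lᵀ := by
  ext a b
  have h : ∀ ω, (L *ᵥ ζ ω) a * (L *ᵥ ζ ω) b = ∑ j, ∑ i, L a i * L b j * (ζ ω i * ζ ω j) := by
    intro ω
    rw [mulVec, mulVec, dotProduct, dotProduct, Fintype.sum_mul_sum, Finset.sum_comm]
    exact Finset.sum_congr rfl fun j _ => Finset.sum_congr rfl fun i _ => by ring
  have hi := integrable_mul_of_memLp hζ
  simp only [secondMoment, h, Matrix.mul_apply, Matrix.transpose_apply, Finset.sum_mul]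
  rw [integral_finsetSum _ fun j _ => integrable_finsetSum _ fun i _ => (hi i j).const_mul _]
  refine Finset.sum_congr rfl fun j _ => ?_
  rw [integral_finsetSum _ fun i _ => (hi i j).const_mul _]
  refine Finset.sum_congr rfl fun i _ => ?_
  rw [integral_const_mul]
  ring

theorem memLp_output (hV : Measurable V) (hlaw : μ.map V = ν)
    (hrad : ∀ᵐ v ∂ν, ‖WithLp.toLp 2 (modelNoise A B M v)‖ ≤ rad)
    (hζ : ∀ j, MemLp (fun ω => ζ ω j) 2 μ) (i : Fin nx) :
    MemLp (fun ω => ∑ k, ∑ j, modelNoise A B M (V ω) k * M i j k * ζ ω j) 2 μ := by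
  subst hlaw
  refine memLp_finsetSum _ fun k _ => memLp_finsetSum _ fun j _ => ?_
  refine (hζ j).of_le_mul (c := rad * |M i j k|) ?_ ?_
  · exact (((measurable_pi_iff.1 measurable_modelNoise k).comp hV).mul_const
      _).aestronglyMeasurable.mul (hζ j).aestronglyMeasurable
  · filter_upwards [ae_of_ae_map hV.aemeasurable hrad] with ω hω
    rw [norm_mul, norm_mul]
    exact mul_le_mul_of_nonneg_right (mul_le_mul_of_nonneg_right
      (abs_apply_le_of_norm_le hω k) (abs_nonneg _)) (norm_nonneg _)

/-- The second moment dynamics. -/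
theorem secondMoment_output [IsProbabilityMeasure μ] (hV : Measurable V) (hlaw : μ.map V = ν)
    (hrad : ∀ᵐ v ∂ν, ‖WithLp.toLp 2 (modelNoise A B M v)‖ ≤ rad)
    (hζ : ∀ j, MemLp (fun ω => ζ ω j) 2 μ) (hind : IndepFun ζ V μ) :
    secondMoment μ (fun ω i => ∑ k, ∑ j, modelNoise A B M (V ω) k * M i j k * ζ ω j) =
      momentOp M (trueMoment A B M ν) (secondMoment μ ζ) := by
  have hν : IsProbabilityMeasure ν := hlaw ▸ Measure.isProbabilityMeasure_map hV.aemeasurable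
  ext i i'
  have h : ∀ ω, (∑ k, ∑ j, modelNoise A B M (V ω) k * M i j k * ζ ω j) *
      (∑ k, ∑ j, modelNoise A B M (V ω) k * M i' j k * ζ ω j) =
      ∑ b : (Fin nx ⊕ Fin nu) × (Fin nx ⊕ Fin nu), ∑ c : Fin nw × Fin nw,
        (ζ ω b.1 * ζ ω b.2) * (modelNoise A B M (V ω) c.1 * modelNoise A B M (V ω) c.2) *
          (M i b.1 c.1 * M i' b.2 c.2) := by
    intro ω
    have := congrFun (congrFun (momentOp_vecMulVec M (modelNoise A B M (V ω)) (ζ ω)) i) i'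
    rw [momentOp_apply] at this
    exact this.symm
  have hmeas : ∀ c : Fin nw × Fin nw, Measurable fun v : Fin nv → ℝ =>
      modelNoise A B M v c.1 * modelNoise A B M v c.2 := fun c =>
    (measurable_pi_iff.1 measurable_modelNoise c.1).mul
      (measurable_pi_iff.1 measurable_modelNoise c.2)
  have hmeasζ : ∀ b : (Fin nx ⊕ Fin nu) × (Fin nx ⊕ Fin nu),
      Measurable fun z : Fin nx ⊕ Fin nu → ℝ => z b.1 * z b.2 := fun b =>
    (measurable_pi_apply b.1).mul (measurable_pi_apply b.2)
  have hi1 := integrable_mul_of_memLp hζ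
  have hi2 : ∀ c : Fin nw × Fin nw,
      Integrable (fun ω => modelNoise A B M (V ω) c.1 * modelNoise A B M (V ω) c.2) μ := fun c => by
    have := integrable_mul_noise measurable_modelNoise hrad c.1 c.2
    rw [← hlaw] at this
    exact this.comp_measurable hV
  -- Independence makes the product of two integrable quadratic terms integrable, so no fourth
  -- moments of the state are needed.
  have hindep : ∀ (b : (Fin nx ⊕ Fin nu) × (Fin nx ⊕ Fin nu)) (c : Fin nw × Fin nw),
      IndepFun (fun ω => ζ ω b.1 * ζ ω b.2)
        (fun ω => modelNoise A B M (V ω) c.1 * modelNoise A B M (V ω) c.2) μ := fun b c =>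
    hind.comp (hmeasζ b) (hmeas c)
  have hi : ∀ (b : (Fin nx ⊕ Fin nu) × (Fin nx ⊕ Fin nu)) (c : Fin nw × Fin nw),
      Integrable (fun ω => (ζ ω b.1 * ζ ω b.2) *
        (modelNoise A B M (V ω) c.1 * modelNoise A B M (V ω) c.2)) μ := fun b c =>
    (hindep b c).integrable_mul (hi1 b.1 b.2) (hi2 c)
  rw [momentOp_apply]
  simp only [secondMoment, h]
  rw [integral_finsetSum _ fun b _ => integrable_finsetSum _ fun c _ => (hi b c).mul_const _]
  refine Finset.sum_congr rfl fun b _ => ?_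
  rw [integral_finsetSum _ fun c _ => (hi b c).mul_const _]
  refine Finset.sum_congr rfl fun c _ => ?_
  rw [integral_mul_const]
  congr 1
  have h1 := (hindep b c).integral_mul_eq_mul_integral (hi1 b.1 b.2).aestronglyMeasurable
    (hi2 c).aestronglyMeasurable
  refine h1.trans ?_
  congr 1
  rw [trueMoment, ← hlaw, integral_map hV.aemeasurable (hmeas c).aestronglyMeasurable]

end OneStep

/-! ### The stochastic control problem and its moment relaxation -/

section Control

variable {nx nu nv nw : ℕ} {A : Fin nv → Matrix (Fin nx) (Fin nx) ℝ}
  {B : Fin nv → Matrix (Fin nx) (Fin nu) ℝ} {M : Tensor (Fin nx) (Fin nx ⊕ Fin nu) (Fin nw)}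
  {Ω : Type*} {mΩ : MeasurableSpace Ω} {μ : Measure Ω} {𝓕 : Filtration ℕ mΩ}
  {ν : Measure (Fin nv → ℝ)} {rad : ℝ} {x₀ : Ω → Fin nx → ℝ} {v : ℕ → Ω → Fin nv → ℝ}
  {u : ℕ → Ω → Fin nu → ℝ} {Q : Matrix (Fin nx) (Fin nx) ℝ} {R : Matrix (Fin nu) (Fin nu) ℝ}

/-- The trajectory of the pairs of a state and an input. -/
def inputState (A : Fin nv → Matrix (Fin nx) (Fin nx) ℝ) (B : Fin nv → Matrix (Fin nx) (Fin nu) ℝ)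
    (x₀ : Ω → Fin nx → ℝ) (v : ℕ → Ω → Fin nv → ℝ) (u : ℕ → Ω → Fin nu → ℝ) (t : ℕ) (ω : Ω) :
    Fin nx ⊕ Fin nu → ℝ :=
  Sum.elim (stateTraj A B x₀ v u t ω) (u t ω)

theorem stateTraj_succ (hM : ModelEquivalence A B M) (t : ℕ) (ω : Ω) :
    stateTraj A B x₀ v u (t + 1) ω =
      fun i => ∑ k, ∑ j, modelNoise A B M (v t ω) k * M i j k * inputState A B x₀ v u t ω j :=
  output_eq hM (v t ω) (inputState A B x₀ v u t ω)

theorem continuous_modeSum_mulVec {m n : Type} [Fintype n] (A : Fin nv → Matrix m n ℝ) :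
    Continuous fun p : (Fin nv → ℝ) × (n → ℝ) => modeSum A p.1 *ᵥ p.2 := by
  unfold modeSum
  exact (continuous_finsetSum _ fun i _ =>
    ((continuous_apply i).comp continuous_fst).smul continuous_const).matrix_mulVec continuous_snd

theorem IsControlSetting.measurable_stateTraj (h : IsControlSetting μ 𝓕 ν x₀ v)
    (hu : ∀ t, Measurable[𝓕 t] (u t)) (t : ℕ) : Measurable[𝓕 t] (stateTraj A B x₀ v u t) := by
  induction t with
  | zero => exact h.measurable_init
  | succ t ih =>
    have hle : 𝓕 t ≤ 𝓕 (t + 1) := 𝓕.mono t.le_succ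
    have h1 := (continuous_modeSum_mulVec A).measurable.comp
      ((h.measurable_v t).prodMk (ih.mono hle le_rfl))
    have h2 := (continuous_modeSum_mulVec B).measurable.comp
      ((h.measurable_v t).prodMk ((hu t).mono hle le_rfl))
    exact h1.add h2

theorem IsControlSetting.measurable_inputState (h : IsControlSetting μ 𝓕 ν x₀ v)
    (hu : ∀ t, Measurable[𝓕 t] (u t)) (t : ℕ) : Measurable[𝓕 t] (inputState A B x₀ v u t) := by
  have hc : Continuous fun p : (Fin nx → ℝ) × (Fin nu → ℝ) =>
      (Sum.elim p.1 p.2 : Fin nx ⊕ Fin nu → ℝ) := by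
    refine continuous_pi fun j => ?_
    rcases j with j | j
    · exact (continuous_apply j).comp continuous_fst
    · exact (continuous_apply j).comp continuous_snd
  exact hc.measurable.comp ((h.measurable_stateTraj hu t).prodMk (hu t))

theorem IsControlSetting.indepFun (h : IsControlSetting μ 𝓕 ν x₀ v)
    (hu : ∀ t, Measurable[𝓕 t] (u t)) (t : ℕ) :
    IndepFun (inputState A B x₀ v u t) (v t) μ := by
  rw [IndepFun_iff_Indep]
  exact indep_of_indep_of_le_left (h.indep t) (h.measurable_inputState hu t).comap_le

theorem IsControlSetting.measurable_noise (h : IsControlSetting μ 𝓕 ν x₀ v) (t : ℕ) :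
    Measurable (v t) := (h.measurable_v t).mono (𝓕.le _) le_rfl

/-- The second moments of a square integrable trajectory follow the moment dynamics. -/
theorem IsControlSetting.isFeasible [IsProbabilityMeasure μ] (h : IsControlSetting μ 𝓕 ν x₀ v)
    (hM : ModelEquivalence A B M)
    (hrad : ∀ᵐ v ∂ν, ‖WithLp.toLp 2 (modelNoise A B M v)‖ ≤ rad)
    (hu : ∀ t, Measurable[𝓕 t] (u t))
    (hL : ∀ t j, MemLp (fun ω => inputState A B x₀ v u t ω j) 2 μ) :
    IsFeasible M (trueMoment A B M ν) (initMoment μ x₀)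
      (fun t => secondMoment μ (inputState A B x₀ v u t)) := by
  refine ⟨fun t => posSemidef_secondMoment (integrable_mul_of_memLp (hL t)), rfl, fun t => ?_⟩
  rw [← secondMoment_output (h.measurable_noise t) (h.law_v t) hrad (hL t) (h.indepFun hu t)]
  ext i j
  change ∫ ω, stateTraj A B x₀ v u (t + 1) ω i * stateTraj A B x₀ v u (t + 1) ω j ∂μ = _
  simp only [stateTraj_succ hM]
  rfl

theorem stageCost_eq (x : Fin nx → ℝ) (y : Fin nu → ℝ) :
    x ⬝ᵥ Q *ᵥ x + y ⬝ᵥ R *ᵥ y =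
      ∑ i, ∑ j, Sum.elim x y i * Sum.elim x y j * fromBlocks Q 0 0 R j i := by
  have h := trace_mul_fromBlocks (vecMulVec (Sum.elim x y) (Sum.elim x y)) Q R
  rw [← trace_vecMulVec_mul, ← trace_vecMulVec_mul]
  exact h.symm

theorem stageCost_nonneg (hQ : Q.PosDef) (hR : R.PosDef) (x : Fin nx → ℝ) (y : Fin nu → ℝ) :
    0 ≤ x ⬝ᵥ Q *ᵥ x + y ⬝ᵥ R *ᵥ y := by
  have h1 := hQ.posSemidef.dotProduct_mulVec_nonneg x
  have h2 := hR.posSemidef.dotProduct_mulVec_nonneg y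
  rw [star_trivial] at h1 h2
  exact add_nonneg h1 h2

theorem IsControlSetting.measurable_stageCost (h : IsControlSetting μ 𝓕 ν x₀ v)
    (hu : ∀ t, Measurable[𝓕 t] (u t)) (t : ℕ) :
    Measurable fun ω => stateTraj A B x₀ v u t ω ⬝ᵥ Q *ᵥ stateTraj A B x₀ v u t ω +
      u t ω ⬝ᵥ R *ᵥ u t ω := by
  have hz := measurable_pi_iff.1 ((h.measurable_inputState (A := A) (B := B) hu t).mono
    (𝓕.le t) le_rfl)
  simp only [stageCost_eq]
  exact Finset.measurable_sum _ fun i _ => Finset.measurable_sum _ fun j _ =>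
    ((hz i).mul (hz j)).mul_const _

/-- The expected cost of a square integrable trajectory is the cost of its second moments. -/
theorem IsControlSetting.lintegral_cost (h : IsControlSetting μ 𝓕 ν x₀ v)
    (hQ : Q.PosDef) (hR : R.PosDef) (hu : ∀ t, Measurable[𝓕 t] (u t))
    (hL : ∀ t j, MemLp (fun ω => inputState A B x₀ v u t ω j) 2 μ) :
    ∫⁻ ω, ∑' t, ENNReal.ofReal
      (stateTraj A B x₀ v u t ω ⬝ᵥ Q *ᵥ stateTraj A B x₀ v u t ω + u t ω ⬝ᵥ R *ᵥ u t ω) ∂μ =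
      momentCost Q R (fun t => secondMoment μ (inputState A B x₀ v u t)) := by
  rw [lintegral_tsum fun t => (h.measurable_stageCost hu t).ennreal_ofReal.aemeasurable,
    momentCost]
  refine tsum_congr fun t => ?_
  have hi : ∀ i j, Integrable (fun ω => inputState A B x₀ v u t ω i *
      inputState A B x₀ v u t ω j * fromBlocks Q 0 0 R j i) μ := fun i j =>
    (integrable_mul_of_memLp (hL t) i j).mul_const _
  have he : ∀ ω, stateTraj A B x₀ v u t ω ⬝ᵥ Q *ᵥ stateTraj A B x₀ v u t ω +
      u t ω ⬝ᵥ R *ᵥ u t ω = ∑ i, ∑ j, inputState A B x₀ v u t ω i *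
        inputState A B x₀ v u t ω j * fromBlocks Q 0 0 R j i := fun ω => stageCost_eq _ _
  have hint : Integrable (fun ω => stateTraj A B x₀ v u t ω ⬝ᵥ Q *ᵥ stateTraj A B x₀ v u t ω +
      u t ω ⬝ᵥ R *ᵥ u t ω) μ := by
    simp only [he]
    exact integrable_finsetSum _ fun i _ => integrable_finsetSum _ fun j _ => hi i j
  rw [← ofReal_integral_eq_lintegral_ofReal hint
    (Filter.Eventually.of_forall fun ω => stageCost_nonneg hQ hR _ _)]
  congr 1
  simp only [he]
  rw [integral_finsetSum _ fun i _ => integrable_finsetSum _ fun j _ => hi i j]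
  refine Finset.sum_congr rfl fun i _ => ?_
  rw [integral_finsetSum _ fun j _ => hi i j]
  exact Finset.sum_congr rfl fun j _ => integral_mul_const _ _

theorem exists_sq_le {n : Type} [Fintype n] [DecidableEq n] {S : Matrix n n ℝ} (hS : S.PosDef) :
    ∃ c : ℝ, ∀ (x : n → ℝ) (i : n), x i ^ 2 ≤ c * (x ⬝ᵥ S *ᵥ x) := by
  obtain ⟨a, ha, h⟩ := exists_sub_smul_one_posSemidef hS
  refine ⟨a⁻¹, fun x i => ?_⟩
  have h1 := h.dotProduct_mulVec_nonneg x
  rw [star_trivial, sub_mulVec, dotProduct_sub, smul_mulVec, one_mulVec, dotProduct_smul,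
    smul_eq_mul] at h1
  have h2 : x i ^ 2 ≤ x ⬝ᵥ x := by
    rw [pow_two]
    exact Finset.single_le_sum (f := fun j => x j * x j) (fun j _ => mul_self_nonneg (x j))
      (Finset.mem_univ i)
  rw [le_inv_mul_iff₀ ha]
  nlinarith

/-- A trajectory of finite cost is square integrable. -/
theorem IsControlSetting.memLp_of_lintegral_ne_top (h : IsControlSetting μ 𝓕 ν x₀ v)
    (hQ : Q.PosDef) (hR : R.PosDef) (hu : ∀ t, Measurable[𝓕 t] (u t))
    (hfin : ∫⁻ ω, ∑' t, ENNReal.ofReal (stateTraj A B x₀ v u t ω ⬝ᵥ Q *ᵥ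
      stateTraj A B x₀ v u t ω + u t ω ⬝ᵥ R *ᵥ u t ω) ∂μ ≠ ⊤) (t : ℕ) (j : Fin nx ⊕ Fin nu) :
    MemLp (fun ω => inputState A B x₀ v u t ω j) 2 μ := by
  have hint : Integrable (fun ω => stateTraj A B x₀ v u t ω ⬝ᵥ Q *ᵥ stateTraj A B x₀ v u t ω +
      u t ω ⬝ᵥ R *ᵥ u t ω) μ := by
    refine ⟨(h.measurable_stageCost hu t).aestronglyMeasurable, ?_⟩
    rw [hasFiniteIntegral_iff_ofReal
      (Filter.Eventually.of_forall fun ω => stageCost_nonneg hQ hR _ _)]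
    refine lt_of_le_of_lt (lintegral_mono fun ω => ?_) hfin.lt_top
    exact ENNReal.le_tsum (f := fun t => ENNReal.ofReal (stateTraj A B x₀ v u t ω ⬝ᵥ Q *ᵥ
      stateTraj A B x₀ v u t ω + u t ω ⬝ᵥ R *ᵥ u t ω)) t
  have hz := measurable_pi_iff.1 ((h.measurable_inputState (A := A) (B := B) hu t).mono
    (𝓕.le t) le_rfl) j
  rw [memLp_two_iff_integrable_sq hz.aestronglyMeasurable]
  obtain ⟨c, hc⟩ := exists_sq_le hQ
  obtain ⟨d, hd⟩ := exists_sq_le hR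
  refine (hint.const_mul (max (max c d) 0)).mono' (hz.pow_const 2).aestronglyMeasurable
    (Filter.Eventually.of_forall fun ω => ?_)
  rw [Real.norm_eq_abs, abs_of_nonneg (sq_nonneg _)]
  have h1 := hQ.posSemidef.dotProduct_mulVec_nonneg (stateTraj A B x₀ v u t ω)
  have h2 := hR.posSemidef.dotProduct_mulVec_nonneg (u t ω)
  rw [star_trivial] at h1 h2
  rw [mul_add]
  have h3 : 0 ≤ max (max c d) 0 := le_max_right _ _
  rcases j with i | i
  · refine (hc (stateTraj A B x₀ v u t ω) i).trans ?_
    have := mul_le_mul_of_nonneg_right ((le_max_left c d).trans (le_max_left _ 0)) h1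
    have := mul_nonneg h3 h2
    linarith
  · refine (hd (u t ω) i).trans ?_
    have := mul_le_mul_of_nonneg_right ((le_max_right c d).trans (le_max_left _ 0)) h2
    have := mul_nonneg h3 h1
    linarith

/-- An input of finite cost makes the trajectory square integrable, and its second moments are then
feasible for the moment problem at the same cost. -/
theorem IsControlSetting.valCP_le_valSLQR [IsProbabilityMeasure μ]
    (h : IsControlSetting μ 𝓕 ν x₀ v) (hM : ModelEquivalence A B M)
    (hrad : ∀ᵐ v ∂ν, ‖WithLp.toLp 2 (modelNoise A B M v)‖ ≤ rad)
    (hQ : Q.PosDef) (hR : R.PosDef) :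
    valCP M Q R (trueMoment A B M ν) (initMoment μ x₀) ≤ valSLQR μ 𝓕 A B Q R x₀ v := by
  refine le_iInf₂ fun u hu => ?_
  by_cases hfin : ∫⁻ ω, ∑' t, ENNReal.ofReal (stateTraj A B x₀ v u t ω ⬝ᵥ Q *ᵥ
      stateTraj A B x₀ v u t ω + u t ω ⬝ᵥ R *ᵥ u t ω) ∂μ = ⊤
  · rw [hfin]; exact le_top
  · have hL := h.memLp_of_lintegral_ne_top hQ hR hu hfin
    rw [h.lintegral_cost hQ hR hu hL]
    exact iInf₂_le _ (h.isFeasible hM hrad hu hL)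

/-- The state trajectory under linear feedback. -/
def feedbackTraj (A : Fin nv → Matrix (Fin nx) (Fin nx) ℝ)
    (B : Fin nv → Matrix (Fin nx) (Fin nu) ℝ) (x₀ : Ω → Fin nx → ℝ) (v : ℕ → Ω → Fin nv → ℝ)
    (K : Matrix (Fin nu) (Fin nx) ℝ) : ℕ → Ω → Fin nx → ℝ
  | 0 => x₀
  | t + 1 => fun ω => modeSum A (v t ω) *ᵥ feedbackTraj A B x₀ v K t ω +
      modeSum B (v t ω) *ᵥ (K *ᵥ feedbackTraj A B x₀ v K t ω)

/-- The feedback input depends on the trajectory that it generates. Defining `feedbackTraj` on its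
own avoids the circularity, and this identity closes the loop. -/
theorem stateTraj_feedback (K : Matrix (Fin nu) (Fin nx) ℝ) (t : ℕ) :
    stateTraj A B x₀ v (fun t ω => K *ᵥ feedbackTraj A B x₀ v K t ω) t =
      feedbackTraj A B x₀ v K t := by
  induction t with
  | zero => rfl
  | succ t ih => rw [stateTraj, feedbackTraj, ih]

theorem IsControlSetting.measurable_feedbackTraj (h : IsControlSetting μ 𝓕 ν x₀ v)
    (K : Matrix (Fin nu) (Fin nx) ℝ) (t : ℕ) : Measurable[𝓕 t] (feedbackTraj A B x₀ v K t) := by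
  induction t with
  | zero => exact h.measurable_init
  | succ t ih =>
    have hle : 𝓕 t ≤ 𝓕 (t + 1) := 𝓕.mono t.le_succ
    have hK : Continuous fun x : Fin nx → ℝ => K *ᵥ x :=
      continuous_const.matrix_mulVec continuous_id
    have h1 := (continuous_modeSum_mulVec A).measurable.comp
      ((h.measurable_v t).prodMk (ih.mono hle le_rfl))
    have h2 := (continuous_modeSum_mulVec B).measurable.comp
      ((h.measurable_v t).prodMk (hK.measurable.comp (ih.mono hle le_rfl)))
    exact h1.add h2

theorem inputState_feedback (K : Matrix (Fin nu) (Fin nx) ℝ) (t : ℕ) :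
    inputState A B x₀ v (fun t ω => K *ᵥ feedbackTraj A B x₀ v K t ω) t =
      fun ω => fromRows (1 : Matrix (Fin nx) (Fin nx) ℝ) K *ᵥ feedbackTraj A B x₀ v K t ω := by
  ext ω j
  rw [fromRows_mulVec, one_mulVec, inputState, stateTraj_feedback]

theorem IsControlSetting.memLp_feedbackTraj (h : IsControlSetting μ 𝓕 ν x₀ v)
    (hM : ModelEquivalence A B M)
    (hrad : ∀ᵐ v ∂ν, ‖WithLp.toLp 2 (modelNoise A B M v)‖ ≤ rad)
    (K : Matrix (Fin nu) (Fin nx) ℝ) (t : ℕ) (i : Fin nx) :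
    MemLp (fun ω => feedbackTraj A B x₀ v K t ω i) 2 μ := by
  induction t generalizing i with
  | zero => exact h.memLp_init i
  | succ t ih =>
    have hz : ∀ j, MemLp (fun ω => inputState A B x₀ v
        (fun t ω => K *ᵥ feedbackTraj A B x₀ v K t ω) t ω j) 2 μ := by
      intro j
      rw [inputState_feedback]
      exact memLp_mulVec ih _ j
    have := memLp_output (h.measurable_noise t) (h.law_v t) hrad hz i
    rw [← stateTraj_feedback]
    simpa only [stateTraj_succ hM] using this

/-- Under linear feedback the joint moment of state and input is `Π_K` of the state moment, so the
moments follow the optimal policy of the moment problem. -/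
theorem IsControlSetting.valSLQR_le [IsProbabilityMeasure μ]
    (h : IsControlSetting μ 𝓕 ν x₀ v) (hM : ModelEquivalence A B M)
    (hrad : ∀ᵐ v ∂ν, ‖WithLp.toLp 2 (modelNoise A B M v)‖ ≤ rad)
    (hQ : Q.PosDef) (hR : R.PosDef) {P : Matrix (Fin nx) (Fin nx) ℝ}
    {K : Matrix (Fin nu) (Fin nx) ℝ} (hW : (trueMoment A B M ν).PosSemidef)
    (hP : IsRiccatiPair M Q R (trueMoment A B M ν) P K) :
    valSLQR μ 𝓕 A B Q R x₀ v ≤ ENNReal.ofReal (P * initMoment μ x₀).trace := by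
  set u : ℕ → Ω → Fin nu → ℝ := fun t ω => K *ᵥ feedbackTraj A B x₀ v K t ω with hudef
  have hu : ∀ t, Measurable[𝓕 t] (u t) := fun t =>
    (continuous_const.matrix_mulVec continuous_id : Continuous fun x : Fin nx → ℝ =>
      K *ᵥ x).measurable.comp (h.measurable_feedbackTraj K t)
  have hF := h.memLp_feedbackTraj hM hrad K
  have hL : ∀ t j, MemLp (fun ω => inputState A B x₀ v u t ω j) 2 μ := by
    intro t j
    rw [inputState_feedback]
    exact memLp_mulVec (hF t) _ j
  refine (iInf₂_le u hu).trans ?_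
  rw [h.lintegral_cost hQ hR hu hL]
  refine hP.momentCost_le hQ hR hW (h.isFeasible hM hrad hu hL) fun t => ?_
  have h1 : secondMoment μ (inputState A B x₀ v u t) =
      policyOp K (secondMoment μ (feedbackTraj A B x₀ v K t)) := by
    rw [inputState_feedback, secondMoment_mulVec (hF t), policyOp_eq]
  change secondMoment μ (inputState A B x₀ v u t) =
    policyOp K (secondMoment μ (inputState A B x₀ v u t)).toBlocks₁₁
  rw [h1, toBlocks₁₁_policyOp]

end Control

end MultNoise

/-! ### The main theorem -/

theorem mainTheorem5 {nx nu nv nw N : ℕ}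
    -- the true system, the law of its disturbance, and the mode tensor of the model
    (A : Fin nv → Matrix (Fin nx) (Fin nx) ℝ) (B : Fin nv → Matrix (Fin nx) (Fin nu) ℝ)
    (ν : Measure (Fin nv → ℝ)) (M : Tensor (Fin nx) (Fin nx ⊕ Fin nu) (Fin nw))
    (hM : ModelEquivalence A B M)
    (rad : ℝ) (hrad : ∀ᵐ v ∂ν, ‖WithLp.toLp 2 (modelNoise A B M v)‖ ≤ rad)
    -- the weights of the cost
    (Q : Matrix (Fin nx) (Fin nx) ℝ) (R : Matrix (Fin nu) (Fin nu) ℝ)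
    (hQ : Q.PosDef) (hR : R.PosDef)
    -- the data
    {Ω : Type*} [MeasurableSpace Ω] (Pr : Measure Ω) [IsProbabilityMeasure Pr]
    (z : Fin N → Ω → Fin nx ⊕ Fin nu → ℝ) (v : Fin N → Ω → Fin nv → ℝ)
    (y : Fin N → Ω → Fin nx → ℝ) (hdata : IsSample Pr A B ν z v y)
    (hN : (nx + nu) * (nx + nu + 1) / 2 ≤ N)
    (δ : ℝ) (hδ : 0 < δ) (hδ' : δ < 1)
    -- the stochastic control problem
    {Ω' : Type*} [mΩ' : MeasurableSpace Ω'] (μ : Measure Ω') [IsProbabilityMeasure μ]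
    (𝓕 : Filtration ℕ mΩ') (x₀ : Ω' → Fin nx → ℝ) (v' : ℕ → Ω' → Fin nv → ℝ)
    (hctrl : IsControlSetting μ 𝓕 ν x₀ v') :
    ∃ G : Set Ω, MeasurableSet G ∧ ENNReal.ofReal (1 - δ) ≤ Pr G ∧ ∀ ω ∈ G,
      let W₁ := lowerW M rad δ (fun i => z i ω) (fun i => y i ω)
      let W₂ := upperW M rad δ (fun i => z i ω) (fun i => y i ω)
      let Wtrue := trueMoment A B M ν
      let X₀ := initMoment μ x₀
      (∃ K : Matrix (Fin nu) (Fin nx) ℝ, ∀ W : Matrix (Fin nw) (Fin nw) ℝ,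
        Between W₁ W₂ W → rho (closedLoop M W K) < 1) →
      (∃! PK : Matrix (Fin nx) (Fin nx) ℝ × Matrix (Fin nu) (Fin nx) ℝ,
        IsRiccatiPair M Q R W₂ PK.1 PK.2) ∧
      (∀ (P : Matrix (Fin nx) (Fin nx) ℝ) (K : Matrix (Fin nu) (Fin nx) ℝ),
        IsRiccatiPair M Q R W₂ P K → rho (closedLoop M Wtrue K) < 1) ∧
      valCP M Q R Wtrue X₀ ≤ valDR M Q R W₁ W₂ X₀ ∧
      valCP M Q R Wtrue X₀ = valSLQR μ 𝓕 A B Q R x₀ v' := by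
  have hν : IsProbabilityMeasure ν := by
    rw [← hctrl.law_v 0]
    exact Measure.isProbabilityMeasure_map (hctrl.measurable_noise 0).aemeasurable
  obtain ⟨G, hG, hPr, hgood⟩ := hdata.exists_good_event hM hrad hN hδ hδ'
  refine ⟨G, hG, hPr, fun ω hω => ?_⟩
  obtain ⟨W', hW's, hb, hW'⟩ := hgood ω hω
  intro W₁ W₂ Wtrue X₀ hfeas
  obtain ⟨K₀, hK₀⟩ := hfeas
  have hβ : 0 ≤ betaW M rad δ (fun i => z i ω) := betaW_nonneg M rad δ _
  have hW₁₂ : (W₂ - W₁).PosSemidef := by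
    have h1 := (PosSemidef.one (n := Fin nw) (R := ℝ)).smul (add_nonneg hβ hβ)
    convert h1 using 1
    simp only [W₁, W₂, lowerW, upperW, add_smul]
    abel
  have hW₂s : W₂.IsSymm := by
    have h1 := (isSymm_of_posSemidef hb.2).add hW's
    rwa [sub_add_cancel] at h1
  have hWtrue : Wtrue.PosSemidef :=
    posSemidef_secondMoment (integrable_mul_noise measurable_modelNoise hrad)
  have hX₀ : X₀.PosSemidef := posSemidef_secondMoment (integrable_mul_of_memLp hctrl.memLp_init)
  -- `W₂` need not be positive semidefinite, so the Riccati theory does not apply to it directly.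
  -- Replacing `W'` by the true moment inside `W₂ = W' + (W₂ - W')` keeps the dynamics on symmetric
  -- matrices and gives a positive semidefinite matrix above the true moment.
  set W₃ := Wtrue + (W₂ - W') with hW₃
  have hW₃psd : W₃.PosSemidef := hWtrue.add hb.2
  have hW₃le : (W₃ - Wtrue).PosSemidef := by
    rw [hW₃, add_sub_cancel_left]
    exact hb.2
  have hW₃s := isSymm_of_posSemidef hW₃psd
  have hcongr : ∀ Z : Matrix (Fin nx ⊕ Fin nu) (Fin nx ⊕ Fin nu) ℝ, Z.IsSymm →
      momentOp M W₂ Z = momentOp M W₃ Z := by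
    intro Z hZ
    have h1 := hW' Z hZ
    simp only [← momentLin_apply] at h1 ⊢
    rw [hW₃, map_add, map_sub, LinearMap.add_apply, LinearMap.sub_apply, h1]
    abel
  have hric : ∀ P K, IsRiccatiPair M Q R W₂ P K ↔ IsRiccatiPair M Q R W₃ P K := fun P K =>
    isRiccatiPair_congr hW₂s hW₃s hcongr
  -- The feasible gain is used at two members of the interval: at its upper end, which has the
  -- dynamics of `W₃`, and at `W'`, which has the true dynamics.
  have hrho₃ : rho (closedLoop M W₃ K₀) < 1 := by
    rw [← rho_closedLoop_congr hcongr]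
    exact hK₀ W₂ ⟨hW₁₂, by rw [sub_self]; exact PosSemidef.zero⟩
  have hrhoTrue : rho (closedLoop M Wtrue K₀) < 1 := by
    rw [← rho_closedLoop_congr hW']
    exact hK₀ W' hb
  refine ⟨?_, fun P K h => ?_, valCP_le_valDR hWtrue hX₀ hb hW', ?_⟩
  · obtain ⟨P, K, hP⟩ := exists_isRiccatiPair hQ hR hW₃psd K₀ fun X hX =>
      summable_policy_cost hW₃s hrho₃ _ (isSymm_of_posSemidef hX)
    refine ⟨(P, K), (hric P K).2 hP, fun PK hPK => ?_⟩
    obtain ⟨h1, h2⟩ := ((hric PK.1 PK.2).1 hPK).unique hP hQ hR hW₃psd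
    exact Prod.ext h1 h2
  · exact (((hric P K).1 h).isStable_of_le hQ hR hW₃psd hWtrue hW₃le).rho_lt_one
      (isSymm_of_posSemidef hWtrue)
  · obtain ⟨P, K, hP⟩ := exists_isRiccatiPair hQ hR hWtrue K₀ fun X hX =>
      summable_policy_cost (isSymm_of_posSemidef hWtrue) hrhoTrue _ (isSymm_of_posSemidef hX)
    -- For the Riccati solution `P` of the true dynamics, both values are squeezed onto `tr(P X₀)`.
    exact le_antisymm (hctrl.valCP_le_valSLQR hM hrad hQ hR)
      ((hctrl.valSLQR_le hM hrad hQ hR hWtrue hP).trans (hP.le_valCP hQ hR hWtrue))
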